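/- **Formal functions.** For $\rho\in\mathbb C$ let $E_\rho$ be the space of formal functions $f=\sum_{\alpha\in S}\sum_{j\in T}\sum_{n\ge 0}c_{\alpha,j,n}(z-\rho)^{n+\alpha}(\log(z-\rho))^j$, with $S\subset\mathbb C$ and $T\subset\mathbb N$ finite, and let $E_\infty$ be the space of formal functions $\sum_{\alpha\in S}\sum_{j\in T}\sum_{n\ge 0}c_{\alpha,j,n}x^{-n-\alpha-1}(\log(1/x))^j$. We always take $\alpha-\alpha'\notin\mathbb Z$ for distinct $\alpha,\alpha'\in S$. The Nilsson classes $\mathcal N_\rho\subset E_\rho$ and $\mathcal N_\infty\subset E_\infty$ consist of those $f$ for which all the power series $\sum_n c_{\alpha,j,n}X^n$ have a positive radius of convergence. **Operators.** Write $\{u+iv\}=(u-\lfloor u\rfloor)+iv$ for real $u,v$, and $\widehat\Gamma=1/\Gamma$. Derivatives in $y$ at $\alpha$ of functions involving $\{y\}$ are taken at the right of $\alpha$ ($\operatorname{Re}y>\operatorname{Re}\alpha$) when $\operatorname{Re}\alpha\in\mathbb Z$. Put $$L\big(z^\alpha(\log z)^j\big)=\sum_{k=0}^j\binom jk\frac{d^{j-k}}{dy^{j-k}}\Big(\frac{\Gamma(1-\{y\})}{\Gamma(-y)}\Big)_{|y=\alpha}x^{-\alpha-1}(\log(1/x))^k,$$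 $$\mathcal T\big(e^{\rho x}x^{-\alpha-1}(\log(1/x))^j\big)=e^{\rho x}x^{-\alpha-1}\sum_{i=0}^j(-1)^{j-i}\binom ji\widehat\Gamma^{(j-i)}(1-\{\alpha\})(\log(1/x))^i .$$ The following operators are defined term by term. $L_\rho:E_\rho\to e^{\rho x}E_\infty$ maps $(z-\rho)^\alpha(\log(z-\rho))^j$ to $e^{\rho x}L(z^\alpha(\log z)^j)$. $T_\infty:e^{\rho x}E_\infty\to e^{\rho x}E_\infty$ is given by $\mathcal T$. $L_\infty:E_\infty\to E_0$ maps $z^{-\alpha-1}(\log(1/z))^j$ to $(-1)^jL(z^{-\alpha-1}(\log z)^j)$. $T_0:E_0\to E_0$ maps $x^\alpha(\log x)^j$ to $(-1)^j\mathcal T(x^\alpha(\log(1/x))^j)$. Here $\log(1/x)=-\log x$ throughout. **(1)** Let $\rho\in\mathbb C$, $\theta\in\mathbb R$, $f\in\mathcal N_\rho$, $r>0$, $\varepsilon>0$ and $0\le\delta\le\varepsilon$. Points $z\ne\rho$ are considered on the Riemann surface of $\log(z-\rho)$, so that $\arg(z-\rho)$ is any real number. Assume that the expansion of $f$ converges for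 $0<|z-\rho|<r$, $|\arg(z-\rho)+\theta|<\pi+\delta$, and that $f$ continues analytically from there to the two sectors $$U_1:\ -\theta-\pi-\delta<\arg(z-\rho)<-\theta-\pi+\varepsilon,\qquad U_2:\ -\theta+\pi-\varepsilon<\arg(z-\rho)<-\theta+\pi+\delta$$ ($z\neq\rho$) along the two banks of the cut, with sub-exponential growth: for every $\eta>0$ there is $c>0$ with $|f(z)|\le c\,e^{\eta|z|}$ for all $z\in U_1\cup U_2$ with $|z|\ge|\rho|+1$. Let $x\neq 0$ with $|\arg x-\theta|<\frac\pi2+\delta$. Let $\Gamma_\rho$ be a path that comes from infinity along the ray $\arg(z-\rho)=\varphi_1$ to the circle $|z-\rho|=\kappa$ with $0<\kappa<r$, follows this circle from the argument $\varphi_1$ to the argument $\varphi_2$, and returns to infinity along the ray $\arg(z-\rho)=\varphi_2$. The rays are required to lie in $U_1$ and $U_2$ respectively, with $|\arg x+\varphi_1+\pi|<\frac\pi2$ and $|\arg x+\varphi_2-\pi|<\frac\pi2$. Then the integral $$F(x)=\frac1{2i\pi}\int_{\Gamma_\rho}f(z)e^{xz}\,dz$$ converges absolutely, and $F(x)$ does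 not depend on $\kappa,\varphi_1,\varphi_2$. Moreover, for every $\psi<\frac\pi2+\delta$, $T_\infty L_\rho f$ is the asymptotic expansion of $F$ as $|x|\to\infty$ in the sector $|\arg x-\theta|\le\psi$, in the following sense. Writing $T_\infty L_\rho f=e^{\rho x}\sum_{\alpha\in S}\sum_{j\in T}\sum_{n\ge0}a_{\alpha,j,n}x^{-n-\alpha-1}(\log(1/x))^j$, there are $R,B,C>0$ such that $F$ is holomorphic for $|x|\ge R$, $|\arg x-\theta|\le\psi$, and there, for all $N\ge1$, $$\Big|e^{-\rho x}F(x)-\sum_{\alpha\in S}\sum_{j\in T}\sum_{n=0}^{N-1}a_{\alpha,j,n}x^{-n-\alpha-1}(\log(1/x))^j\Big|\le C^N N!\,|x|^{B-N}.$$ In particular, if $\delta>0$, this is an asymptotic expansion in a large sector bisected by $\theta$, i.e. a sector $|\arg x-\theta|<\frac\pi2+\varepsilon'$ with $\varepsilon'>0$. **(2)** Let $\theta\in\mathbb R$ and $f\in\mathcal N_\infty$. Then $T_0L_\infty f\in E_0$, and in its expansion all the power series $\sum_n c_{\alpha,j,n}x^n$ are entire. The expansion of $f(z)$ converges absolutely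 for $|z|$ large and, with $\log z=\log|z|+i\arg z$, defines $f$ there. For all $x\ne0$ with $\theta-\frac\pi2<\arg x<\theta+\frac\pi2$, $$(T_0L_\infty f)(x)=\lim_{R\to+\infty}\frac1{2i\pi}\int_{\Gamma'_R}f(z)e^{xz}\,dz,$$ where the series on the left converges absolutely and $\Gamma'_R$ is the positively oriented circle $|z|=R$, $-\theta-\pi<\arg z<-\theta+\pi$. -/

import Mathlib

open Filter Topology

/-! ### Formal functions with complex exponents and logarithms

A family `a : ℂ → Polynomial ℂ` encodes a formal function through its coefficients, which makes the
expansion canonical (two expansions are equal iff their coefficients are).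

* At a finite point `ρ` it encodes `∑_β (z - ρ) ^ β * a_β (log (z - ρ))`.
* At infinity it encodes `∑_β x ^ (-β - 1) * a_β (log (1 / x))`.

In both cases `IsLogSeries` says that the exponents `β` lie in finitely many progressions `α + ℕ`,
and that finitely many powers of the logarithm occur. -/

/-- The spaces `E_ρ` and `E_∞` of formal functions. -/
def IsLogSeries (a : ℂ → Polynomial ℂ) : Prop :=
  ∃ (S : Finset ℂ) (T : Finset ℕ), ∀ (β : ℂ) (j : ℕ), (a β).coeff j ≠ 0 →
    j ∈ T ∧ ∃ α ∈ S, ∃ n : ℕ, β = α + n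

/-- The power series `∑ c n X ^ n` has a positive radius of convergence. -/
def HasPosRadius (c : ℕ → ℂ) : Prop :=
  ∃ r : ℝ, 0 < r ∧ Summable fun n => ‖c n‖ * r ^ n

/-- The power series `∑ c n X ^ n` has an infinite radius of convergence. -/
def IsEntireSeries (c : ℕ → ℂ) : Prop :=
  ∀ r : ℝ, 0 < r → Summable fun n => ‖c n‖ * r ^ n

/-- The Nilsson classes `𝒩_ρ` and `𝒩_∞`: all the power series involved have a positive radius of
convergence (in `z - ρ`, respectively in `1 / x`). -/
def IsNilsson (a : ℂ → Polynomial ℂ) : Prop :=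
  IsLogSeries a ∧ ∀ (α : ℂ) (j : ℕ), HasPosRadius fun n => (a (α + n)).coeff j

/-- The term of exponent `β` of a formal function at a finite point `ρ`, as a function of a
determination `w` of `log (z - ρ)`. -/
noncomputable def finTerm (a : ℂ → Polynomial ℂ) (w β : ℂ) : ℂ :=
  Complex.exp (β * w) * (a β).eval w

/-- The term of exponent `- β - 1` of a formal function at infinity, as a function of a
determination `w` of `log x`; one has `log (1 / x) = - w`. -/
noncomputable def infTerm (a : ℂ → Polynomial ℂ) (w β : ℂ) : ℂ :=
  Complex.exp (-(β + 1) * w) * (a β).eval (-w)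

/-! ### The formal operators -/

/-- `{u + iv} = Frac(u) + iv`. -/
noncomputable def fracC (y : ℂ) : ℂ := y - (⌊y.re⌋ : ℂ)

/-- `y ↦ Γ(1 - {y}) / Γ(- y)`, where the integer part of `Re y` is frozen to the one of `Re α`. It
is holomorphic on `Re y < ⌊Re α⌋ + 1`. -/
noncomputable def gammaQuot (α y : ℂ) : ℂ :=
  Complex.Gamma (1 - (y - (⌊α.re⌋ : ℂ))) * (Complex.Gamma (-y))⁻¹

/-- Near `α` and with `Re y ≥ Re α`, the frozen function is `Γ(1 - {y}) / Γ(- y)`. If `Re α` is not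
an integer this holds in a full neighbourhood of `α`. So the derivatives of `gammaQuot α` at `α` are
the derivatives of `Γ(1 - {y}) / Γ(- y)` at `α`, taken at the right of `α` if `Re α` is an
integer. -/
theorem gammaQuot_eq {α y : ℂ} (h : ⌊y.re⌋ = ⌊α.re⌋) :
    gammaQuot α y = Complex.Gamma (1 - fracC y) / Complex.Gamma (-y) := by
  rw [gammaQuot, fracC, h, div_eq_mul_inv]

/-- The polynomial in `log (1 / x)` such that the rational inverse Laplace transform of
`z ^ α * (log z) ^ j` is `x ^ (- α - 1)` times this polynomial. -/
noncomputable def laplaceMono (α : ℂ) (j : ℕ) : Polynomial ℂ :=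
  ∑ k ∈ Finset.range (j + 1),
    Polynomial.C ((j.choose k : ℂ) * iteratedDeriv (j - k) (gammaQuot α) α) * Polynomial.X ^ k

/-- The polynomial in `log (1 / x)` such that the operator `𝒯` maps
`x ^ (- α - 1) * (log (1 / x)) ^ j` to `x ^ (- α - 1)` times this polynomial. -/
noncomputable def gammaMono (α : ℂ) (j : ℕ) : Polynomial ℂ :=
  ∑ i ∈ Finset.range (j + 1),
    Polynomial.C ((-1) ^ (j - i) * (j.choose i : ℂ) *
      iteratedDeriv (j - i) (fun s => (Complex.Gamma s)⁻¹) (1 - fracC α)) * Polynomial.X ^ i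

/-- Linear extension to formal functions of an operator given on the powers of the logarithm: the
`j`-th power at the exponent index `β` is mapped to `m β j` at the same index. -/
noncomputable def extendMono (m : ℂ → ℕ → Polynomial ℂ) (a : ℂ → Polynomial ℂ) :
    ℂ → Polynomial ℂ :=
  fun β => (a β).sum fun j c => c • m β j

/-- `L_ρ : E_ρ → e^{ρx} E_∞`, without the factor `e^{ρx}` of the image. The term
`(z - ρ) ^ β * (log (z - ρ)) ^ j` goes to `e^{ρx} * x ^ (- β - 1) * laplaceMono β j (log (1 / x))`. -/
noncomputable def laplaceFin : (ℂ → Polynomial ℂ) → ℂ → Polynomial ℂ :=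
  extendMono laplaceMono

/-- `T_∞` on `e^{ρx} E_∞`, without the factor `e^{ρx}`. -/
noncomputable def gammaOpInf : (ℂ → Polynomial ℂ) → ℂ → Polynomial ℂ :=
  extendMono gammaMono

/-- `L_∞ : E_∞ → E_0`. As `(log (1 / z)) ^ j = (-1) ^ j * (log z) ^ j`, the term
`z ^ (- β - 1) * (log (1 / z)) ^ j` goes to
`(-1) ^ j * x ^ β * laplaceMono (- β - 1) j (log (1 / x))`, and `log (1 / x) = - log x`. -/
noncomputable def laplaceInf : (ℂ → Polynomial ℂ) → ℂ → Polynomial ℂ :=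
  extendMono fun β j => (-1 : ℂ) ^ j • (laplaceMono (-β - 1) j).comp (-Polynomial.X)

/-- `T_0 : E_0 → E_0`. As `(log x) ^ j = (-1) ^ j * (log (1 / x)) ^ j`, the term
`x ^ β * (log x) ^ j` goes to `(-1) ^ j * x ^ β * gammaMono (- β - 1) j (log (1 / x))`, and
`log (1 / x) = - log x`. -/
noncomputable def gammaOpZero : (ℂ → Polynomial ℂ) → ℂ → Polynomial ℂ :=
  extendMono fun β j => (-1 : ℂ) ^ j • (gammaMono (-β - 1) j).comp (-Polynomial.X)

/-! ### Integrals

The Riemann surface of `log (z - ρ)` is parametrised by `w = log (z - ρ)`, so that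
`z = ρ + exp w` and `Im w = arg (z - ρ)`; similarly `x = exp u` and `Im u = arg x`. -/

/-- The integrand of `∫ f(z) e^{xz} dz` on the ray `z = ρ + t e^{iφ}`, where `x = exp u` and where
`f` is a function of `log (z - ρ) = log t + iφ`. -/
noncomputable def rayIntegrand (f : ℂ → ℂ) (ρ u : ℂ) (φ t : ℝ) : ℂ :=
  f (Real.log t + φ * Complex.I) *
    Complex.exp (Complex.exp u * (ρ + t * Complex.exp (φ * Complex.I))) *
    Complex.exp (φ * Complex.I)

/-- `∫ f(z) e^{xz} dz` over the arc `z = ρ + κ e^{iτ}`, `τ` going from `φ₁` to `φ₂`. -/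
noncomputable def arcIntegral (f : ℂ → ℂ) (ρ u : ℂ) (κ φ₁ φ₂ : ℝ) : ℂ :=
  ∫ τ in φ₁..φ₂, f (Real.log κ + τ * Complex.I) *
    Complex.exp (Complex.exp u * (ρ + κ * Complex.exp (τ * Complex.I))) *
    (κ * Complex.exp (τ * Complex.I) * Complex.I)

/-- `(1 / 2iπ) ∫ f(z) e^{xz} dz` over the Hankel contour around `ρ` that comes from infinity along
the ray of argument `φ₁`, turns on the circle of radius `κ` from the argument `φ₁` to `φ₂`, and goes
back to infinity along the ray of argument `φ₂`. -/
noncomputable def hankelIntegral (f : ℂ → ℂ) (ρ u : ℂ) (κ φ₁ φ₂ : ℝ) : ℂ :=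
  (2 * Complex.I * Real.pi)⁻¹ *
    (-(∫ t in Set.Ioi κ, rayIntegrand f ρ u φ₁ t) + arcIntegral f ρ u κ φ₁ φ₂ +
      ∫ t in Set.Ioi κ, rayIntegrand f ρ u φ₂ t)

/-- The part `-θ - π - δ < arg (z - ρ) < -θ - π + ε` (first bank) or
`-θ + π - ε < arg (z - ρ) < -θ + π + δ` (second bank) of the Riemann surface of `log (z - ρ)`. -/
def bankSectors (θ δ ε : ℝ) : Set ℂ :=
  {w | -θ - Real.pi - δ < w.im ∧ w.im < -θ - Real.pi + ε} ∪
    {w | -θ + Real.pi - ε < w.im ∧ w.im < -θ + Real.pi + δ}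

/-- The part `|z - ρ| < r`, `-θ - π - δ < arg (z - ρ) < -θ + π + δ` of the Riemann surface of
`log (z - ρ)`. -/
def punctDisc (θ δ r : ℝ) : Set ℂ :=
  {w | Real.exp w.re < r ∧ -θ - Real.pi - δ < w.im ∧ w.im < -θ + Real.pi + δ}

/-- The function `F` of `u = log x` has the asymptotic expansion
`e^{ρx} ∑_β x ^ (- β - 1) a_β (log (1 / x))` as `|x| → ∞` in the sector `|arg x - θ| ≤ ψ`, in the
sense of 1-summability: `e^{-ρx} F` is holomorphic there for large `|x|`, and after `N` terms of each
progression of exponents the error is at most `C ^ N * N! * |x| ^ (B - N)`. -/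
def HasAsympExpansion (F : ℂ → ℂ) (ρ : ℂ) (a : ℂ → Polynomial ℂ) (θ ψ : ℝ) : Prop :=
  ∃ S : Finset ℂ,
    (∀ α ∈ S, ∀ α' ∈ S, α ≠ α' → ∀ m : ℤ, α - α' ≠ m) ∧
    (∀ β, a β ≠ 0 → ∃ α ∈ S, ∃ n : ℕ, β = α + n) ∧
    ∃ R > (0 : ℝ), ∃ B > (0 : ℝ), ∃ C > (0 : ℝ),
      DifferentiableOn ℂ F {u | R ≤ Real.exp u.re ∧ |u.im - θ| ≤ ψ} ∧
      ∀ u : ℂ, R ≤ Real.exp u.re → |u.im - θ| ≤ ψ → ∀ N : ℕ, 1 ≤ N →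
        ‖Complex.exp (-(ρ * Complex.exp u)) * F u -
            ∑ α ∈ S, ∑ n ∈ Finset.range N, infTerm a u (α + n)‖ ≤
          C ^ N * (N.factorial : ℝ) * Real.exp u.re ^ (B - N)

/-!
All functions are read on the Riemann surface of the logarithm, in the coordinate
`w = log (z - ρ)`, and the rays of the contours point in directions where `e^{xz}` decays.

The formal operators encode Hankel's formula: the integral of `z ^ γ e^{xz}` over a Hankel contour,
divided by `2iπ`, is `x ^ (- γ - 1) / Γ(- γ)`. For `Re γ > 0` the circle of the contour can be
shrunk to a point, which leaves Euler's integral and the reflection formula; both sides are entire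
in `γ`, so the formula holds for all `γ` (`hankelIntegral_logMono_zero`). Its `j`-th
derivative in `γ` gives the integral of `z ^ γ (log z) ^ j e^{xz}` (`hankelIntegral_logMono`). On the formal side,
`L` followed by `𝒯` multiplies `Γ(1 - {y}) / Γ(- y)` by `1 / Γ(1 - {y})`, and Leibniz' rule for this
product shows that the composite is given by the derivatives of `1 / Γ(- y)`, hence by the same
polynomials (`gammaOpInf_laplaceFin`, `gammaOpZero_laplaceInf`).

At a finite point, Cauchy's theorem makes the integral independent of the contour
(`HankelDomain.hankelIntegral_eq`); as the admissible contours for `x` remain admissible near `x`,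
the value is holomorphic in `x` (`exists_hankel_function`). By Hankel's formula, subtracting the
first terms of the expansion from `e^{-ρx} F` amounts to integrating the remainder of the expansion
of `f`. This remainder is bounded on the whole contour by a constant times
`(D t) ^ N * t ^ (- B) * e^{2t}` with `t = |z - ρ|` (`exists_remainder_bound`), and integrating this
over the contour whose circle has radius `1 / |x|` produces the factor `N! |x| ^ (B - N)`
(`norm_hankelIntegral_le`, `exists_asymp_bound`).

At infinity, the contour with circle `|z| = R` and two rays lies in the domain of convergence of
`f`, so its Hankel integral is computed term by term, and equals the value of the formal function at
the origin for every large `R` (`IsNilsson.hasSum_hankelIntegral`). The contribution of the rays is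
the tail of a convergent integral, so the circle integral alone has the same limit
(`IsNilsson.tendsto_arcIntegral`). The series at the origin are entire since `1 / Γ` and its
derivatives decay factorially along `α + ℕ` (`isEntireSeries_iteratedDeriv_Gamma_neg_inv`).
-/

/-! ### The composite of the two formal operators -/

/-- The polynomial `P` with `x ^ (- γ - 1) * P (log (1 / x))` equal to the `j`-th derivative in `γ`
of `x ^ (- γ - 1) / Γ(- γ)`. -/
noncomputable def hankelMono (γ : ℂ) (j : ℕ) : Polynomial ℂ :=
  ∑ i ∈ Finset.range (j + 1),
    Polynomial.C ((j.choose i : ℂ) * iteratedDeriv (j - i) (fun y => (Complex.Gamma (-y))⁻¹) γ) *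
      Polynomial.X ^ i

/-- The linear map on polynomials which sends `X ^ j` to `m j`. -/
noncomputable def monoLin (m : ℕ → Polynomial ℂ) : Polynomial ℂ →ₗ[ℂ] Polynomial ℂ :=
  Polynomial.lsum fun j => LinearMap.toSpanSingleton ℂ _ (m j)

theorem monoLin_apply (m : ℕ → Polynomial ℂ) (p : Polynomial ℂ) :
    monoLin m p = p.sum fun j c => c • m j := rfl

theorem monoLin_monomial (m : ℕ → Polynomial ℂ) (j : ℕ) (c : ℂ) :
    monoLin m (Polynomial.monomial j c) = c • m j := by
  rw [monoLin_apply, Polynomial.sum_monomial_index _ _ (by simp)]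

theorem monoLin_C_mul_X_pow (m : ℕ → Polynomial ℂ) (j : ℕ) (c : ℂ) :
    monoLin m (Polynomial.C c * Polynomial.X ^ j) = c • m j := by
  rw [Polynomial.C_mul_X_pow_eq_monomial, monoLin_monomial]

theorem differentiable_Gamma_neg_inv : Differentiable ℂ fun y => (Complex.Gamma (-y))⁻¹ :=
  Complex.differentiable_one_div_Gamma.comp differentiable_neg

theorem one_sub_fracC_re_pos (γ : ℂ) : 0 < (1 - fracC γ).re := by
  have := Int.fract_lt_one γ.re
  simpa [fracC] using this

/-- Leibniz' rule for the product of `Γ(1 - {y}) / Γ(- y)` and `1 / Γ(1 - {y})`. -/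
theorem iteratedDeriv_Gamma_neg_inv (γ : ℂ) (n : ℕ) :
    iteratedDeriv n (fun y => (Complex.Gamma (-y))⁻¹) γ =
      ∑ l ∈ Finset.range (n + 1), (n.choose l : ℂ) *
        ((-1) ^ l * iteratedDeriv l (fun s => (Complex.Gamma s)⁻¹) (1 - fracC γ)) *
        iteratedDeriv (n - l) (gammaQuot γ) γ := by
  set m : ℂ := (⌊γ.re⌋ : ℂ) with hm
  have hopen : IsOpen {y : ℂ | 0 < (1 + m - y).re} :=
    isOpen_lt continuous_const (by fun_prop)
  have hmem : γ ∈ {y : ℂ | 0 < (1 + m - y).re} := by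
    have := one_sub_fracC_re_pos γ
    rw [fracC, ← hm] at this
    show 0 < (1 + m - γ).re
    convert this using 2; ring
  have hΓ : AnalyticAt ℂ (fun y : ℂ => Complex.Gamma (1 + m - y)) γ := by
    apply DifferentiableOn.analyticAt (s := {y : ℂ | 0 < (1 + m - y).re}) _ (hopen.mem_nhds hmem)
    intro y hy
    apply DifferentiableAt.differentiableWithinAt
    refine (Complex.differentiableAt_Gamma _ ?_).comp y (by fun_prop)
    intro k hk
    have : 0 < (1 + m - y).re := hy
    rw [hk] at this
    simp at this
    linarith [(Nat.cast_nonneg k : (0 : ℝ) ≤ k)]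
  have hquot : gammaQuot γ = fun y => Complex.Gamma (1 + m - y) * (Complex.Gamma (-y))⁻¹ := by
    funext y
    rw [gammaQuot, ← hm]
    congr 2; ring
  have hG : ContDiffAt ℂ n (gammaQuot γ) γ := by
    rw [hquot]
    exact (hΓ.mul (differentiable_Gamma_neg_inv.analyticAt γ)).contDiffAt
  have hH : ContDiffAt ℂ n (fun y : ℂ => (Complex.Gamma (1 + m - y))⁻¹) γ :=
    ((Complex.differentiable_one_div_Gamma.comp
      (differentiable_id.const_sub (1 + m))).analyticAt γ).contDiffAt
  have heq : (fun y => (Complex.Gamma (-y))⁻¹) =ᶠ[𝓝 γ]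
      fun y => (Complex.Gamma (1 + m - y))⁻¹ * gammaQuot γ y := by
    filter_upwards [hopen.mem_nhds hmem] with y hy
    have h0 : Complex.Gamma (1 + m - y) ≠ 0 := Complex.Gamma_ne_zero_of_re_pos hy
    rw [hquot]
    field_simp
  rw [heq.iteratedDeriv_eq, iteratedDeriv_fun_mul hH hG]
  refine Finset.sum_congr rfl fun l _ => ?_
  have := congrFun (iteratedDeriv_comp_const_sub l (fun s => (Complex.Gamma s)⁻¹) (1 + m)) γ
  rw [this, smul_eq_mul, fracC, ← hm]
  congr 4
  ring

/-- The two gamma factors of the operators `L` and `𝒯` combine into `1 / Γ(- γ)`. -/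
theorem monoLin_gammaMono_laplaceMono (γ : ℂ) (j : ℕ) :
    monoLin (gammaMono γ) (laplaceMono γ j) = hankelMono γ j := by
  simp only [laplaceMono, map_sum, monoLin_C_mul_X_pow, gammaMono, Finset.smul_sum, hankelMono]
  rw [Finset.sum_comm' (t' := Finset.range (j + 1)) (s' := fun i => Finset.Ico i (j + 1))
    (by intro x y; simp; omega)]
  refine Finset.sum_congr rfl fun i hi => ?_
  have hi' : i ≤ j := by simpa [Nat.lt_succ_iff] using hi
  rw [Finset.sum_Ico_eq_sum_range, iteratedDeriv_Gamma_neg_inv, show j + 1 - i = j - i + 1 by omega,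
    Finset.mul_sum, map_sum, Finset.sum_mul]
  refine Finset.sum_congr rfl fun l hl => ?_
  rw [Polynomial.smul_eq_C_mul, ← mul_assoc, ← Polynomial.C_mul]
  congr 2
  have hc := Nat.choose_mul (n := j) (k := i + l) (s := i) (by omega)
  rw [Nat.add_sub_cancel_left] at hc
  have hc' : (j.choose (i + l) : ℂ) * ((i + l).choose i : ℂ) =
      (j.choose i : ℂ) * ((j - i).choose l : ℂ) := by exact_mod_cast hc
  rw [Nat.add_sub_cancel_left, show j - (i + l) = j - i - l by omega]
  linear_combination (iteratedDeriv (j - i - l) (gammaQuot γ) γ * (-1) ^ l *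
    iteratedDeriv l (fun s => (Complex.Gamma s)⁻¹) (1 - fracC γ)) * hc'

theorem gammaOpInf_laplaceFin (a : ℂ → Polynomial ℂ) (β : ℂ) :
    gammaOpInf (laplaceFin a) β = monoLin (hankelMono β) (a β) := by
  have h : (monoLin (gammaMono β)).comp (monoLin (laplaceMono β)) = monoLin (hankelMono β) := by
    refine Polynomial.lhom_ext' fun j => LinearMap.ext fun c => ?_
    simp [monoLin_monomial, monoLin_gammaMono_laplaceMono]
  exact LinearMap.congr_fun h (a β)

/-- Changing the sign of the logarithm before and after a term-by-term operator amounts to the signs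
and substitutions of the operators `L_∞` and `T_0`. -/
theorem monoLin_comp_neg (m : ℕ → Polynomial ℂ) (p : Polynomial ℂ) :
    monoLin (fun j => (-1 : ℂ) ^ j • (m j).comp (-Polynomial.X)) p =
      (monoLin m (p.comp (-Polynomial.X))).comp (-Polynomial.X) := by
  let σ : Polynomial ℂ →ₗ[ℂ] Polynomial ℂ := (Polynomial.aeval (-Polynomial.X)).toLinearMap
  have hσ : ∀ q, σ q = q.comp (-Polynomial.X) := fun q => by
    simp [σ, Polynomial.aeval_def, Polynomial.comp]
  have h : monoLin (fun j => (-1 : ℂ) ^ j • (m j).comp (-Polynomial.X)) =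
      σ.comp ((monoLin m).comp σ) := by
    refine Polynomial.lhom_ext' fun j => LinearMap.ext fun c => ?_
    have : σ (Polynomial.monomial j c) = Polynomial.monomial j (c * (-1) ^ j) := by
      rw [hσ, Polynomial.monomial_comp, neg_pow, ← mul_assoc, ← Polynomial.C_mul_X_pow_eq_monomial]
      simp
    simp only [LinearMap.comp_apply, monoLin_monomial, this, hσ, smul_smul,
      Polynomial.smul_comp]
  rw [h]
  simp only [LinearMap.comp_apply, hσ]

theorem gammaOpZero_laplaceInf (a : ℂ → Polynomial ℂ) (β : ℂ) :
    gammaOpZero (laplaceInf a) β =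
      (monoLin (hankelMono (-β - 1)) ((a β).comp (-Polynomial.X))).comp (-Polynomial.X) := by
  have h1 : laplaceInf a β =
      (monoLin (laplaceMono (-β - 1)) ((a β).comp (-Polynomial.X))).comp (-Polynomial.X) :=
    monoLin_comp_neg (laplaceMono (-β - 1)) (a β)
  have h2 : gammaOpZero (laplaceInf a) β =
      (monoLin (gammaMono (-β - 1)) ((laplaceInf a β).comp (-Polynomial.X))).comp
        (-Polynomial.X) :=
    monoLin_comp_neg (gammaMono (-β - 1)) (laplaceInf a β)
  have h3 := gammaOpInf_laplaceFin (fun _ => (a β).comp (-Polynomial.X)) (-β - 1)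
  have h4 : gammaOpInf (laplaceFin fun _ => (a β).comp (-Polynomial.X)) (-β - 1) =
    monoLin (gammaMono (-β - 1)) (monoLin (laplaceMono (-β - 1)) ((a β).comp (-Polynomial.X))) :=
    rfl
  rw [h2, h1, ← h3, h4, Polynomial.comp_assoc]
  simp

/-! ### Exponents and coefficient bounds -/

/-- The finite set of initial exponents can be chosen with pairwise non-integral differences. -/
theorem exists_normalized_exponents (S : Finset ℂ) :
    ∃ S' : Finset ℂ, (∀ α ∈ S', ∀ α' ∈ S', α ≠ α' → ∀ m : ℤ, α - α' ≠ m) ∧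
      ∀ α ∈ S, ∃ α' ∈ S', ∃ n : ℕ, α = α' + n := by
  classical
  induction S using Finset.induction_on with
  | empty => exact ⟨∅, by simp, by simp⟩
  | insert α S _ ih =>
    obtain ⟨S', h1, h2⟩ := ih
    by_cases hc : ∃ α' ∈ S', ∃ m : ℤ, α - α' = m
    · obtain ⟨α', hα', m, hm⟩ := hc
      rcases le_or_gt 0 m with h0 | h0
      · refine ⟨S', h1, fun x hx => ?_⟩
        rcases Finset.mem_insert.1 hx with rfl | hx
        · refine ⟨α', hα', m.toNat, ?_⟩
          have : ((m.toNat : ℤ) : ℂ) = m := by rw [Int.toNat_of_nonneg h0]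
          rw [Int.cast_natCast] at this
          rw [this, ← hm]; ring
        · exact h2 x hx
      -- otherwise `α` precedes `α'` in the same progression, and replaces it
      · have key : ∀ x ∈ S', x ≠ α' → ∀ k : ℤ, x - α ≠ k := fun x hx hxα k hk =>
          h1 x hx α' hα' hxα (k + m) (by push_cast; rw [← hm, ← hk]; ring)
        refine ⟨insert α (S'.erase α'), ?_, fun x hx => ?_⟩
        · intro x hx y hy hxy k hk
          rcases Finset.mem_insert.1 hx with rfl | hx' <;>
            rcases Finset.mem_insert.1 hy with rfl | hy'
          · exact hxy rfl
          · rw [Finset.mem_erase] at hy'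
            exact key y hy'.2 hy'.1 (-k) (by push_cast; rw [← hk]; ring)
          · rw [Finset.mem_erase] at hx'
            exact key x hx'.2 hx'.1 k hk
          · exact h1 x (Finset.mem_of_mem_erase hx') y (Finset.mem_of_mem_erase hy') hxy k hk
        · rcases Finset.mem_insert.1 hx with rfl | hx
          · exact ⟨x, Finset.mem_insert_self _ _, 0, by simp⟩
          · obtain ⟨y, hy, n, hn⟩ := h2 x hx
            by_cases hyα : y = α'
            · refine ⟨α, Finset.mem_insert_self _ _, (-m).toNat + n, ?_⟩
              have : (((-m).toNat : ℤ) : ℂ) = ((-m : ℤ) : ℂ) := by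
                rw [Int.toNat_of_nonneg (by omega)]
              rw [Int.cast_natCast, Int.cast_neg] at this
              push_cast
              rw [this, hn, hyα, ← hm]; ring
            · exact ⟨y, Finset.mem_insert_of_mem (Finset.mem_erase.2 ⟨hyα, hy⟩), n, hn⟩
    · push Not at hc
      refine ⟨insert α S', ?_, fun x hx => ?_⟩
      · intro x hx y hy hxy k hk
        rcases Finset.mem_insert.1 hx with rfl | hx' <;>
            rcases Finset.mem_insert.1 hy with rfl | hy'
        · exact hxy rfl
        · exact hc y hy' k hk
        · exact hc x hx' (-k) (by push_cast; rw [← hk]; ring)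
        · exact h1 x hx' y hy' hxy k hk
      · rcases Finset.mem_insert.1 hx with rfl | hx
        · exact ⟨x, Finset.mem_insert_self _ _, 0, by simp⟩
        · obtain ⟨y, hy, n, hn⟩ := h2 x hx
          exact ⟨y, Finset.mem_insert_of_mem hy, n, hn⟩

theorem IsLogSeries.exists_normalized {a : ℂ → Polynomial ℂ} (h : IsLogSeries a) :
    ∃ (S : Finset ℂ) (J : ℕ), (∀ α ∈ S, ∀ α' ∈ S, α ≠ α' → ∀ m : ℤ, α - α' ≠ m) ∧
      (∀ β, a β ≠ 0 → ∃ α ∈ S, ∃ n : ℕ, β = α + n) ∧ ∀ β, (a β).natDegree < J := by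
  obtain ⟨S, T, h⟩ := h
  obtain ⟨S', h1, h2⟩ := exists_normalized_exponents S
  refine ⟨S', T.sup id + 1, h1, fun β hβ => ?_, fun β => ?_⟩
  · obtain ⟨-, α, hα, n, hn⟩ := h β _ (Polynomial.leadingCoeff_ne_zero.2 hβ)
    obtain ⟨α', hα', k, hk⟩ := h2 α hα
    exact ⟨α', hα', k + n, by rw [hn, hk]; push_cast; ring⟩
  · by_cases h0 : a β = 0
    · simp [h0]
    · exact Nat.lt_succ_of_le
        (Finset.le_sup (f := id) (h β _ (Polynomial.leadingCoeff_ne_zero.2 h0)).1)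

theorem HasPosRadius.exists_bound {c : ℕ → ℂ} (h : HasPosRadius c) :
    ∃ M A : ℝ, 0 ≤ M ∧ 0 ≤ A ∧ ∀ n, ‖c n‖ ≤ M * A ^ n := by
  obtain ⟨r, hr, h⟩ := h
  refine ⟨∑' n, ‖c n‖ * r ^ n, r⁻¹, tsum_nonneg fun n => by positivity, by positivity, fun n => ?_⟩
  have := h.le_tsum n (fun _ _ => by positivity)
  rw [inv_pow, ← div_eq_mul_inv, le_div_iff₀ (by positivity)]
  exact this

/-- A common geometric bound for all the coefficients of a formal function in a Nilsson class. -/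
theorem IsNilsson.exists_coeff_bound {a : ℂ → Polynomial ℂ} (h : IsNilsson a) (S : Finset ℂ)
    (J : ℕ) : ∃ M A : ℝ, 0 < M ∧ 0 < A ∧
      ∀ α ∈ S, ∀ j < J, ∀ n : ℕ, ‖(a (α + n)).coeff j‖ ≤ M * A ^ n := by
  choose M A hM hA hb using fun α j => (h.2 α j).exists_bound
  refine ⟨1 + ∑ α ∈ S, ∑ j ∈ Finset.range J, M α j, 1 + ∑ α ∈ S, ∑ j ∈ Finset.range J, A α j,
    ?_, ?_, fun α hα j hj n => (hb α j n).trans ?_⟩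
  · have := Finset.sum_nonneg fun α (_ : α ∈ S) => Finset.sum_nonneg fun j
      (_ : j ∈ Finset.range J) => hM α j
    linarith
  · have := Finset.sum_nonneg fun α (_ : α ∈ S) => Finset.sum_nonneg fun j
      (_ : j ∈ Finset.range J) => hA α j
    linarith
  · have hle : ∀ m : ℂ → ℕ → ℝ, (∀ α j, 0 ≤ m α j) →
        m α j ≤ 1 + ∑ α ∈ S, ∑ j ∈ Finset.range J, m α j := fun m hm => by
      have h1 := Finset.single_le_sum (f := fun j => m α j) (fun j _ => hm α j)
        (Finset.mem_range.2 hj)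
      have h2 := Finset.single_le_sum (f := fun α => ∑ j ∈ Finset.range J, m α j)
        (fun α _ => Finset.sum_nonneg fun j _ => hm α j) hα
      linarith
    exact mul_le_mul (hle M hM) (pow_le_pow_left₀ (hA α j) (hle A hA) n)
      (pow_nonneg (hA α j) n) ((hM α j).trans (hle M hM))

/-- The size of a polynomial in the logarithm `v` is controlled by its coefficients and
`e ^ |v|`. -/
theorem norm_eval_le_mul_exp {p : Polynomial ℂ} {J : ℕ} (hJ : p.natDegree < J) {m : ℝ}
    (hm : ∀ j < J, ‖p.coeff j‖ ≤ m) (v : ℂ) :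
    ‖p.eval v‖ ≤ m * ((∑ j ∈ Finset.range J, (j.factorial : ℝ)) * Real.exp ‖v‖) := by
  rw [Polynomial.eval_eq_sum_range' hJ, Finset.sum_mul, Finset.mul_sum]
  refine (norm_sum_le _ _).trans (Finset.sum_le_sum fun j hj => ?_)
  rw [norm_mul, norm_pow]
  have h1 := Real.pow_div_factorial_le_exp ‖v‖ (norm_nonneg _) j
  rw [div_le_iff₀ (by positivity)] at h1
  have h2 := hm j (Finset.mem_range.1 hj)
  have h3 : 0 ≤ m := (norm_nonneg _).trans h2
  calc _ ≤ m * (Real.exp ‖v‖ * j.factorial) := by gcongr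
    _ = _ := by ring

theorem norm_le_abs_re_add {w : ℂ} {V : ℝ} (hV : |w.im| ≤ V) : ‖w‖ ≤ |w.re| + V :=
  (Complex.norm_le_abs_re_add_abs_im w).trans (by linarith)

theorem norm_exp_mul_le {γ w : ℂ} {V B : ℝ} (hV : |w.im| ≤ V) (hB : ‖γ‖ ≤ B) (n : ℝ) :
    ‖Complex.exp ((γ + n) * w)‖ ≤ Real.exp (n * w.re) * Real.exp (B * (|w.re| + V)) := by
  rw [Complex.norm_exp, ← Real.exp_add]
  apply Real.exp_le_exp.2
  rw [add_mul, Complex.add_re, Complex.re_ofReal_mul, add_comm]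
  gcongr
  calc _ ≤ ‖γ * w‖ := Complex.re_le_norm _
    _ = ‖γ‖ * ‖w‖ := norm_mul _ _
    _ ≤ B * (|w.re| + V) := by
      have := norm_le_abs_re_add hV
      gcongr
      exact (norm_nonneg _).trans hB

/-- Bounds for the terms of a formal function in a Nilsson class, at a finite point and at infinity,
in a strip of bounded argument. -/
theorem IsNilsson.exists_term_bound {a : ℂ → Polynomial ℂ} (h : IsNilsson a) (S : Finset ℂ)
    {J : ℕ} (hJ : ∀ β, (a β).natDegree < J) :
    ∃ (A : ℝ) (B : ℕ), 0 < A ∧ ∀ V : ℝ, ∃ M > 0, ∀ α ∈ S, ∀ w : ℂ, |w.im| ≤ V → ∀ n : ℕ,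
      ‖finTerm a w (α + n)‖ ≤ M * A ^ n * Real.exp (n * w.re) * Real.exp (B * |w.re|) ∧
      ‖infTerm a w (α + n)‖ ≤ M * A ^ n * Real.exp (-(n * w.re)) * Real.exp (B * |w.re|) := by
  obtain ⟨M, A, hM, hA, hb⟩ := h.exists_coeff_bound S J
  obtain ⟨b, hbS⟩ : ∃ b : ℕ, ∀ α ∈ S, ‖α‖ ≤ b := by
    obtain ⟨b, hb⟩ := exists_nat_ge (∑ α ∈ S, ‖α‖)
    exact ⟨b, fun α hα => (Finset.single_le_sum (f := fun α => ‖α‖)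
      (fun _ _ => norm_nonneg _) hα).trans hb⟩
  set F : ℝ := ∑ j ∈ Finset.range J, (j.factorial : ℝ)
  have hF : 0 < F := by
    have : 0 < J := (Nat.zero_le _).trans_lt (hJ 0)
    exact Finset.sum_pos (fun j _ => by positivity) ⟨0, by simpa⟩
  refine ⟨A, b + 2, hA, fun V => ⟨M * F * Real.exp ((b + 2) * V), by positivity,
    fun α hα w hw n => ?_⟩⟩
  have hev : ∀ v : ℂ, ‖v‖ = ‖w‖ → ‖(a (α + n)).eval v‖ ≤
      M * A ^ n * (F * Real.exp (|w.re| + V)) := fun v hv => by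
    refine (norm_eval_le_mul_exp (hJ _) (fun j hj => hb α hα j hj n) v).trans ?_
    have := norm_le_abs_re_add hw
    rw [hv]
    gcongr
  constructor
  · have h1 := norm_exp_mul_le hw ((hbS α hα).trans (by linarith : (b : ℝ) ≤ b + 1)) n
    rw [finTerm, norm_mul]
    rw [Complex.ofReal_natCast] at h1
    refine (mul_le_mul h1 (hev w rfl) (norm_nonneg _) (by positivity)).trans (le_of_eq ?_)
    have : Real.exp ((b + 1) * (|w.re| + V)) * Real.exp (|w.re| + V) =
        Real.exp ((b + 2) * V) * Real.exp (((b + 2 : ℕ) : ℝ) * |w.re|) := by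
      rw [← Real.exp_add, ← Real.exp_add]; congr 1; push_cast; ring
    linear_combination (Real.exp (n * w.re) * M * A ^ n * F) * this
  · have hα1 : ‖-(α + 1)‖ ≤ (b : ℝ) + 1 := by
      rw [norm_neg]
      refine (norm_add_le _ _).trans ?_
      rw [norm_one]
      linarith [hbS α hα]
    have h1 := norm_exp_mul_le hw hα1 (-n)
    rw [infTerm, norm_mul]
    rw [show -(α + 1) + ((-(n : ℝ) : ℝ) : ℂ) = -(α + n + 1) by push_cast; ring] at h1
    refine (mul_le_mul h1 (hev (-w) (norm_neg w)) (norm_nonneg _) (by positivity)).trans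
      (le_of_eq ?_)
    have : Real.exp ((b + 1) * (|w.re| + V)) * Real.exp (|w.re| + V) =
        Real.exp ((b + 2) * V) * Real.exp (((b + 2 : ℕ) : ℝ) * |w.re|) := by
      rw [← Real.exp_add, ← Real.exp_add]; congr 1; push_cast; ring
    rw [neg_mul]
    linear_combination (Real.exp (-(n * w.re)) * M * A ^ n * F) * this

/-- The exponents `α + n` are pairwise distinct when the `α`'s have non-integral differences. -/
theorem injective_exponent {S : Finset ℂ}
    (hS : ∀ α ∈ S, ∀ α' ∈ S, α ≠ α' → ∀ m : ℤ, α - α' ≠ m) :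
    Function.Injective fun p : S × ℕ => (p.1 : ℂ) + p.2 := by
  rintro ⟨⟨α, hα⟩, n⟩ ⟨⟨α', hα'⟩, n'⟩ h
  have h' : α + (n : ℂ) = α' + n' := h
  have : α = α' := by
    by_contra hne
    exact hS α hα α' hα' hne ((n' : ℤ) - n) (by push_cast; linear_combination h')
  subst this
  simpa using h'

/-! ### Hankel contours -/

/-- `‖e^{xz}‖` on the ray of argument `φ` issuing from `ρ`. -/
theorem norm_exp_exp_mul (ρ u : ℂ) (φ t : ℝ) :
    ‖Complex.exp (Complex.exp u * (ρ + t * Complex.exp (φ * Complex.I)))‖ =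
      ‖Complex.exp (Complex.exp u * ρ)‖ *
        Real.exp (Real.exp u.re * Real.cos (u.im + φ) * t) := by
  rw [mul_add, Complex.exp_add, norm_mul]
  congr 1
  rw [Complex.norm_exp, show Complex.exp u * (t * Complex.exp (φ * Complex.I)) =
    t * Complex.exp (u + φ * Complex.I) by rw [Complex.exp_add]; ring, Complex.re_ofReal_mul,
    Complex.exp_re]
  simp
  ring

theorem norm_rayIntegrand (f : ℂ → ℂ) (ρ u : ℂ) (φ t : ℝ) :
    ‖rayIntegrand f ρ u φ t‖ = ‖f (Real.log t + φ * Complex.I)‖ *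
      (‖Complex.exp (Complex.exp u * ρ)‖ *
        Real.exp (Real.exp u.re * Real.cos (u.im + φ) * t)) := by
  rw [rayIntegrand, norm_mul, norm_mul, norm_exp_exp_mul, Complex.norm_exp_ofReal_mul_I, mul_one]

/-- The integrand of `arcIntegral`. -/
noncomputable def arcIntegrand (f : ℂ → ℂ) (ρ u : ℂ) (κ τ : ℝ) : ℂ :=
  f (Real.log κ + τ * Complex.I) *
    Complex.exp (Complex.exp u * (ρ + κ * Complex.exp (τ * Complex.I))) *
    (κ * Complex.exp (τ * Complex.I) * Complex.I)

theorem arcIntegral_eq (f : ℂ → ℂ) (ρ u : ℂ) (κ φ₁ φ₂ : ℝ) :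
    arcIntegral f ρ u κ φ₁ φ₂ = ∫ τ in φ₁..φ₂, arcIntegrand f ρ u κ τ := rfl

theorem norm_arcIntegrand (f : ℂ → ℂ) (ρ u : ℂ) {κ : ℝ} (hκ : 0 ≤ κ) (τ : ℝ) :
    ‖arcIntegrand f ρ u κ τ‖ = ‖f (Real.log κ + τ * Complex.I)‖ *
      (‖Complex.exp (Complex.exp u * ρ)‖ *
        Real.exp (Real.exp u.re * Real.cos (u.im + τ) * κ)) * κ := by
  rw [arcIntegrand, norm_mul, norm_mul, norm_exp_exp_mul, norm_mul, norm_mul,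
    Complex.norm_exp_ofReal_mul_I, Complex.norm_I, mul_one, mul_one, Complex.norm_real,
    Real.norm_eq_abs, abs_of_nonneg hκ]

theorem continuousOn_rayIntegrand {f : ℂ → ℂ} (ρ u : ℂ) {φ : ℝ} {s : Set ℝ}
    (hf : ContinuousOn (fun t : ℝ => f (Real.log t + φ * Complex.I)) s) :
    ContinuousOn (rayIntegrand f ρ u φ) s := by
  unfold rayIntegrand
  exact (hf.mul (by fun_prop)).mul (by fun_prop)

theorem continuousOn_arcIntegrand {f : ℂ → ℂ} (ρ u : ℂ) {κ : ℝ} {s : Set ℝ}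
    (hf : ContinuousOn (fun τ : ℝ => f (Real.log κ + τ * Complex.I)) s) :
    ContinuousOn (arcIntegrand f ρ u κ) s := by
  unfold arcIntegrand
  exact (hf.mul (by fun_prop)).mul (by fun_prop)

theorem continuousOn_comp_ray {f : ℂ → ℂ} {φ : ℝ} {s : Set ℝ} (hs : ∀ t ∈ s, 0 < t)
    (hf : ∀ t ∈ s, DifferentiableAt ℂ f (Real.log t + φ * Complex.I)) :
    ContinuousOn (fun t : ℝ => f (Real.log t + φ * Complex.I)) s := by
  intro t ht
  refine ContinuousAt.continuousWithinAt ?_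
  refine ContinuousAt.comp (f := fun t : ℝ => (Real.log t : ℂ) + φ * Complex.I)
    (hf t ht).continuousAt ?_
  exact (Complex.continuous_ofReal.continuousAt.comp
    (Real.continuousAt_log (hs t ht).ne')).add continuousAt_const

theorem continuousOn_comp_arc {f : ℂ → ℂ} {κ : ℝ} {s : Set ℝ}
    (hf : ∀ τ ∈ s, DifferentiableAt ℂ f (Real.log κ + τ * Complex.I)) :
    ContinuousOn (fun τ : ℝ => f (Real.log κ + τ * Complex.I)) s := by
  intro τ hτ
  refine ContinuousAt.continuousWithinAt ?_
  exact ContinuousAt.comp (f := fun τ : ℝ => (Real.log κ : ℂ) + τ * Complex.I)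
    (hf τ hτ).continuousAt (by fun_prop)

/-- Cauchy's theorem for the boundary of an annular sector. -/
theorem rayIntegral_sub_rayIntegral {f : ℂ → ℂ} (ρ u : ℂ) {κ l φ₁ φ₂ : ℝ} (hκ : 0 < κ)
    (hl : 0 < l)
    (hf : ∀ t ∈ Set.uIcc κ l, ∀ φ ∈ Set.uIcc φ₁ φ₂,
      DifferentiableAt ℂ f (Real.log t + φ * Complex.I)) :
    (∫ t in κ..l, rayIntegrand f ρ u φ₁ t) - (∫ t in κ..l, rayIntegrand f ρ u φ₂ t) =
      arcIntegral f ρ u κ φ₁ φ₂ - arcIntegral f ρ u l φ₁ φ₂ := by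
  set G : ℂ → ℂ := fun w =>
    f w * Complex.exp (Complex.exp u * (ρ + Complex.exp w)) * Complex.exp w with hG
  have hexp : ∀ {t : ℝ}, 0 < t → ∀ φ : ℝ,
      Complex.exp (Real.log t + φ * Complex.I) = t * Complex.exp (φ * Complex.I) := fun ht φ => by
    rw [Complex.exp_add, ← Complex.ofReal_exp, Real.exp_log ht]
  have hpos : ∀ t ∈ Set.uIcc κ l, 0 < t := fun t ht =>
    lt_of_lt_of_le (lt_min hκ hl) ht.1
  have hray : ∀ φ ∈ Set.uIcc φ₁ φ₂, ∫ t in κ..l, rayIntegrand f ρ u φ t =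
      ∫ s in Real.log κ..Real.log l, G (s + φ * Complex.I) := fun φ hφ => by
    have himg : Real.exp '' Set.uIcc (Real.log κ) (Real.log l) ⊆ Set.uIcc κ l := by
      rintro _ ⟨s, hs, rfl⟩
      have := Real.exp_monotone.image_uIcc_subset (a := Real.log κ) (b := Real.log l)
        ⟨s, hs, rfl⟩
      rwa [Real.exp_log hκ, Real.exp_log hl] at this
    have h := intervalIntegral.integral_deriv_smul_comp' (a := Real.log κ) (b := Real.log l)
      (f := Real.exp) (f' := Real.exp) (g := rayIntegrand f ρ u φ)
      (fun s _ => Real.hasDerivAt_exp s) Real.continuous_exp.continuousOn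
      ((continuousOn_rayIntegrand ρ u
        (continuousOn_comp_ray hpos fun t ht => hf t ht φ hφ)).mono himg)
    rw [Real.exp_log hκ, Real.exp_log hl] at h
    rw [← h]
    refine intervalIntegral.integral_congr fun s _ => ?_
    simp only [Function.comp, rayIntegrand, hG, Real.log_exp, Complex.real_smul, Complex.exp_add,
      Complex.ofReal_exp]
    ring
  have harc : ∀ {t : ℝ}, 0 < t → arcIntegral f ρ u t φ₁ φ₂ =
      Complex.I • ∫ τ in φ₁..φ₂, G (Real.log t + τ * Complex.I) := fun {t} ht => by
    rw [arcIntegral, smul_eq_mul, ← intervalIntegral.integral_const_mul]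
    refine intervalIntegral.integral_congr fun τ _ => ?_
    simp only [hG, hexp ht]
    ring
  have h := Complex.integral_boundary_rect_eq_zero_of_differentiableOn G
    ⟨Real.log κ, φ₁⟩ ⟨Real.log l, φ₂⟩ (by
      intro w hw
      refine DifferentiableAt.differentiableWithinAt ?_
      rw [Complex.mem_reProdIm] at hw
      have ht : Real.exp w.re ∈ Set.uIcc κ l := by
        have := Real.exp_monotone.image_uIcc_subset (a := Real.log κ) (b := Real.log l)
          ⟨w.re, hw.1, rfl⟩
        rwa [Real.exp_log hκ, Real.exp_log hl] at this
      have hd := hf _ ht _ hw.2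
      rw [Real.log_exp, Complex.re_add_im] at hd
      exact (hd.mul (by fun_prop)).mul (by fun_prop))
  simp only at h
  rw [← hray φ₁ Set.left_mem_uIcc, ← hray φ₂ Set.right_mem_uIcc, ← harc hκ, ← harc hl] at h
  linear_combination h

/-- The function `f` of `log (z - ρ)` is holomorphic on the arguments in `P` and on the disc of
radius `r` and arguments in `Q`, and it has sub-exponential growth, locally uniformly in `P`. -/
structure HankelDomain (f : ℂ → ℂ) (r : ℝ) (P Q : Set ℝ) : Prop where
  ordConnected : Q.OrdConnected
  diff_bank : ∀ t > 0, ∀ φ ∈ P, DifferentiableAt ℂ f (Real.log t + φ * Complex.I)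
  diff_disc : ∀ t > 0, t < r → ∀ φ ∈ Q, DifferentiableAt ℂ f (Real.log t + φ * Complex.I)
  growth : ∀ p q κ η : ℝ, Set.Icc p q ⊆ P → 0 < κ → 0 < η → ∃ c > 0, ∀ t ≥ κ,
    ∀ φ ∈ Set.Icc p q, ‖f (Real.log t + φ * Complex.I)‖ ≤ c * Real.exp (η * t)

theorem integrableOn_exp_neg_mul (κ : ℝ) {m : ℝ} (hm : 0 < m) (c : ℝ) :
    MeasureTheory.IntegrableOn (fun t : ℝ => c * Real.exp (-m * t)) (Set.Ioi κ) :=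
  (exp_neg_integrableOn_Ioi κ hm).const_mul c

/-- Bound for the integrand on a ray along which `e^{xz}` decays. -/
theorem norm_rayIntegrand_le {f : ℂ → ℂ} (ρ : ℂ) {u : ℂ} {φ t m c η : ℝ} (ht : 0 ≤ t)
    (hcos : Real.cos (u.im + φ) ≤ -m)
    (hf : ‖f (Real.log t + φ * Complex.I)‖ ≤ c * Real.exp (η * t)) :
    ‖rayIntegrand f ρ u φ t‖ ≤ c * ‖Complex.exp (Complex.exp u * ρ)‖ *
      Real.exp (-(Real.exp u.re * m - η) * t) := by
  rw [norm_rayIntegrand]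
  have := (norm_nonneg _).trans hf
  calc _ ≤ c * Real.exp (η * t) * (‖Complex.exp (Complex.exp u * ρ)‖ *
        Real.exp (Real.exp u.re * (-m) * t)) := by gcongr
    _ = c * ‖Complex.exp (Complex.exp u * ρ)‖ *
        (Real.exp (η * t) * Real.exp (Real.exp u.re * (-m) * t)) := by ring
    _ = _ := by rw [← Real.exp_add]; congr 2; ring

namespace HankelDomain

variable {f : ℂ → ℂ} {r : ℝ} {P Q : Set ℝ}

theorem continuousOn_ray (hf : HankelDomain f r P Q) (ρ u : ℂ) {κ φ : ℝ} (hκ : 0 < κ)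
    (hφ : φ ∈ P) : ContinuousOn (rayIntegrand f ρ u φ) (Set.Ici κ) :=
  continuousOn_rayIntegrand ρ u (continuousOn_comp_ray (fun _ ht => hκ.trans_le ht)
    fun t ht => hf.diff_bank t (hκ.trans_le ht) φ hφ)

theorem integrableOn_ray (hf : HankelDomain f r P Q) (ρ : ℂ) {u : ℂ} {κ φ : ℝ} (hκ : 0 < κ)
    (hφ : φ ∈ P) (hcos : Real.cos (u.im + φ) < 0) :
    MeasureTheory.IntegrableOn (rayIntegrand f ρ u φ) (Set.Ioi κ) := by
  set b := Real.exp u.re * (-Real.cos (u.im + φ)) with hb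
  have hb0 : 0 < b := mul_pos (Real.exp_pos _) (by linarith)
  obtain ⟨c, hc, hbound⟩ := hf.growth φ φ κ (b / 2) (by simpa using hφ) hκ (by positivity)
  refine (integrableOn_exp_neg_mul κ (half_pos hb0)
    (c * ‖Complex.exp (Complex.exp u * ρ)‖)).mono' ?_ ?_
  · exact ((hf.continuousOn_ray ρ u hκ hφ).mono Set.Ioi_subset_Ici_self).aestronglyMeasurable
      measurableSet_Ioi
  · refine (MeasureTheory.ae_restrict_mem measurableSet_Ioi).mono fun t ht => ?_
    have ht' : κ < t := ht
    have h := norm_rayIntegrand_le (f := f) ρ (u := u) (hκ.trans ht').le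
      (le_of_eq (neg_neg _).symm) (hbound t ht'.le φ (by simp))
    rw [← hb] at h
    convert h using 3
    ring

theorem intervalIntegrable_arc (hf : HankelDomain f r P Q) (ρ u : ℂ) {κ φ₁ φ₂ : ℝ} (hκ : 0 < κ)
    (hr : κ < r) (h₁ : φ₁ ∈ Q) (h₂ : φ₂ ∈ Q) :
    IntervalIntegrable (arcIntegrand f ρ u κ) MeasureTheory.volume φ₁ φ₂ := by
  have hsub := hf.ordConnected.uIcc_subset h₁ h₂
  exact (continuousOn_arcIntegrand ρ u (continuousOn_comp_arc fun τ hτ =>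
    hf.diff_disc κ hκ hr τ (hsub hτ))).intervalIntegrable

theorem tendsto_arcIntegral (hf : HankelDomain f r P Q) (ρ : ℂ) {u : ℂ} {φ₁ φ₂ : ℝ}
    (hle : φ₁ ≤ φ₂) (hP : Set.Icc φ₁ φ₂ ⊆ P)
    (hcos : ∀ φ ∈ Set.Icc φ₁ φ₂, Real.cos (u.im + φ) < 0) :
    Tendsto (fun l => arcIntegral f ρ u l φ₁ φ₂) atTop (𝓝 0) := by
  obtain ⟨φ₀, hφ₀, hmax⟩ := isCompact_Icc.exists_isMaxOn (Set.nonempty_Icc.2 hle)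
    (f := fun φ => Real.cos (u.im + φ)) (by fun_prop)
  set m := -Real.cos (u.im + φ₀) with hm
  have hm0 : 0 < m := by have := hcos φ₀ hφ₀; linarith
  set b := Real.exp u.re * m with hb
  have hb0 : 0 < b := by positivity
  obtain ⟨c, hc, hbound⟩ := hf.growth φ₁ φ₂ 1 (b / 2) hP one_pos (half_pos hb0)
  set K := c * ‖Complex.exp (Complex.exp u * ρ)‖
  have hlim : Tendsto (fun l : ℝ => K * (l ^ 1 * Real.exp (-(b / 2) * l)) * |φ₂ - φ₁|) atTop
      (𝓝 0) := by
    have h := ((tendsto_rpow_mul_exp_neg_mul_atTop_nhds_zero 1 (b / 2)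
      (half_pos hb0)).const_mul K).mul_const |φ₂ - φ₁|
    simpa using h
  refine squeeze_zero_norm' ?_ hlim
  filter_upwards [eventually_ge_atTop 1] with l hl
  have hl0 : (0 : ℝ) ≤ l := by linarith
  rw [arcIntegral_eq]
  refine intervalIntegral.norm_integral_le_of_norm_le_const fun τ hτ => ?_
  rw [Set.uIoc_of_le hle] at hτ
  have hτ' := Set.Ioc_subset_Icc_self hτ
  have hcosτ : Real.cos (u.im + τ) ≤ -m := by
    rw [hm, neg_neg]; exact hmax hτ'
  have h := norm_rayIntegrand_le (f := f) ρ (u := u) hl0 hcosτ (hbound l hl τ hτ')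
  rw [norm_rayIntegrand] at h
  rw [norm_arcIntegrand f ρ u hl0]
  refine (mul_le_mul_of_nonneg_right h hl0).trans (le_of_eq ?_)
  rw [pow_one, show -(Real.exp u.re * m - b / 2) = -(b / 2) by rw [← hb]; ring]
  ring

/-- Rotation of a ray at infinity. -/
theorem rayIntegral_sub_rayIntegral (hf : HankelDomain f r P Q) (ρ : ℂ) {u : ℂ} {κ φ₁ φ₂ : ℝ}
    (hκ : 0 < κ) (hP : Set.uIcc φ₁ φ₂ ⊆ P)
    (hcos : ∀ φ ∈ Set.uIcc φ₁ φ₂, Real.cos (u.im + φ) < 0) :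
    (∫ t in Set.Ioi κ, rayIntegrand f ρ u φ₁ t) - (∫ t in Set.Ioi κ, rayIntegrand f ρ u φ₂ t) =
      arcIntegral f ρ u κ φ₁ φ₂ := by
  wlog hle : φ₁ ≤ φ₂ generalizing φ₁ φ₂
  · have := this (by rwa [Set.uIcc_comm]) (by rwa [Set.uIcc_comm]) (le_of_not_ge hle)
    rw [arcIntegral, intervalIntegral.integral_symm, ← arcIntegral, ← this]
    ring
  rw [Set.uIcc_of_le hle] at hP hcos
  have h1 : φ₁ ∈ Set.Icc φ₁ φ₂ := ⟨le_rfl, hle⟩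
  have h2 : φ₂ ∈ Set.Icc φ₁ φ₂ := ⟨hle, le_rfl⟩
  have l1 := MeasureTheory.intervalIntegral_tendsto_integral_Ioi κ
    (hf.integrableOn_ray ρ hκ (hP h1) (hcos _ h1)) tendsto_id
  have l2 := MeasureTheory.intervalIntegral_tendsto_integral_Ioi κ
    (hf.integrableOn_ray ρ hκ (hP h2) (hcos _ h2)) tendsto_id
  have l3 := (tendsto_const_nhds (x := arcIntegral f ρ u κ φ₁ φ₂)).sub
    (hf.tendsto_arcIntegral ρ hle hP hcos)
  rw [sub_zero] at l3
  refine tendsto_nhds_unique ((l1.sub l2).congr' ?_) l3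
  filter_upwards [eventually_gt_atTop 0] with l hl
  refine _root_.rayIntegral_sub_rayIntegral ρ u hκ hl fun t ht φ hφ => ?_
  rw [Set.uIcc_of_le hle] at hφ
  exact hf.diff_bank t ((lt_min hκ hl).trans_le ht.1) φ (hP hφ)

/-- The Hankel integral does not depend on the contour. -/
theorem hankelIntegral_eq (hf : HankelDomain f r P Q) (ρ : ℂ) {u : ℂ} {κ κ' φ₁ φ₁' φ₂ φ₂' : ℝ}
    (hκ : 0 < κ) (hr : κ < r) (hκ' : 0 < κ') (hr' : κ' < r)
    (hQ₁ : φ₁ ∈ Q) (hQ₁' : φ₁' ∈ Q) (hQ₂ : φ₂ ∈ Q) (hQ₂' : φ₂' ∈ Q)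
    (hP₁ : Set.uIcc φ₁ φ₁' ⊆ P) (hP₂ : Set.uIcc φ₂ φ₂' ⊆ P)
    (hcos₁ : ∀ φ ∈ Set.uIcc φ₁ φ₁', Real.cos (u.im + φ) < 0)
    (hcos₂ : ∀ φ ∈ Set.uIcc φ₂ φ₂', Real.cos (u.im + φ) < 0) :
    hankelIntegral f ρ u κ φ₁ φ₂ = hankelIntegral f ρ u κ' φ₁' φ₂' := by
  have hrot₁ := hf.rayIntegral_sub_rayIntegral ρ hκ' hP₁ hcos₁
  have hrot₂ := hf.rayIntegral_sub_rayIntegral ρ hκ' hP₂ hcos₂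
  have hdisc := _root_.rayIntegral_sub_rayIntegral (f := f) ρ u (φ₁ := φ₁) (φ₂ := φ₂) hκ hκ'
    fun t ht φ hφ => hf.diff_disc t ((lt_min hκ hκ').trans_le ht.1)
      (ht.2.trans_lt (max_lt hr hr')) φ (hf.ordConnected.uIcc_subset hQ₁ hQ₂ hφ)
  have hsplit : ∀ φ, φ ∈ P → Real.cos (u.im + φ) < 0 →
      ∫ t in κ..κ', rayIntegrand f ρ u φ t =
        (∫ t in Set.Ioi κ, rayIntegrand f ρ u φ t) - ∫ t in Set.Ioi κ', rayIntegrand f ρ u φ t :=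
    fun φ hφ hc => (intervalIntegral.integral_Ioi_sub_Ioi'
      (hf.integrableOn_ray ρ hκ hφ hc) (hf.integrableOn_ray ρ hκ' hφ hc)).symm
  rw [hsplit φ₁ (hP₁ Set.left_mem_uIcc) (hcos₁ _ Set.left_mem_uIcc),
    hsplit φ₂ (hP₂ Set.left_mem_uIcc) (hcos₂ _ Set.left_mem_uIcc)] at hdisc
  have ha : arcIntegral f ρ u κ' φ₁ φ₁' + arcIntegral f ρ u κ' φ₁' φ₂ =
      arcIntegral f ρ u κ' φ₁ φ₂ :=
    intervalIntegral.integral_add_adjacent_intervals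
      (hf.intervalIntegrable_arc ρ u hκ' hr' hQ₁ hQ₁')
      (hf.intervalIntegrable_arc ρ u hκ' hr' hQ₁' hQ₂)
  have hb : arcIntegral f ρ u κ' φ₁' φ₂ + arcIntegral f ρ u κ' φ₂ φ₂' =
      arcIntegral f ρ u κ' φ₁' φ₂' :=
    intervalIntegral.integral_add_adjacent_intervals
      (hf.intervalIntegrable_arc ρ u hκ' hr' hQ₁' hQ₂)
      (hf.intervalIntegrable_arc ρ u hκ' hr' hQ₂ hQ₂')
  unfold hankelIntegral
  congr 1
  linear_combination -hdisc - hrot₁ + hrot₂ - ha + hb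
end HankelDomain

/-! ### Linearity of the Hankel integral -/

/-- Absolute convergence of the Hankel integral. -/
structure HankelIntegrable (f : ℂ → ℂ) (ρ u : ℂ) (κ φ₁ φ₂ : ℝ) : Prop where
  ray₁ : MeasureTheory.IntegrableOn (rayIntegrand f ρ u φ₁) (Set.Ioi κ)
  ray₂ : MeasureTheory.IntegrableOn (rayIntegrand f ρ u φ₂) (Set.Ioi κ)
  arc : IntervalIntegrable (arcIntegrand f ρ u κ) MeasureTheory.volume φ₁ φ₂

theorem HankelDomain.hankelIntegrable {f : ℂ → ℂ} {r : ℝ} {P Q : Set ℝ}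
    (hf : HankelDomain f r P Q) (ρ : ℂ) {u : ℂ} {κ φ₁ φ₂ : ℝ} (hκ : 0 < κ) (hr : κ < r)
    (hQ₁ : φ₁ ∈ Q) (hQ₂ : φ₂ ∈ Q) (hP₁ : φ₁ ∈ P) (hP₂ : φ₂ ∈ P)
    (hcos₁ : Real.cos (u.im + φ₁) < 0) (hcos₂ : Real.cos (u.im + φ₂) < 0) :
    HankelIntegrable f ρ u κ φ₁ φ₂ :=
  ⟨hf.integrableOn_ray ρ hκ hP₁ hcos₁, hf.integrableOn_ray ρ hκ hP₂ hcos₂,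
    hf.intervalIntegrable_arc ρ u hκ hr hQ₁ hQ₂⟩

section linear

variable {ρ u : ℂ} {κ φ₁ φ₂ : ℝ}

theorem rayIntegrand_sum {ι : Type*} (s : Finset ι) (c : ι → ℂ) (f : ι → ℂ → ℂ) (φ : ℝ) :
    rayIntegrand (fun w => ∑ i ∈ s, c i * f i w) ρ u φ =
      fun t => ∑ i ∈ s, c i * rayIntegrand (f i) ρ u φ t := by
  funext t
  simp only [rayIntegrand, Finset.sum_mul]
  exact Finset.sum_congr rfl fun i _ => by ring

theorem arcIntegrand_sum {ι : Type*} (s : Finset ι) (c : ι → ℂ) (f : ι → ℂ → ℂ) :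
    arcIntegrand (fun w => ∑ i ∈ s, c i * f i w) ρ u κ =
      fun t => ∑ i ∈ s, c i * arcIntegrand (f i) ρ u κ t := by
  funext t
  simp only [arcIntegrand, Finset.sum_mul]
  exact Finset.sum_congr rfl fun i _ => by ring

theorem HankelIntegrable.sum {ι : Type*} {s : Finset ι} (c : ι → ℂ) {f : ι → ℂ → ℂ}
    (h : ∀ i ∈ s, HankelIntegrable (f i) ρ u κ φ₁ φ₂) :
    HankelIntegrable (fun w => ∑ i ∈ s, c i * f i w) ρ u κ φ₁ φ₂ := by
  refine ⟨?_, ?_, ?_⟩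
  · rw [rayIntegrand_sum]
    exact MeasureTheory.integrable_finsetSum _ fun i hi => (h i hi).ray₁.const_mul _
  · rw [rayIntegrand_sum]
    exact MeasureTheory.integrable_finsetSum _ fun i hi => (h i hi).ray₂.const_mul _
  · rw [arcIntegrand_sum]
    have := IntervalIntegrable.sum (μ := MeasureTheory.volume) (a := φ₁) (b := φ₂) s
      (f := fun i t => c i * arcIntegrand (f i) ρ u κ t) fun i hi => (h i hi).arc.const_mul _
    rwa [show (∑ i ∈ s, fun t => c i * arcIntegrand (f i) ρ u κ t) =
      fun t => ∑ i ∈ s, c i * arcIntegrand (f i) ρ u κ t from by funext t; simp] at this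

theorem hankelIntegral_sum {ι : Type*} {s : Finset ι} (c : ι → ℂ) {f : ι → ℂ → ℂ}
    (h : ∀ i ∈ s, HankelIntegrable (f i) ρ u κ φ₁ φ₂) :
    hankelIntegral (fun w => ∑ i ∈ s, c i * f i w) ρ u κ φ₁ φ₂ =
      ∑ i ∈ s, c i * hankelIntegral (f i) ρ u κ φ₁ φ₂ := by
  simp only [hankelIntegral, arcIntegral_eq, rayIntegrand_sum, arcIntegrand_sum]
  rw [MeasureTheory.integral_finsetSum _ fun i hi => (h i hi).ray₁.const_mul _,
    MeasureTheory.integral_finsetSum _ fun i hi => (h i hi).ray₂.const_mul _,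
    intervalIntegral.integral_finsetSum fun i hi => (h i hi).arc.const_mul _,
    ← Finset.sum_neg_distrib, ← Finset.sum_add_distrib, ← Finset.sum_add_distrib, Finset.mul_sum]
  refine Finset.sum_congr rfl fun i _ => ?_
  rw [MeasureTheory.integral_const_mul, MeasureTheory.integral_const_mul,
    intervalIntegral.integral_const_mul]
  ring

theorem hankelIntegral_sub {f g : ℂ → ℂ} (hf : HankelIntegrable f ρ u κ φ₁ φ₂)
    (hg : HankelIntegrable g ρ u κ φ₁ φ₂) :
    hankelIntegral (fun w => f w - g w) ρ u κ φ₁ φ₂ =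
      hankelIntegral f ρ u κ φ₁ φ₂ - hankelIntegral g ρ u κ φ₁ φ₂ := by
  have h : ∀ i ∈ (Finset.univ : Finset Bool),
      HankelIntegrable (if i then f else g) ρ u κ φ₁ φ₂ := by
    intro i _; cases i <;> simpa
  have := hankelIntegral_sum (fun i : Bool => if i then (1 : ℂ) else -1) h
  simpa [sub_eq_add_neg] using this

end linear

/-! ### Integrals depending holomorphically on a parameter -/

/-- Differentiation under the integral sign: for holomorphic integrands, a bound of the integrand
suffices, by Cauchy's estimate. -/
theorem hasDerivAt_integral_of_holomorphic {μ : MeasureTheory.Measure ℝ} {G : ℂ → ℝ → ℂ} {z₀ : ℂ}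
    {r : ℝ} (hr : 0 < r) {bound : ℝ → ℝ}
    (hmeas : ∀ z ∈ Metric.ball z₀ r, MeasureTheory.AEStronglyMeasurable (G z) μ)
    (hdiff : ∀ᵐ t ∂μ, DifferentiableOn ℂ (fun z => G z t) (Metric.ball z₀ r))
    (hbound : ∀ᵐ t ∂μ, ∀ z ∈ Metric.ball z₀ r, ‖G z t‖ ≤ bound t)
    (hint : MeasureTheory.Integrable bound μ) :
    HasDerivAt (fun z => ∫ t, G z t ∂μ) (∫ t, deriv (fun z => G z t) z₀ ∂μ) z₀ := by
  have hz₀ : z₀ ∈ Metric.ball z₀ r := Metric.mem_ball_self hr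
  have hsub : ∀ z ∈ Metric.ball z₀ (r / 2), Metric.closedBall z (r / 4) ⊆ Metric.ball z₀ r :=
    fun z hz => Metric.closedBall_subset_ball' (by rw [Metric.mem_ball] at hz; linarith)
  refine (hasDerivAt_integral_of_dominated_loc_of_deriv_le (μ := μ) (F := G)
    (F' := fun z t => deriv (fun z => G z t) z) (bound := fun t => bound t / (r / 4))
    (s := Metric.ball z₀ (r / 2)) (Metric.ball_mem_nhds _ (half_pos hr)) ?_ ?_ ?_ ?_ ?_ ?_).2
  · filter_upwards [Metric.ball_mem_nhds z₀ hr] with z hz using hmeas z hz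
  · exact hint.mono' (hmeas z₀ hz₀) (hbound.mono fun t ht => ht z₀ hz₀)
  · set h : ℕ → ℂ := fun n => ((r / 2 * (1 / ((n : ℝ) + 1)) : ℝ) : ℂ) with hh
    have hlim : Tendsto h atTop (𝓝 0) := by
      have := (tendsto_one_div_add_atTop_nhds_zero_nat (𝕜 := ℝ)).const_mul (r / 2)
      rw [mul_zero] at this
      have h0 := (Complex.continuous_ofReal.tendsto 0).comp this
      rwa [Complex.ofReal_zero] at h0
    have hne : ∀ n, h n ≠ 0 := fun n => by
      have : 0 < r / 2 * (1 / ((n : ℝ) + 1)) := by positivity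
      exact Complex.ofReal_ne_zero.2 this.ne'
    have hball : ∀ n, z₀ + h n ∈ Metric.ball z₀ r := fun n => by
      have h1 : 0 < r / 2 * (1 / ((n : ℝ) + 1)) := by positivity
      have h2 : 1 / ((n : ℝ) + 1) ≤ 1 := by
        rw [div_le_one (by positivity)]
        linarith [(Nat.cast_nonneg n : (0 : ℝ) ≤ n)]
      rw [Metric.mem_ball, dist_self_add_left, hh, Complex.norm_real, Real.norm_eq_abs,
        abs_of_pos h1]
      nlinarith
    refine aestronglyMeasurable_of_tendsto_ae atTop
      (f := fun n => (h n)⁻¹ • (G (z₀ + h n) - G z₀))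
      (fun n => ((hmeas _ (hball n)).sub (hmeas z₀ hz₀)).const_smul _) ?_
    filter_upwards [hdiff] with t ht
    have hd := ((ht z₀ hz₀).differentiableAt (Metric.ball_mem_nhds z₀ hr)).hasDerivAt
    exact (hasDerivAt_iff_tendsto_slope_zero.1 hd).comp
      (tendsto_nhdsWithin_iff.2 ⟨hlim, Eventually.of_forall hne⟩)
  · filter_upwards [hdiff, hbound] with t ht hb z hz
    refine Complex.norm_deriv_le_of_forall_mem_sphere_norm_le (by linarith)
      (ht.diffContOnCl_ball (hsub z hz)) fun y hy =>
        hb y (hsub z hz (Metric.sphere_subset_closedBall hy))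
  · exact hint.div_const _
  · filter_upwards [hdiff] with t ht z hz
    have hz' : z ∈ Metric.ball z₀ r := Metric.ball_subset_ball (by linarith) hz
    exact ((ht z hz').differentiableAt (Metric.isOpen_ball.mem_nhds hz')).hasDerivAt

theorem hasDerivAt_intervalIntegral_of_holomorphic {G : ℂ → ℝ → ℂ} {a b : ℝ}
    (hc : ContinuousOn (Function.uncurry G) (Set.univ ×ˢ Set.uIcc a b))
    (hd : ∀ t ∈ Set.uIcc a b, Differentiable ℂ fun z => G z t) (z₀ : ℂ) :
    HasDerivAt (fun z => ∫ t in a..b, G z t) (∫ t in a..b, deriv (fun z => G z t) z₀) z₀ := by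
  simp only [intervalIntegral.intervalIntegral_eq_integral_uIoc]
  obtain ⟨C, hC⟩ := ((isCompact_closedBall z₀ 1).prod isCompact_uIcc).exists_bound_of_continuousOn
    (hc.mono (Set.prod_mono (Set.subset_univ _) subset_rfl))
  have hae : ∀ᵐ t ∂MeasureTheory.volume.restrict (Set.uIoc a b), t ∈ Set.uIcc a b :=
    (MeasureTheory.ae_restrict_mem measurableSet_uIoc).mono fun t ht => Set.uIoc_subset_uIcc ht
  refine HasDerivAt.const_smul _ (hasDerivAt_integral_of_holomorphic one_pos (bound := fun _ => C)
    (fun z _ => ?_) (hae.mono fun t ht => (hd t ht).differentiableOn) (hae.mono fun t ht z hz => ?_)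
    ?_)
  · have : ContinuousOn (G z) (Set.uIcc a b) :=
      hc.comp (f := fun t => (z, t)) (by fun_prop) fun t ht => ⟨Set.mem_univ _, ht⟩
    exact (this.mono Set.uIoc_subset_uIcc).aestronglyMeasurable measurableSet_uIoc
  · exact hC (z, t) ⟨Metric.ball_subset_closedBall hz, ht⟩
  · exact MeasureTheory.integrableOn_const (by simp [Set.uIoc])

/-! ### Hankel integrals of powers and logarithms -/

/-- The function `z ^ γ * (log z) ^ j` of `w = log z`. -/
noncomputable def logMono (j : ℕ) (γ w : ℂ) : ℂ :=
  Complex.exp (γ * w) * w ^ j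

theorem abs_log_le {κ s t : ℝ} (hκ : 0 < κ) (hs : 0 < s) (ht : κ ≤ t) :
    |Real.log t| ≤ s * t + (|Real.log s| + |Real.log κ|) := by
  have ht0 := hκ.trans_le ht
  rw [abs_le]
  constructor
  · have h1 := Real.log_le_log hκ ht
    have h2 := neg_abs_le (Real.log κ)
    have h3 := abs_nonneg (Real.log s)
    have : 0 ≤ s * t := by positivity
    linarith
  · have h1 := Real.log_le_sub_one_of_pos (mul_pos hs ht0)
    rw [Real.log_mul hs.ne' ht0.ne'] at h1
    have h2 := neg_abs_le (Real.log s)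
    have h3 := abs_nonneg (Real.log κ)
    linarith

theorem exists_exp_abs_log_le {B κ η : ℝ} (hB : 0 ≤ B) (hκ : 0 < κ) (hη : 0 < η) :
    ∃ c > 0, ∀ t ≥ κ, Real.exp (B * |Real.log t|) ≤ c * Real.exp (η * t) := by
  refine ⟨Real.exp (B * (|Real.log (η / (B + 1))| + |Real.log κ|)), Real.exp_pos _, fun t ht => ?_⟩
  rw [← Real.exp_add, Real.exp_le_exp]
  have h := mul_le_mul_of_nonneg_left (abs_log_le hκ (s := η / (B + 1)) (by positivity) ht) hB
  have h2 : B * (η / (B + 1) * t) ≤ η * t := by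
    have ht0 := hκ.trans_le ht
    rw [← mul_assoc]
    gcongr
    rw [mul_div_assoc', div_le_iff₀ (by positivity)]
    nlinarith
  linarith

theorem exists_norm_logMono_le (j : ℕ) {V b κ η : ℝ} (hb : 0 ≤ b) (hκ : 0 < κ) (hη : 0 < η) :
    ∃ c > 0, ∀ γ : ℂ, ‖γ‖ ≤ b → ∀ t ≥ κ, ∀ φ : ℝ, |φ| ≤ V →
      ‖logMono j γ (Real.log t + φ * Complex.I)‖ ≤ c * Real.exp (η * t) := by
  obtain ⟨c, hc, h⟩ := exists_exp_abs_log_le (B := b + 1) (by positivity) hκ hη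
  refine ⟨j.factorial * Real.exp ((b + 1) * V) * c, by positivity, fun γ hγ t ht φ hφ => ?_⟩
  set w : ℂ := Real.log t + φ * Complex.I with hw
  have hw' : ‖w‖ ≤ |Real.log t| + V := by
    have := norm_le_abs_re_add (w := w) (V := V) (by simpa [hw] using hφ)
    simpa [hw] using this
  have h1 : ‖Complex.exp (γ * w)‖ ≤ Real.exp (b * ‖w‖) := by
    rw [Complex.norm_exp]
    refine Real.exp_le_exp.2 ((Complex.re_le_norm _).trans ?_)
    rw [norm_mul]
    gcongr
  have h2 : ‖w ^ j‖ ≤ j.factorial * Real.exp ‖w‖ := by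
    have := Real.pow_div_factorial_le_exp ‖w‖ (norm_nonneg _) j
    rw [div_le_iff₀ (by positivity)] at this
    rw [norm_pow]; linarith
  rw [logMono, norm_mul]
  calc _ ≤ Real.exp (b * ‖w‖) * (j.factorial * Real.exp ‖w‖) := by gcongr
    _ = j.factorial * Real.exp ((b + 1) * ‖w‖) := by
      rw [add_mul, one_mul, Real.exp_add]; ring
    _ ≤ j.factorial * Real.exp ((b + 1) * (|Real.log t| + V)) := by gcongr
    _ = j.factorial * Real.exp ((b + 1) * V) * Real.exp ((b + 1) * |Real.log t|) := by
      rw [mul_add, Real.exp_add]; ring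
    _ ≤ j.factorial * Real.exp ((b + 1) * V) * (c * Real.exp (η * t)) := by gcongr; exact h t ht
    _ = _ := by ring

theorem differentiable_logMono (j : ℕ) (γ : ℂ) : Differentiable ℂ (logMono j γ) := by
  unfold logMono
  fun_prop

theorem hankelDomain_logMono (j : ℕ) (γ : ℂ) (r : ℝ) :
    HankelDomain (logMono j γ) r Set.univ Set.univ where
  ordConnected := Set.ordConnected_univ
  diff_bank _ _ _ _ := differentiable_logMono j γ _
  diff_disc _ _ _ _ _ := differentiable_logMono j γ _
  growth p q κ η _ hκ hη := by
    obtain ⟨c, hc, h⟩ := exists_norm_logMono_le j (V := max |p| |q|) (norm_nonneg γ) hκ hη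
    exact ⟨c, hc, fun t ht φ hφ => h γ le_rfl t ht φ (abs_le_max_abs_abs hφ.1 hφ.2)⟩

theorem hasDerivAt_logMono (j : ℕ) (γ w : ℂ) :
    HasDerivAt (fun γ => logMono j γ w) (logMono (j + 1) γ w) γ := by
  have h := (((hasDerivAt_id γ).mul_const w).cexp).mul_const (w ^ j)
  refine h.congr_deriv ?_
  show _ = Complex.exp (γ * w) * w ^ (j + 1)
  rw [pow_succ]
  simp only [id]
  ring

theorem hasDerivAt_rayIntegrand_logMono (j : ℕ) (ρ u : ℂ) (φ t : ℝ) (γ : ℂ) :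
    HasDerivAt (fun γ => rayIntegrand (logMono j γ) ρ u φ t)
      (rayIntegrand (logMono (j + 1) γ) ρ u φ t) γ :=
  ((hasDerivAt_logMono j γ _).mul_const _).mul_const _

theorem hasDerivAt_arcIntegrand_logMono (j : ℕ) (ρ u : ℂ) (κ t : ℝ) (γ : ℂ) :
    HasDerivAt (fun γ => arcIntegrand (logMono j γ) ρ u κ t)
      (arcIntegrand (logMono (j + 1) γ) ρ u κ t) γ :=
  ((hasDerivAt_logMono j γ _).mul_const _).mul_const _

theorem hasDerivAt_rayIntegral_logMono (j : ℕ) (ρ : ℂ) {u : ℂ} {κ φ : ℝ} (hκ : 0 < κ)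
    (hcos : Real.cos (u.im + φ) < 0) (γ : ℂ) :
    HasDerivAt (fun γ => ∫ t in Set.Ioi κ, rayIntegrand (logMono j γ) ρ u φ t)
      (∫ t in Set.Ioi κ, rayIntegrand (logMono (j + 1) γ) ρ u φ t) γ := by
  set b := Real.exp u.re * (-Real.cos (u.im + φ)) with hb
  have hb0 : 0 < b := mul_pos (Real.exp_pos _) (by linarith)
  obtain ⟨c, hc, hbound⟩ := exists_norm_logMono_le j (V := |φ|) (b := ‖γ‖ + 1) (by positivity) hκ
    (half_pos hb0)
  have h := hasDerivAt_integral_of_holomorphic (z₀ := γ) one_pos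
    (G := fun γ => rayIntegrand (logMono j γ) ρ u φ)
    (μ := MeasureTheory.volume.restrict (Set.Ioi κ))
    (fun z _ => (((hankelDomain_logMono j z 1).continuousOn_ray ρ u hκ (Set.mem_univ φ)).mono
      Set.Ioi_subset_Ici_self).aestronglyMeasurable measurableSet_Ioi)
    (Eventually.of_forall fun t z _ =>
      (hasDerivAt_rayIntegrand_logMono j ρ u φ t z).differentiableAt.differentiableWithinAt)
    ((MeasureTheory.ae_restrict_mem measurableSet_Ioi).mono fun t ht z hz => ?_)
    (integrableOn_exp_neg_mul κ (half_pos hb0) (c * ‖Complex.exp (Complex.exp u * ρ)‖))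
  · simpa only [(hasDerivAt_rayIntegrand_logMono j ρ u φ _ γ).deriv] using h
  · have ht' : κ < t := ht
    have hz' : ‖z‖ ≤ ‖γ‖ + 1 := by
      have h1 : dist z γ < 1 := hz
      rw [dist_eq_norm] at h1
      have := norm_sub_norm_le z γ
      linarith
    have h := norm_rayIntegrand_le (f := logMono j z) ρ (u := u) (hκ.trans ht').le
      (le_of_eq (neg_neg _).symm) (hbound z hz' t ht'.le φ le_rfl)
    rw [← hb] at h
    convert h using 3
    ring

theorem hasDerivAt_hankelIntegral_logMono (j : ℕ) (ρ : ℂ) {u : ℂ} {κ φ₁ φ₂ : ℝ} (hκ : 0 < κ)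
    (hcos₁ : Real.cos (u.im + φ₁) < 0) (hcos₂ : Real.cos (u.im + φ₂) < 0) (γ : ℂ) :
    HasDerivAt (fun γ => hankelIntegral (logMono j γ) ρ u κ φ₁ φ₂)
      (hankelIntegral (logMono (j + 1) γ) ρ u κ φ₁ φ₂) γ := by
  have harc := hasDerivAt_intervalIntegral_of_holomorphic (a := φ₁) (b := φ₂)
    (G := fun γ => arcIntegrand (logMono j γ) ρ u κ) (Continuous.continuousOn (by
      simp only [arcIntegrand, logMono, Function.uncurry_def]; fun_prop))
    (fun t _ z => (hasDerivAt_arcIntegrand_logMono j ρ u κ t z).differentiableAt) γ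
  simp only [(hasDerivAt_arcIntegrand_logMono j ρ u κ _ γ).deriv] at harc
  exact (((hasDerivAt_rayIntegral_logMono j ρ hκ hcos₁ γ).neg.add harc).add
    (hasDerivAt_rayIntegral_logMono j ρ hκ hcos₂ γ)).const_mul _

theorem iteratedDeriv_hankelIntegral_logMono (j : ℕ) (ρ : ℂ) {u : ℂ} {κ φ₁ φ₂ : ℝ} (hκ : 0 < κ)
    (hcos₁ : Real.cos (u.im + φ₁) < 0) (hcos₂ : Real.cos (u.im + φ₂) < 0) :
    iteratedDeriv j (fun γ => hankelIntegral (logMono 0 γ) ρ u κ φ₁ φ₂) =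
      fun γ => hankelIntegral (logMono j γ) ρ u κ φ₁ φ₂ := by
  induction j with
  | zero => rw [iteratedDeriv_zero]
  | succ j ih =>
    rw [iteratedDeriv_succ, ih]
    funext γ
    exact (hasDerivAt_hankelIntegral_logMono j ρ hκ hcos₁ hcos₂ γ).deriv

/-! ### Hankel's formula -/

theorem cos_neg_of_abs_add_pi_lt {y : ℝ} (h : |y + Real.pi| < Real.pi / 2) : Real.cos y < 0 := by
  rw [abs_lt] at h
  have := Real.cos_pos_of_mem_Ioo (x := y + Real.pi) ⟨by linarith, h.2⟩
  rw [Real.cos_add_pi] at this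
  linarith

theorem cos_neg_of_abs_sub_pi_lt {y : ℝ} (h : |y - Real.pi| < Real.pi / 2) : Real.cos y < 0 := by
  rw [abs_lt] at h
  have := Real.cos_pos_of_mem_Ioo (x := y - Real.pi) ⟨by linarith, h.2⟩
  rw [Real.cos_sub_pi] at this
  linarith

/-- On a ray along which `x * (z - ρ)` is real negative, the integrand is that of Euler's
integral. -/
theorem rayIntegrand_logMono_of_exp_eq (γ ρ u : ℂ) {φ : ℝ}
    (hφ : Complex.exp u * Complex.exp (φ * Complex.I) = -(Real.exp u.re : ℂ)) {t : ℝ}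
    (ht : 0 < t) :
    rayIntegrand (logMono 0 γ) ρ u φ t =
      Complex.exp (Complex.exp u * ρ) * Complex.exp ((γ + 1) * (φ * Complex.I)) *
        ((t : ℂ) ^ (γ + 1 - 1) * Complex.exp (-(Real.exp u.re * t))) := by
  have h1 : Complex.exp u * (ρ + t * Complex.exp (φ * Complex.I)) =
      Complex.exp u * ρ + -(Real.exp u.re * t) := by linear_combination (t : ℂ) * hφ
  rw [rayIntegrand, h1, Complex.exp_add, add_sub_cancel_right,
    Complex.cpow_def_of_ne_zero (by exact_mod_cast ht.ne'), ← Complex.ofReal_log ht.le, logMono,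
    pow_zero, mul_one, mul_add, Complex.exp_add, add_mul, Complex.exp_add, one_mul,
    mul_comm γ (Real.log t : ℂ)]
  ring

theorem exp_mul_ofReal_log_exp (x : ℝ) : (1 / (Real.exp x : ℂ)) = Complex.exp (-x) := by
  rw [Complex.ofReal_exp, Complex.exp_neg, one_div]

theorem integral_rayIntegrand_logMono {γ : ℂ} (hγ : 0 < γ.re) (ρ u : ℂ) {φ : ℝ}
    (hφ : Complex.exp u * Complex.exp (φ * Complex.I) = -(Real.exp u.re : ℂ)) :
    MeasureTheory.IntegrableOn (rayIntegrand (logMono 0 γ) ρ u φ) (Set.Ioi 0) ∧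
    ∫ t in Set.Ioi 0, rayIntegrand (logMono 0 γ) ρ u φ t =
      Complex.exp (Complex.exp u * ρ) * Complex.exp ((γ + 1) * (φ * Complex.I)) *
        (Complex.exp (-((γ + 1) * u.re)) * Complex.Gamma (γ + 1)) := by
  have hre : 0 < (γ + 1).re := by simp; linarith
  have hpow : (1 / (Real.exp u.re : ℂ)) ^ (γ + 1) = Complex.exp (-((γ + 1) * u.re)) := by
    rw [exp_mul_ofReal_log_exp, Complex.cpow_def_of_ne_zero (Complex.exp_ne_zero _),
      ← Complex.ofReal_neg, ← Complex.ofReal_exp, ← Complex.ofReal_log (Real.exp_pos _).le,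
      Real.log_exp]
    congr 1
    push_cast
    ring
  have hint := Complex.integral_cpow_mul_exp_neg_mul_Ioi hre (Real.exp_pos u.re)
  rw [hpow] at hint
  have hval : ∫ t in Set.Ioi 0, rayIntegrand (logMono 0 γ) ρ u φ t =
      Complex.exp (Complex.exp u * ρ) * Complex.exp ((γ + 1) * (φ * Complex.I)) *
        (Complex.exp (-((γ + 1) * u.re)) * Complex.Gamma (γ + 1)) := by
    rw [← hint, ← MeasureTheory.integral_const_mul]
    exact MeasureTheory.setIntegral_congr_fun measurableSet_Ioi fun t ht =>
      rayIntegrand_logMono_of_exp_eq γ ρ u hφ ht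
  refine ⟨MeasureTheory.Integrable.of_integral_ne_zero ?_, hval⟩
  rw [hval]
  have := Complex.Gamma_ne_zero_of_re_pos hre
  simp [this, Complex.exp_ne_zero]

theorem tendsto_rayIntegral_zero {g : ℝ → ℂ}
    (hg : MeasureTheory.IntegrableOn g (Set.Ioi 0)) :
    Tendsto (fun κ => ∫ t in Set.Ioi κ, g t) (𝓝[>] 0) (𝓝 (∫ t in Set.Ioi 0, g t)) := by
  have h := (MeasureTheory.aecover_Ioi_of_Ioi (μ := MeasureTheory.volume) (A := (0 : ℝ))
    (l := 𝓝[>] 0) (a := id) (tendsto_id'.2 nhdsWithin_le_nhds)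
    ).integral_tendsto_of_countably_generated hg
  refine h.congr' ?_
  filter_upwards [self_mem_nhdsWithin] with κ hκ
  rw [MeasureTheory.Measure.restrict_restrict measurableSet_Ioi, id,
    Set.inter_eq_left.2 (Set.Ioi_subset_Ioi (le_of_lt hκ))]

theorem tendsto_arcIntegral_logMono_zero {γ : ℂ} (hγ : 0 < γ.re) (ρ u : ℂ) (φ₁ φ₂ : ℝ) :
    Tendsto (fun κ => arcIntegral (logMono 0 γ) ρ u κ φ₁ φ₂) (𝓝[>] 0) (𝓝 0) := by
  set V := max |φ₁| |φ₂|
  set K := Real.exp (‖γ‖ * V) *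
    (‖Complex.exp (Complex.exp u * ρ)‖ * Real.exp (Real.exp u.re)) * |φ₂ - φ₁|
  have hlim : Tendsto (fun κ : ℝ => K * κ) (𝓝[>] 0) (𝓝 0) := by
    have : Tendsto (fun κ : ℝ => K * κ) (𝓝 0) (𝓝 (K * 0)) := tendsto_id.const_mul K
    rw [mul_zero] at this
    exact this.mono_left nhdsWithin_le_nhds
  refine squeeze_zero_norm' ?_ hlim
  filter_upwards [Ioo_mem_nhdsGT (one_pos (α := ℝ))] with κ hκ
  rw [arcIntegral_eq]
  refine (intervalIntegral.norm_integral_le_of_norm_le_const (C := Real.exp (‖γ‖ * V) *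
    (‖Complex.exp (Complex.exp u * ρ)‖ * Real.exp (Real.exp u.re)) * κ) fun τ hτ => ?_).trans
    (le_of_eq (by ring))
  rw [norm_arcIntegrand _ _ _ hκ.1.le]
  have hτ' := Set.uIoc_subset_uIcc hτ
  have hV : |τ| ≤ V := by
    rcases Set.mem_uIcc.1 hτ' with h | h
    · exact abs_le_max_abs_abs h.1 h.2
    · rw [show V = max |φ₂| |φ₁| from max_comm _ _]; exact abs_le_max_abs_abs h.1 h.2
  have h1 : ‖logMono 0 γ (Real.log κ + τ * Complex.I)‖ ≤ Real.exp (‖γ‖ * V) := by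
    rw [logMono, pow_zero, mul_one, Complex.norm_exp, Real.exp_le_exp]
    have hlog : Real.log κ ≤ 0 := Real.log_nonpos hκ.1.le hκ.2.le
    have him : |γ.im * τ| ≤ ‖γ‖ * V := by
      rw [abs_mul]
      exact mul_le_mul (Complex.abs_im_le_norm γ) hV (abs_nonneg _) (norm_nonneg _)
    have := neg_abs_le (γ.im * τ)
    simp
    nlinarith
  have h2 : Real.exp (Real.exp u.re * Real.cos (u.im + τ) * κ) ≤ Real.exp (Real.exp u.re) := by
    rw [Real.exp_le_exp]
    have h3 : Real.cos (u.im + τ) * κ ≤ 1 := by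
      have := Real.cos_le_one (u.im + τ)
      nlinarith [hκ.1, hκ.2]
    have := Real.exp_pos u.re
    nlinarith
  have := hκ.1
  gcongr

/-- The reflection formula, in the form which is also valid at the poles. -/
theorem sin_mul_Gamma_div_pi {γ : ℂ} (hγ : Complex.Gamma (γ + 1) ≠ 0) :
    Complex.sin (Real.pi * (γ + 1)) * Complex.Gamma (γ + 1) / Real.pi =
      (Complex.Gamma (-γ))⁻¹ := by
  have h := Complex.Gamma_mul_Gamma_one_sub (γ + 1)
  rw [show 1 - (γ + 1) = -γ by ring] at h
  have h2 : Complex.Gamma (-γ) =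
      (Real.pi / Complex.sin (Real.pi * (γ + 1))) / Complex.Gamma (γ + 1) := by
    rw [← h]; field_simp
  rw [h2, inv_div, div_div_eq_mul_div]
  ring

/-- Hankel's formula when the circle around the origin can be shrunk to a point. -/
theorem hankelIntegral_logMono_of_re_pos {γ : ℂ} (hγ : 0 < γ.re) (ρ : ℂ) {u : ℂ}
    {κ φ₁ φ₂ : ℝ} (hκ : 0 < κ) (h₁ : |u.im + φ₁ + Real.pi| < Real.pi / 2)
    (h₂ : |u.im + φ₂ - Real.pi| < Real.pi / 2) :
    hankelIntegral (logMono 0 γ) ρ u κ φ₁ φ₂ = Complex.exp (Complex.exp u * ρ) *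
      (Complex.exp (-(γ + 1) * u) * (Complex.Gamma (-γ))⁻¹) := by
  set ψ₁ := -u.im - Real.pi with hψ₁
  set ψ₂ := -u.im + Real.pi with hψ₂
  have hpi := Real.pi_pos
  have hexp : ∀ ε : ℂ, Complex.exp ε = -1 → ∀ ψ : ℝ, (ψ : ℂ) * Complex.I = -(u.im * Complex.I) + ε →
      Complex.exp u * Complex.exp (ψ * Complex.I) = -(Real.exp u.re : ℂ) := fun ε hε ψ hψ => by
    rw [hψ, ← Complex.exp_add, show u + (-(u.im * Complex.I) + ε) =
      (u - u.im * Complex.I) + ε by ring, Complex.exp_add, hε,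
      show u - u.im * Complex.I = u.re by apply Complex.ext <;> simp, Complex.ofReal_exp]
    ring
  have e1 : Complex.exp u * Complex.exp (ψ₁ * Complex.I) = -(Real.exp u.re : ℂ) :=
    hexp (-(Real.pi * Complex.I)) (by rw [Complex.exp_neg, Complex.exp_pi_mul_I]; norm_num) _
      (by rw [hψ₁]; push_cast; ring)
  have e2 : Complex.exp u * Complex.exp (ψ₂ * Complex.I) = -(Real.exp u.re : ℂ) :=
    hexp (Real.pi * Complex.I) Complex.exp_pi_mul_I _ (by rw [hψ₂]; push_cast; ring)
  obtain ⟨i1, v1⟩ := integral_rayIntegrand_logMono hγ ρ u e1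
  obtain ⟨i2, v2⟩ := integral_rayIntegrand_logMono hγ ρ u e2
  -- the integral over the contours with real negative `x z` is independent of the radius
  have hconst : ∀ κ' : ℝ, 0 < κ' → hankelIntegral (logMono 0 γ) ρ u κ φ₁ φ₂ =
      hankelIntegral (logMono 0 γ) ρ u κ' ψ₁ ψ₂ := fun κ' hκ' => by
    refine (hankelDomain_logMono 0 γ (max κ κ' + 1)).hankelIntegral_eq ρ hκ
      (by linarith [le_max_left κ κ']) hκ' (by linarith [le_max_right κ κ']) (Set.mem_univ _)
      (Set.mem_univ _) (Set.mem_univ _) (Set.mem_univ _) (Set.subset_univ _) (Set.subset_univ _)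
      (fun φ hφ => cos_neg_of_abs_add_pi_lt ?_) fun φ hφ => cos_neg_of_abs_sub_pi_lt ?_
    · rw [abs_lt] at h₁ ⊢
      rcases Set.mem_uIcc.1 hφ with h | h <;> constructor <;> linarith [h.1, h.2]
    · rw [abs_lt] at h₂ ⊢
      rcases Set.mem_uIcc.1 hφ with h | h <;> constructor <;> linarith [h.1, h.2]
  have hlim : Tendsto (fun κ' => hankelIntegral (logMono 0 γ) ρ u κ' ψ₁ ψ₂) (𝓝[>] 0)
      (𝓝 ((2 * Complex.I * Real.pi)⁻¹ * (-(∫ t in Set.Ioi 0, rayIntegrand (logMono 0 γ) ρ u ψ₁ t) +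
        0 + ∫ t in Set.Ioi 0, rayIntegrand (logMono 0 γ) ρ u ψ₂ t))) :=
    (((tendsto_rayIntegral_zero i1).neg.add (tendsto_arcIntegral_logMono_zero hγ ρ u ψ₁ ψ₂)).add
      (tendsto_rayIntegral_zero i2)).const_mul _
  have hlim' := hlim.congr' (f₂ := fun _ => hankelIntegral (logMono 0 γ) ρ u κ φ₁ φ₂) (by
    filter_upwards [self_mem_nhdsWithin] with κ' hκ' using (hconst κ' hκ').symm)
  rw [tendsto_nhds_unique tendsto_const_nhds hlim', v1, v2,
    ← sin_mul_Gamma_div_pi (Complex.Gamma_ne_zero_of_re_pos (by simp; linarith))]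
  have hsin : 2 * Complex.sin (Real.pi * (γ + 1)) =
      (Complex.exp (-((γ + 1) * (Real.pi * Complex.I)))
      - Complex.exp ((γ + 1) * (Real.pi * Complex.I))) * Complex.I := by
    rw [Complex.two_sin]
    congr 3 <;> ring_nf
  have x1 : Complex.exp ((γ + 1) * (ψ₁ * Complex.I)) =
      Complex.exp (-((γ + 1) * (u.im * Complex.I))) *
      Complex.exp (-((γ + 1) * (Real.pi * Complex.I))) := by
    rw [← Complex.exp_add, hψ₁]; congr 1; push_cast; ring
  have x2 : Complex.exp ((γ + 1) * (ψ₂ * Complex.I)) =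
      Complex.exp (-((γ + 1) * (u.im * Complex.I))) *
      Complex.exp ((γ + 1) * (Real.pi * Complex.I)) := by
    rw [← Complex.exp_add, hψ₂]; congr 1; push_cast; ring
  have x3 : Complex.exp (-(γ + 1) * u) = Complex.exp (-((γ + 1) * (u.im * Complex.I))) *
      Complex.exp (-((γ + 1) * u.re)) := by
    rw [← Complex.exp_add]
    congr 1
    conv_lhs => rw [← Complex.re_add_im u]
    ring
  rw [x1, x2, x3]
  rw [show (2 * Complex.I * (Real.pi : ℂ))⁻¹ = -Complex.I / (2 * Real.pi) by
    rw [mul_inv, mul_inv, Complex.inv_I]; field_simp]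
  linear_combination (-(Complex.exp (Complex.exp u * ρ) *
    Complex.exp (-((γ + 1) * (u.im * Complex.I))) * Complex.exp (-((γ + 1) * u.re)) *
    Complex.Gamma (γ + 1)) / (2 * Real.pi)) * hsin

/-- Hankel's formula. -/
theorem hankelIntegral_logMono_zero (ρ : ℂ) {u : ℂ} {κ φ₁ φ₂ : ℝ} (hκ : 0 < κ)
    (h₁ : |u.im + φ₁ + Real.pi| < Real.pi / 2) (h₂ : |u.im + φ₂ - Real.pi| < Real.pi / 2) :
    (fun γ => hankelIntegral (logMono 0 γ) ρ u κ φ₁ φ₂) = fun γ =>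
      Complex.exp (Complex.exp u * ρ) *
        (Complex.exp (-(γ + 1) * u) * (Complex.Gamma (-γ))⁻¹) := by
  have hd : Differentiable ℂ fun γ => hankelIntegral (logMono 0 γ) ρ u κ φ₁ φ₂ := fun γ =>
    (hasDerivAt_hankelIntegral_logMono 0 ρ hκ (cos_neg_of_abs_add_pi_lt h₁)
      (cos_neg_of_abs_sub_pi_lt h₂) γ).differentiableAt
  have hd' : Differentiable ℂ fun γ => Complex.exp (Complex.exp u * ρ) *
      (Complex.exp (-(γ + 1) * u) * (Complex.Gamma (-γ))⁻¹) :=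
    (Differentiable.mul (by fun_prop) differentiable_Gamma_neg_inv).const_mul _
  refine AnalyticOnNhd.eq_of_eventuallyEq (𝕜 := ℂ) (fun z _ => hd.analyticAt z)
    (fun z _ => hd'.analyticAt z) (z₀ := 1) ?_
  filter_upwards [(isOpen_lt continuous_const Complex.continuous_re).mem_nhds
    (show (0 : ℝ) < (1 : ℂ).re by simp)] with γ hγ
  exact hankelIntegral_logMono_of_re_pos hγ ρ hκ h₁ h₂

theorem eval_hankelMono (γ v : ℂ) (j : ℕ) :
    (hankelMono γ j).eval v = ∑ i ∈ Finset.range (j + 1), (j.choose i : ℂ) * v ^ i *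
      iteratedDeriv (j - i) (fun y => (Complex.Gamma (-y))⁻¹) γ := by
  simp only [hankelMono, Polynomial.eval_finsetSum, Polynomial.eval_mul, Polynomial.eval_C,
    Polynomial.eval_pow, Polynomial.eval_X]
  exact Finset.sum_congr rfl fun i _ => by ring

/-- Hankel's formula with powers of the logarithm: the `j`-th derivative of Hankel's formula with
respect to the exponent. -/
theorem hankelIntegral_logMono (j : ℕ) (γ ρ : ℂ) {u : ℂ} {κ φ₁ φ₂ : ℝ} (hκ : 0 < κ)
    (h₁ : |u.im + φ₁ + Real.pi| < Real.pi / 2) (h₂ : |u.im + φ₂ - Real.pi| < Real.pi / 2) :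
    hankelIntegral (logMono j γ) ρ u κ φ₁ φ₂ = Complex.exp (Complex.exp u * ρ) *
      (Complex.exp (-(γ + 1) * u) * (hankelMono γ j).eval (-u)) := by
  have h := congrFun (iteratedDeriv_hankelIntegral_logMono j ρ hκ (cos_neg_of_abs_add_pi_lt h₁)
    (cos_neg_of_abs_sub_pi_lt h₂)) γ
  have hexp : (fun γ => Complex.exp (-(γ + 1) * u)) =
      fun γ => Complex.exp (-u) * Complex.exp (-u * γ) := by
    funext γ
    rw [← Complex.exp_add]; congr 1; ring
  have hiter : ∀ i, iteratedDeriv i (fun γ => Complex.exp (-(γ + 1) * u)) γ =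
      (-u) ^ i * Complex.exp (-(γ + 1) * u) := fun i => by
    rw [hexp, iteratedDeriv_const_mul_field, iteratedDeriv_cexp_const_mul, congrFun hexp γ]
    ring
  rw [← h, hankelIntegral_logMono_zero ρ hκ h₁ h₂, iteratedDeriv_const_mul_field,
    iteratedDeriv_fun_mul (Differentiable.contDiff (by fun_prop)).contDiffAt
      differentiable_Gamma_neg_inv.contDiff.contDiffAt, eval_hankelMono]
  congr 1
  rw [Finset.mul_sum]
  refine Finset.sum_congr rfl fun i _ => ?_
  rw [hiter]
  ring

theorem exp_mul_eval_eq_sum (γ : ℂ) (p : Polynomial ℂ) :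
    (fun w => Complex.exp (γ * w) * p.eval w) =
      fun w => ∑ j ∈ p.support, p.coeff j * logMono j γ w := by
  funext w
  rw [Polynomial.eval_eq_sum, Polynomial.sum, Finset.mul_sum]
  exact Finset.sum_congr rfl fun j _ => by rw [logMono]; ring

theorem hankelIntegrable_exp_mul_eval (γ : ℂ) (p : Polynomial ℂ) (ρ : ℂ) {u : ℂ} {κ φ₁ φ₂ : ℝ}
    (hκ : 0 < κ) (h₁ : |u.im + φ₁ + Real.pi| < Real.pi / 2)
    (h₂ : |u.im + φ₂ - Real.pi| < Real.pi / 2) :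
    HankelIntegrable (fun w => Complex.exp (γ * w) * p.eval w) ρ u κ φ₁ φ₂ := by
  rw [exp_mul_eval_eq_sum]
  exact HankelIntegrable.sum _ fun j _ => (hankelDomain_logMono j γ (κ + 1)).hankelIntegrable ρ hκ
    (by linarith) (Set.mem_univ _) (Set.mem_univ _) (Set.mem_univ _) (Set.mem_univ _)
    (cos_neg_of_abs_add_pi_lt h₁) (cos_neg_of_abs_sub_pi_lt h₂)

/-- Hankel's formula for a power times a polynomial in the logarithm. -/
theorem hankelIntegral_exp_mul_eval (γ : ℂ) (p : Polynomial ℂ) (ρ : ℂ) {u : ℂ} {κ φ₁ φ₂ : ℝ}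
    (hκ : 0 < κ) (h₁ : |u.im + φ₁ + Real.pi| < Real.pi / 2)
    (h₂ : |u.im + φ₂ - Real.pi| < Real.pi / 2) :
    hankelIntegral (fun w => Complex.exp (γ * w) * p.eval w) ρ u κ φ₁ φ₂ =
      Complex.exp (Complex.exp u * ρ) *
        (Complex.exp (-(γ + 1) * u) * (monoLin (hankelMono γ) p).eval (-u)) := by
  rw [exp_mul_eval_eq_sum, hankelIntegral_sum _ fun j _ =>
    (hankelDomain_logMono j γ (κ + 1)).hankelIntegrable ρ hκ
    (by linarith) (Set.mem_univ _) (Set.mem_univ _) (Set.mem_univ _) (Set.mem_univ _)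
    (cos_neg_of_abs_add_pi_lt h₁) (cos_neg_of_abs_sub_pi_lt h₂), monoLin_apply, Polynomial.sum,
    Polynomial.eval_finsetSum, Finset.mul_sum, Finset.mul_sum]
  refine Finset.sum_congr rfl fun j _ => ?_
  rw [hankelIntegral_logMono j γ ρ hκ h₁ h₂, Polynomial.eval_smul, smul_eq_mul]
  ring

/-! ### The formal function at the origin -/

theorem coeff_hankelMono (γ : ℂ) (j i : ℕ) : (hankelMono γ j).coeff i =
    (j.choose i : ℂ) * iteratedDeriv (j - i) (fun y => (Complex.Gamma (-y))⁻¹) γ := by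
  simp only [hankelMono, Polynomial.finsetSum_coeff, Polynomial.coeff_C_mul_X_pow]
  rw [Finset.sum_ite_eq]
  split_ifs with h
  · rfl
  · rw [Nat.choose_eq_zero_of_lt (by simpa using h)]
    simp

theorem coeff_gammaOpZero_laplaceInf {a : ℂ → Polynomial ℂ} {J : ℕ}
    (hJ : ∀ β, (a β).natDegree < J) (β : ℂ) (i : ℕ) :
    (gammaOpZero (laplaceInf a) β).coeff i = ∑ j ∈ Finset.range J, (a β).coeff j *
      ((-1) ^ j * (-1) ^ i * (j.choose i : ℂ) *
        iteratedDeriv (j - i) (fun y => (Complex.Gamma (-y))⁻¹) (-β - 1)) := by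
  rw [gammaOpZero_laplaceInf, ← monoLin_comp_neg, monoLin_apply,
    Polynomial.sum_over_range' _ (fun _ => by rw [zero_smul]) J (hJ β), Polynomial.finsetSum_coeff]
  refine Finset.sum_congr rfl fun j _ => ?_
  rw [Polynomial.coeff_smul, Polynomial.coeff_smul, show (-Polynomial.X : Polynomial ℂ) =
    Polynomial.C (-1) * Polynomial.X by simp, Polynomial.comp_C_mul_X_coeff, coeff_hankelMono,
    smul_eq_mul, smul_eq_mul]
  ring

theorem gammaOpZero_laplaceInf_eq_zero {a : ℂ → Polynomial ℂ} {β : ℂ} (h : a β = 0) :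
    gammaOpZero (laplaceInf a) β = 0 := by
  rw [gammaOpZero_laplaceInf, h]
  simp

theorem isLogSeries_gammaOpZero_laplaceInf {a : ℂ → Polynomial ℂ} (h : IsLogSeries a) :
    IsLogSeries (gammaOpZero (laplaceInf a)) := by
  obtain ⟨S, J, -, h1, hJ⟩ := h.exists_normalized
  refine ⟨S, Finset.range J, fun β i hi => ⟨?_, h1 β fun h0 => hi ?_⟩⟩
  · by_contra hiJ
    apply hi
    rw [coeff_gammaOpZero_laplaceInf hJ]
    refine Finset.sum_eq_zero fun j hj => ?_
    rw [Finset.mem_range] at hj hiJ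
    rw [Nat.choose_eq_zero_of_lt (by omega)]
    simp
  · rw [gammaOpZero_laplaceInf_eq_zero h0, Polynomial.coeff_zero]

/-- The functional equation makes `1 / Γ` decay faster than any geometric sequence along `s + ℕ`. -/
theorem norm_Gamma_add_nat_inv_le {M : ℝ} {s : ℂ} (hs : 1 ≤ s.re) (hM : ‖(Complex.Gamma s)⁻¹‖ ≤ M)
    (m : ℕ) : ‖(Complex.Gamma (s + m))⁻¹‖ ≤ M / m.factorial := by
  induction m with
  | zero => simpa using hM
  | succ m ih =>
    have hre : (m : ℝ) + 1 ≤ (s + m).re := by simp; linarith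
    have h0 : s + m ≠ 0 := fun h => by
      rw [h] at hre
      simp at hre
      linarith [(Nat.cast_nonneg m : (0 : ℝ) ≤ m)]
    have h1 : (m : ℝ) + 1 ≤ ‖s + m‖ := hre.trans (Complex.re_le_norm _)
    have hM0 : 0 ≤ M := (norm_nonneg _).trans hM
    rw [Nat.cast_succ, ← add_assoc, Complex.Gamma_add_one _ h0, mul_inv, norm_mul, norm_inv,
      Nat.factorial_succ]
    calc _ ≤ ((m : ℝ) + 1)⁻¹ * (M / m.factorial) := by gcongr
      _ = _ := by push_cast; field_simp

theorem isEntireSeries_iteratedDeriv_Gamma_neg_inv (α : ℂ) (k : ℕ) : IsEntireSeries fun n : ℕ =>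
    iteratedDeriv k (fun y => (Complex.Gamma (-y))⁻¹) (-(α + n) - 1) := by
  intro r hr
  obtain ⟨n₀, hn₀⟩ := exists_nat_ge (1 - α.re)
  set c : ℂ := α + 1 + n₀ with hc
  obtain ⟨M, hM⟩ := (isCompact_closedBall c 1).exists_bound_of_continuousOn
    Complex.differentiable_one_div_Gamma.continuous.continuousOn
  refine (summable_nat_add_iff n₀).1 ?_
  refine Summable.of_nonneg_of_le (fun m => by positivity) (fun m => ?_)
    ((Real.summable_pow_div_factorial r).mul_left (k.factorial * M * r ^ n₀))
  have hbound : ‖iteratedDeriv k (fun y => (Complex.Gamma (-y))⁻¹) (-(α + (m + n₀ : ℕ)) - 1)‖ ≤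
      k.factorial * (M / m.factorial) / 1 ^ k := by
    refine Complex.norm_iteratedDeriv_le_of_forall_mem_sphere_norm_le k one_pos
      differentiable_Gamma_neg_inv.diffContOnCl fun y hy => ?_
    have hmem : -y - m ∈ Metric.closedBall c 1 := by
      rw [mem_sphere_iff_norm] at hy
      rw [mem_closedBall_iff_norm, ← norm_neg, ← hy, hc]
      apply le_of_eq
      congr 1
      push_cast
      ring
    have hre : 1 ≤ (-y - m).re := by
      have h1 := (abs_le.1 ((Complex.abs_re_le_norm (-y - m - c)).trans
        (mem_closedBall_iff_norm.1 hmem))).1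
      rw [Complex.sub_re, hc] at h1
      simp only [Complex.add_re, Complex.one_re, Complex.natCast_re] at h1
      linarith
    simpa using norm_Gamma_add_nat_inv_le hre (hM _ hmem) m
  rw [one_pow, div_one] at hbound
  refine (mul_le_mul_of_nonneg_right hbound (by positivity)).trans (le_of_eq ?_)
  rw [pow_add]
  ring

theorem isEntireSeries_gammaOpZero_laplaceInf {a : ℂ → Polynomial ℂ} (h : IsNilsson a) (α : ℂ)
    (i : ℕ) : IsEntireSeries fun n => (gammaOpZero (laplaceInf a) (α + n)).coeff i := by
  intro r hr
  obtain ⟨S, J, -, -, hJ⟩ := h.1.exists_normalized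
  obtain ⟨M, A, hM, hA, hb⟩ := h.exists_coeff_bound {α} J
  refine Summable.of_nonneg_of_le (fun n => by positivity) (fun n => ?_)
    (summable_sum (s := Finset.range J) fun j _ =>
      ((isEntireSeries_iteratedDeriv_Gamma_neg_inv α (j - i) (A * r) (by positivity)).mul_left
        (M * (j.choose i : ℝ))))
  simp only [coeff_gammaOpZero_laplaceInf hJ]
  refine (mul_le_mul_of_nonneg_right (norm_sum_le _ _) (by positivity)).trans ?_
  rw [Finset.sum_mul]
  refine Finset.sum_le_sum fun j hj => ?_
  rw [norm_mul, norm_mul, norm_mul, norm_mul, norm_pow, norm_pow, norm_neg, norm_one, one_pow,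
    one_pow, one_mul, one_mul, Complex.norm_natCast, mul_pow]
  have := hb α (Finset.mem_singleton_self α) j (Finset.mem_range.1 hj) n
  calc _ ≤ M * A ^ n * ((j.choose i : ℝ) *
        ‖iteratedDeriv (j - i) (fun y => (Complex.Gamma (-y))⁻¹) (-(α + n) - 1)‖) * r ^ n := by
        gcongr
    _ = _ := by ring

/-! ### Circle integrals at infinity -/

theorem infTerm_eq_zero {a : ℂ → Polynomial ℂ} {β : ℂ} (h : a β = 0) (w : ℂ) :
    infTerm a w β = 0 := by
  simp [infTerm, h]

theorem finTerm_eq_zero {a : ℂ → Polynomial ℂ} {β : ℂ} (h : a β = 0) (w : ℂ) :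
    finTerm a w β = 0 := by
  simp [finTerm, h]

/-- Outside of a large disc, the terms of a formal function at infinity in the Nilsson class are
dominated by a convergent geometric series. -/
theorem norm_infTerm_le_geometric {M A L t : ℝ} {n : ℕ} (hM : 0 ≤ M) (hA : 0 < A)
    (hL : 0 ≤ L) (ht : 2 * A ≤ t) {x : ℂ}
    (hx : ‖x‖ ≤ M * A ^ n * Real.exp (-(n * Real.log t)) * L) :
    ‖x‖ ≤ M * L * (1 / 2) ^ n := by
  have ht0 : 0 < t := by linarith
  have h1 : A ^ n * Real.exp (-(n * Real.log t)) ≤ (1 / 2) ^ n := by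
    rw [Real.exp_neg, mul_comm (n : ℝ), Real.exp_mul, Real.exp_log ht0, Real.rpow_natCast,
      ← inv_pow, ← mul_pow]
    refine pow_le_pow_left₀ (by positivity) ?_ n
    rw [← div_eq_mul_inv, div_le_div_iff₀ ht0 two_pos]
    linarith
  calc ‖x‖ ≤ M * A ^ n * Real.exp (-(n * Real.log t)) * L := hx
    _ = M * (A ^ n * Real.exp (-(n * Real.log t))) * L := by ring
    _ ≤ M * (1 / 2) ^ n * L := by gcongr
    _ = _ := by ring

theorem summable_geometric_prod (S : Finset ℂ) (K : ℝ) :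
    Summable fun p : S × ℕ => K * (1 / 2 : ℝ) ^ p.2 := by
  refine Summable.mul_left K ?_
  have := Summable.mul_of_nonneg (f := fun _ : S => (1 : ℝ)) (g := fun n : ℕ => (1 / 2 : ℝ) ^ n)
    (Summable.of_finite) summable_geometric_two (fun _ => zero_le_one) fun n => by positivity
  simpa using this

/-- Summation along the progressions `α + ℕ`, `α ∈ S`. -/
theorem hasSum_exponent_iff {S : Finset ℂ}
    (hS : ∀ α ∈ S, ∀ α' ∈ S, α ≠ α' → ∀ m : ℤ, α - α' ≠ m) {g : ℂ → ℂ}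
    (hg : ∀ β, g β ≠ 0 → ∃ α ∈ S, ∃ n : ℕ, β = α + n) {x : ℂ} :
    HasSum (fun p : S × ℕ => g (p.1 + p.2)) x ↔ HasSum g x := by
  refine (injective_exponent hS).hasSum_iff fun β hβ => ?_
  by_contra h
  obtain ⟨α, hα, n, rfl⟩ := hg β h
  exact hβ ⟨(⟨α, hα⟩, n), rfl⟩

theorem integral_exp_neg_mul_Ioi' {b : ℝ} (hb : 0 < b) (c : ℝ) :
    ∫ t in Set.Ioi c, Real.exp (-b * t) = Real.exp (-b * c) / b := by
  rw [integral_exp_mul_Ioi (by linarith) c, neg_div_neg_eq]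

/-- Integrals over the tails of a ray along which `e^{xz}` decays tend to zero. -/
theorem tendsto_rayIntegral_atTop {f : ℂ → ℂ} (ρ : ℂ) {u : ℂ} {φ κ : ℝ} (hκ : 0 < κ)
    (hcos : Real.cos (u.im + φ) < 0)
    (hf : ∀ η > 0, ∃ c : ℝ, ∀ t ≥ κ, ‖f (Real.log t + φ * Complex.I)‖ ≤ c * Real.exp (η * t)) :
    Tendsto (fun R => ∫ t in Set.Ioi R, rayIntegrand f ρ u φ t) atTop (𝓝 0) := by
  set b := Real.exp u.re * (-Real.cos (u.im + φ)) with hb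
  have hb0 : 0 < b := mul_pos (Real.exp_pos _) (by linarith)
  obtain ⟨c, hc⟩ := hf (b / 2) (half_pos hb0)
  set K := c * ‖Complex.exp (Complex.exp u * ρ)‖
  have hlim : Tendsto (fun R => K * (Real.exp (-(b / 2) * R) / (b / 2))) atTop (𝓝 0) := by
    have h1 : Tendsto (fun R : ℝ => -(b / 2) * R) atTop atBot :=
      tendsto_id.const_mul_atTop_of_neg (by linarith)
    have h := ((Real.tendsto_exp_atBot.comp h1).div_const (b / 2)).const_mul K
    simpa using h
  refine squeeze_zero_norm' ?_ hlim
  filter_upwards [eventually_ge_atTop κ] with R hR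
  rw [← integral_exp_neg_mul_Ioi' (half_pos hb0), ← MeasureTheory.integral_const_mul]
  refine MeasureTheory.norm_integral_le_of_norm_le (integrableOn_exp_neg_mul R (half_pos hb0) K)
    ((MeasureTheory.ae_restrict_mem measurableSet_Ioi).mono fun t ht => ?_)
  have ht' : R < t := ht
  have h := norm_rayIntegrand_le (f := f) ρ (u := u) (hκ.trans_le (hR.trans ht'.le)).le
    (le_of_eq (neg_neg _).symm) (hc t (hR.trans ht'.le))
  rw [← hb] at h
  convert h using 3
  ring

/-- Term by term integration over a ray along which `e^{xz}` decays. -/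
theorem hasSum_rayIntegral {ι : Type*} [Countable ι] {F : ι → ℂ → ℂ} {f : ℂ → ℂ} {q : ι → ℝ}
    (hq : Summable q) {u : ℂ} {φ κ : ℝ} (hκ : 0 < κ) (hcos : Real.cos (u.im + φ) < 0)
    (hmeas : ∀ i, MeasureTheory.AEStronglyMeasurable (rayIntegrand (F i) 0 u φ)
      (MeasureTheory.volume.restrict (Set.Ioi κ)))
    (hsum : ∀ t ≥ κ, HasSum (fun i => F i (Real.log t + φ * Complex.I))
      (f (Real.log t + φ * Complex.I)))
    (hF : ∀ η > 0, ∃ c : ℝ, ∀ i, ∀ t ≥ κ,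
      ‖F i (Real.log t + φ * Complex.I)‖ ≤ c * q i * Real.exp (η * t)) :
    HasSum (fun i => ∫ t in Set.Ioi κ, rayIntegrand (F i) 0 u φ t)
      (∫ t in Set.Ioi κ, rayIntegrand f 0 u φ t) := by
  set b := Real.exp u.re * (-Real.cos (u.im + φ)) with hb
  have hb0 : 0 < b := mul_pos (Real.exp_pos _) (by linarith)
  obtain ⟨c, hc⟩ := hF (b / 2) (half_pos hb0)
  set E := ‖Complex.exp (Complex.exp u * 0)‖ with hE
  refine MeasureTheory.hasSum_integral_of_dominated_convergence
    (fun i t => q i * (c * E * Real.exp (-(b / 2) * t))) hmeas (fun i => ?_)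
    (Eventually.of_forall fun t => hq.mul_right _) ?_ ?_
  · refine (MeasureTheory.ae_restrict_mem measurableSet_Ioi).mono fun t ht => ?_
    have ht' : κ < t := ht
    have h := norm_rayIntegrand_le (f := F i) 0 (u := u) (hκ.trans ht').le
      (le_of_eq (neg_neg _).symm) (hc i t ht'.le)
    rw [← hb, ← hE] at h
    refine h.trans (le_of_eq ?_)
    rw [show -(b - b / 2) = -(b / 2) by ring]
    ring
  · simp only [tsum_mul_right]
    exact (integrableOn_exp_neg_mul κ (half_pos hb0) (c * E)).const_mul _
  · refine (MeasureTheory.ae_restrict_mem measurableSet_Ioi).mono fun t ht => ?_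
    exact ((hsum t (le_of_lt ht)).mul_right _).mul_right _

theorem hasSum_arcIntegral {ι : Type*} [Countable ι] {F : ι → ℂ → ℂ} {f : ℂ → ℂ} {q : ι → ℝ}
    (hq : Summable q) {u : ℂ} {φ₁ φ₂ κ c : ℝ} (hκ : 0 < κ)
    (hmeas : ∀ i, IntervalIntegrable (arcIntegrand (F i) 0 u κ) MeasureTheory.volume φ₁ φ₂)
    (hsum : ∀ τ ∈ Set.uIcc φ₁ φ₂, HasSum (fun i => F i (Real.log κ + τ * Complex.I))
      (f (Real.log κ + τ * Complex.I)))
    (hF : ∀ i, ∀ τ ∈ Set.uIcc φ₁ φ₂, ‖F i (Real.log κ + τ * Complex.I)‖ ≤ c * q i) :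
    HasSum (fun i => arcIntegral (F i) 0 u κ φ₁ φ₂) (arcIntegral f 0 u κ φ₁ φ₂) := by
  simp only [arcIntegral_eq]
  set E := ‖Complex.exp (Complex.exp u * 0)‖ with hE
  refine intervalIntegral.hasSum_integral_of_dominated_convergence
    (fun i _ => q i * (c * (E * Real.exp (Real.exp u.re * κ)) * κ)) (fun i => ?_) (fun i => ?_)
    (Eventually.of_forall fun t _ => hq.mul_right _) ?_ ?_
  · exact (intervalIntegrable_iff.1 (hmeas i)).aestronglyMeasurable
  · refine Eventually.of_forall fun τ hτ => ?_
    have h1 := hF i τ (Set.uIoc_subset_uIcc hτ)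
    have h0 := (norm_nonneg _).trans h1
    rw [norm_arcIntegrand _ _ _ hκ.le, ← hE]
    have h2 : Real.exp u.re * Real.cos (u.im + τ) * κ ≤ Real.exp u.re * κ := by
      have := mul_le_mul_of_nonneg_left (Real.cos_le_one (u.im + τ)) (Real.exp_pos u.re).le
      rw [mul_one] at this
      gcongr
    calc _ ≤ c * q i * (E * Real.exp (Real.exp u.re * κ)) * κ := by gcongr
      _ = _ := by ring
  · exact intervalIntegrable_const
  · exact Eventually.of_forall fun τ hτ =>
      ((hsum τ (Set.uIoc_subset_uIcc hτ)).mul_right _).mul_right _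

theorem IsNilsson.exists_summable_infTerm {a : ℂ → Polynomial ℂ} (h : IsNilsson a) :
    ∃ R₀ > (0 : ℝ), ∀ w : ℂ, R₀ < Real.exp w.re → Summable (infTerm a w) := by
  obtain ⟨S, J, hS, hsupp, hJ⟩ := h.1.exists_normalized
  obtain ⟨A, B, hA, hb⟩ := h.exists_term_bound S hJ
  refine ⟨2 * A, by positivity, fun w hw => ?_⟩
  obtain ⟨M, hM, hb⟩ := hb |w.im|
  have hs : Summable fun p : S × ℕ => infTerm a w (p.1 + p.2) := by
    refine Summable.of_norm_bounded (summable_geometric_prod S _) fun p =>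
      norm_infTerm_le_geometric hM.le hA (Real.exp_pos (B * |w.re|)).le hw.le ?_
    rw [Real.log_exp]
    exact (hb p.1 p.1.2 w le_rfl p.2).2
  exact ((hasSum_exponent_iff hS fun β hβ => hsupp β fun h0 =>
    hβ (infTerm_eq_zero h0 w)).1 hs.hasSum).summable

theorem infTerm_eq_exp_mul_eval (a : ℂ → Polynomial ℂ) (β : ℂ) :
    (fun w => infTerm a w β) =
      fun w => Complex.exp ((-β - 1) * w) * ((a β).comp (-Polynomial.X)).eval w := by
  funext w
  rw [infTerm, Polynomial.eval_comp, neg_add']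
  simp

/-- The Hankel integral of a formal function at infinity in the Nilsson class, over a contour which
stays in its domain of convergence, is computed term by term. -/
theorem IsNilsson.hasSum_hankelIntegral {a : ℂ → Polynomial ℂ} (h : IsNilsson a) (θ : ℝ) :
    ∃ R₁ > (0 : ℝ), ∀ u : ℂ, |u.im - θ| < Real.pi / 2 →
      (∀ R ≥ R₁, HasSum (finTerm (gammaOpZero (laplaceInf a)) u)
        (hankelIntegral (fun w => ∑' β, infTerm a w β) 0 u R (-θ - Real.pi) (-θ + Real.pi))) ∧
      ∀ φ ∈ Set.Icc (-θ - Real.pi) (-θ + Real.pi), Real.cos (u.im + φ) < 0 →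
        Tendsto (fun R => ∫ t in Set.Ioi R,
          rayIntegrand (fun w => ∑' β, infTerm a w β) 0 u φ t) atTop (𝓝 0) := by
  obtain ⟨S, J, hS, hsupp, hJ⟩ := h.1.exists_normalized
  obtain ⟨A, B, hA, hb⟩ := h.exists_term_bound S hJ
  obtain ⟨M, hM, hb⟩ := hb (|θ| + Real.pi)
  have hpi := Real.pi_pos
  set f : ℂ → ℂ := fun w => ∑' β, infTerm a w β with hf
  set F : S × ℕ → ℂ → ℂ := fun p w => infTerm a w (p.1 + p.2) with hF
  have hq : Summable fun p : S × ℕ => (1 / 2 : ℝ) ^ p.2 := by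
    simpa using summable_geometric_prod S 1
  have hbound : ∀ p t, 2 * A ≤ t → ∀ φ ∈ Set.Icc (-θ - Real.pi) (-θ + Real.pi),
      ‖F p (Real.log t + φ * Complex.I)‖ ≤ M * Real.exp (B * |Real.log t|) * (1 / 2) ^ p.2 := by
    intro p t ht φ hφ
    refine norm_infTerm_le_geometric hM.le hA (Real.exp_pos _).le ht ?_
    have him : |((Real.log t : ℂ) + φ * Complex.I).im| ≤ |θ| + Real.pi := by
      have h1 := neg_abs_le θ
      have h2 := le_abs_self θ
      simp only [Complex.add_im, Complex.ofReal_im, Complex.mul_im, Complex.ofReal_re,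
        Complex.I_im, Complex.I_re]
      rw [abs_le]
      constructor <;> linarith [hφ.1, hφ.2]
    have := (hb p.1 p.1.2 _ him p.2).2
    simpa using this
  have hsum : ∀ t, 2 * A ≤ t → ∀ φ ∈ Set.Icc (-θ - Real.pi) (-θ + Real.pi),
      HasSum (fun p => F p (Real.log t + φ * Complex.I)) (f (Real.log t + φ * Complex.I)) := by
    intro t ht φ hφ
    have h1 : Summable fun p => F p (Real.log t + φ * Complex.I) :=
      Summable.of_norm_bounded (hq.mul_left _) fun p => hbound p t ht φ hφ
    have h2 := (hasSum_exponent_iff hS fun β hβ => hsupp β fun h0 =>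
      hβ (infTerm_eq_zero h0 _)).1 h1.hasSum
    rw [hf]
    simp only
    rw [h2.tsum_eq]
    exact h1.hasSum
  have hgrowth : ∀ R ≥ 2 * A, ∀ η > 0, ∃ c : ℝ, 0 ≤ c ∧ ∀ p, ∀ t ≥ R,
      ∀ φ ∈ Set.Icc (-θ - Real.pi) (-θ + Real.pi),
      ‖F p (Real.log t + φ * Complex.I)‖ ≤ c * (1 / 2) ^ p.2 * Real.exp (η * t) := by
    intro R hR η hη
    obtain ⟨c, hc, hexp⟩ := exists_exp_abs_log_le (B := B) (Nat.cast_nonneg B)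
      (show 0 < R by linarith) hη
    refine ⟨M * c, by positivity, fun p t ht φ hφ => (hbound p t (hR.trans ht) φ hφ).trans ?_⟩
    calc _ ≤ M * (c * Real.exp (η * t)) * (1 / 2) ^ p.2 := by gcongr; exact hexp t ht
      _ = _ := by ring
  refine ⟨2 * A, by positivity, fun u hu => ⟨fun R hR => ?_, fun φ hφ hcos => ?_⟩⟩
  · have hR0 : 0 < R := by linarith
    set φ₁ := -θ - Real.pi with hφ₁
    set φ₂ := -θ + Real.pi with hφ₂
    have m1 : φ₁ ∈ Set.Icc φ₁ φ₂ := ⟨le_rfl, by linarith⟩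
    have m2 : φ₂ ∈ Set.Icc φ₁ φ₂ := ⟨by linarith, le_rfl⟩
    have h₁ : |u.im + φ₁ + Real.pi| < Real.pi / 2 := by
      rw [hφ₁]; convert hu using 2; ring
    have h₂ : |u.im + φ₂ - Real.pi| < Real.pi / 2 := by
      rw [hφ₂]; convert hu using 2; ring
    have hint : ∀ p, HankelIntegrable (F p) 0 u R φ₁ φ₂ := fun p => by
      rw [hF]
      simp only
      rw [infTerm_eq_exp_mul_eval]
      exact hankelIntegrable_exp_mul_eval _ _ 0 hR0 h₁ h₂
    have hval : ∀ p, hankelIntegral (F p) 0 u R φ₁ φ₂ =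
        finTerm (gammaOpZero (laplaceInf a)) u (p.1 + p.2) := fun p => by
      rw [hF]
      simp only
      rw [infTerm_eq_exp_mul_eval, hankelIntegral_exp_mul_eval _ _ 0 hR0 h₁ h₂, finTerm,
        gammaOpZero_laplaceInf, Polynomial.eval_comp, mul_zero, Complex.exp_zero, one_mul]
      simp
    refine (hasSum_exponent_iff hS fun β hβ => hsupp β fun h0 =>
      hβ (finTerm_eq_zero (gammaOpZero_laplaceInf_eq_zero h0) u)).1 ?_
    simp only [← hval]
    have hray : ∀ φ ∈ Set.Icc φ₁ φ₂, Real.cos (u.im + φ) < 0 →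
        (∀ p, MeasureTheory.IntegrableOn (rayIntegrand (F p) 0 u φ) (Set.Ioi R)) →
        HasSum (fun p => ∫ t in Set.Ioi R, rayIntegrand (F p) 0 u φ t)
          (∫ t in Set.Ioi R, rayIntegrand f 0 u φ t) := fun φ hφ hcos hi =>
      hasSum_rayIntegral hq hR0 hcos (fun p => (hi p).aestronglyMeasurable)
        (fun t ht => hsum t (hR.trans ht) φ hφ) fun η hη => by
          obtain ⟨c, -, hc⟩ := hgrowth R hR η hη
          exact ⟨c, fun p t ht => hc p t ht φ hφ⟩
    have hle : Set.uIcc φ₁ φ₂ = Set.Icc φ₁ φ₂ := Set.uIcc_of_le (by linarith)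
    have harc := hasSum_arcIntegral hq (f := f) hR0 (fun p => (hint p).arc)
      (fun τ hτ => hsum R hR τ (hle ▸ hτ)) fun p τ hτ => hbound p R hR τ (hle ▸ hτ)
    exact (((hray φ₁ m1 (cos_neg_of_abs_add_pi_lt h₁) fun p => (hint p).ray₁).neg.add harc).add
      (hray φ₂ m2 (cos_neg_of_abs_sub_pi_lt h₂) fun p => (hint p).ray₂)).mul_left _
  · refine tendsto_rayIntegral_atTop 0 (κ := 2 * A) (by positivity) hcos fun η hη => ?_
    obtain ⟨c, hc0, hc⟩ := hgrowth (2 * A) le_rfl η hη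
    refine ⟨c * ∑' p : S × ℕ, (1 / 2 : ℝ) ^ p.2, fun t ht => ?_⟩
    rw [← (hsum t ht φ hφ).tsum_eq]
    have hqs : HasSum (fun p : S × ℕ => c * (1 / 2 : ℝ) ^ p.2 * Real.exp (η * t))
        (c * (∑' p : S × ℕ, (1 / 2 : ℝ) ^ p.2) * Real.exp (η * t)) :=
      (hq.hasSum.mul_left c).mul_right _
    exact tsum_of_norm_bounded hqs fun p => hc p t ht φ hφ

theorem IsNilsson.tendsto_arcIntegral {a : ℂ → Polynomial ℂ} (h : IsNilsson a) {θ : ℝ} {u : ℂ}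
    (hu : |u.im - θ| < Real.pi / 2) :
    Summable (finTerm (gammaOpZero (laplaceInf a)) u) ∧
      Tendsto (fun R : ℝ => (2 * Complex.I * Real.pi)⁻¹ *
        arcIntegral (fun w => ∑' β, infTerm a w β) 0 u R (-θ - Real.pi) (-θ + Real.pi))
        atTop (𝓝 (∑' β, finTerm (gammaOpZero (laplaceInf a)) u β)) := by
  obtain ⟨R₁, hR₁, h⟩ := h.hasSum_hankelIntegral θ
  obtain ⟨hsum, htend⟩ := h u hu
  have hpi := Real.pi_pos
  refine ⟨(hsum R₁ le_rfl).summable, ?_⟩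
  have t1 := htend (-θ - Real.pi) ⟨le_rfl, by linarith⟩
    (cos_neg_of_abs_add_pi_lt (by convert hu using 2; ring))
  have t2 := htend (-θ + Real.pi) ⟨by linarith, le_rfl⟩
    (cos_neg_of_abs_sub_pi_lt (by convert hu using 2; ring))
  have hlim := (tendsto_const_nhds (x := ∑' β, finTerm (gammaOpZero (laplaceInf a)) u β)).add
    ((t1.sub t2).const_mul (2 * Complex.I * Real.pi : ℂ)⁻¹)
  rw [sub_zero, mul_zero, add_zero] at hlim
  refine hlim.congr' ?_
  filter_upwards [eventually_ge_atTop R₁] with R hR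
  rw [(hsum R hR).tsum_eq, hankelIntegral]
  ring

/-! ### Admissible contours around a finite point -/

/-- The arguments in the two banks of the cut. -/
def bankArgs (θ δ ε : ℝ) : Set ℝ :=
  Set.Ioo (-θ - Real.pi - δ) (-θ - Real.pi + ε) ∪ Set.Ioo (-θ + Real.pi - ε) (-θ + Real.pi + δ)

/-- The arguments in the disc of convergence. -/
def discArgs (θ δ : ℝ) : Set ℝ :=
  Set.Ioo (-θ - Real.pi - δ) (-θ + Real.pi + δ)

/-- The conditions on the rays of a Hankel contour for the variable `x = exp u`. -/
structure AdmissibleArgs (θ δ ε : ℝ) (u : ℂ) (φ₁ φ₂ : ℝ) : Prop where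
  lower₁ : -θ - Real.pi - δ < φ₁
  upper₁ : φ₁ < -θ - Real.pi + ε
  decay₁ : |u.im + φ₁ + Real.pi| < Real.pi / 2
  lower₂ : -θ + Real.pi - ε < φ₂
  upper₂ : φ₂ < -θ + Real.pi + δ
  decay₂ : |u.im + φ₂ - Real.pi| < Real.pi / 2

theorem isOpen_bankSectors (θ δ ε : ℝ) : IsOpen (bankSectors θ δ ε) :=
  ((isOpen_lt continuous_const Complex.continuous_im).inter
    (isOpen_lt Complex.continuous_im continuous_const)).union
  ((isOpen_lt continuous_const Complex.continuous_im).inter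
    (isOpen_lt Complex.continuous_im continuous_const))

theorem isOpen_punctDisc (θ δ r : ℝ) : IsOpen (punctDisc θ δ r) :=
  (isOpen_lt (Real.continuous_exp.comp Complex.continuous_re) continuous_const).inter
    ((isOpen_lt continuous_const Complex.continuous_im).inter
      (isOpen_lt Complex.continuous_im continuous_const))

theorem log_add_mul_I_re (t φ : ℝ) : ((Real.log t : ℂ) + φ * Complex.I).re = Real.log t := by simp

theorem log_add_mul_I_im (t φ : ℝ) : ((Real.log t : ℂ) + φ * Complex.I).im = φ := by simp

theorem mem_bankSectors_of_mem {θ δ ε t φ : ℝ} (h : φ ∈ bankArgs θ δ ε) :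
    (Real.log t : ℂ) + φ * Complex.I ∈ bankSectors θ δ ε := by
  rcases h with h | h
  · left; simpa using h
  · right; simpa using h

theorem mem_punctDisc_of_mem {θ δ r t φ : ℝ} (ht : 0 < t) (htr : t < r) (h : φ ∈ discArgs θ δ) :
    (Real.log t : ℂ) + φ * Complex.I ∈ punctDisc θ δ r := by
  refine ⟨?_, ?_⟩
  · rwa [log_add_mul_I_re, Real.exp_log ht]
  · rw [log_add_mul_I_im]; exact h

/-- Sub-exponential growth at infinity implies locally uniform bounds on whole rays. -/
theorem hankelDomain_of_growth {ρ : ℂ} {θ : ℝ} {f : ℂ → ℂ} {r δ ε : ℝ}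
    (hdiff : DifferentiableOn ℂ f (punctDisc θ δ r ∪ bankSectors θ δ ε))
    (hgrow : ∀ η > (0 : ℝ), ∃ c > (0 : ℝ), ∀ w ∈ bankSectors θ δ ε,
        ‖ρ‖ + 1 ≤ ‖ρ + Complex.exp w‖ → ‖f w‖ ≤ c * Real.exp (η * ‖ρ + Complex.exp w‖)) :
    HankelDomain f r (bankArgs θ δ ε) (discArgs θ δ) := by
  have hat : ∀ w ∈ punctDisc θ δ r ∪ bankSectors θ δ ε, DifferentiableAt ℂ f w := fun w hw =>
    hdiff.differentiableAt
      (((isOpen_punctDisc θ δ r).union (isOpen_bankSectors θ δ ε)).mem_nhds hw)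
  have hbank : ∀ t > 0, ∀ φ ∈ bankArgs θ δ ε,
      DifferentiableAt ℂ f (Real.log t + φ * Complex.I) := fun t _ φ hφ =>
    hat _ (Or.inr (mem_bankSectors_of_mem hφ))
  refine ⟨Set.ordConnected_Ioo, hbank, fun t ht htr φ hφ =>
    hat _ (Or.inl (mem_punctDisc_of_mem ht htr hφ)), fun p q κ η hpq hκ hη => ?_⟩
  obtain ⟨c, hc, hfar⟩ := hgrow η hη
  have hcont : ContinuousOn (fun z : ℝ × ℝ => f (Real.log z.1 + z.2 * Complex.I))
      (Set.Icc κ (2 * ‖ρ‖ + 1) ×ˢ Set.Icc p q) := by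
    rintro ⟨t, φ⟩ ⟨ht, hφ⟩
    refine ContinuousAt.continuousWithinAt ?_
    have ht0 : 0 < t := hκ.trans_le ht.1
    refine ContinuousAt.comp (f := fun z : ℝ × ℝ => (Real.log z.1 : ℂ) + z.2 * Complex.I)
      (hbank t ht0 φ (hpq hφ)).continuousAt ?_
    refine ContinuousAt.add ?_ (by fun_prop)
    exact Complex.continuous_ofReal.continuousAt.comp (continuousAt_fst.log ht0.ne')
  obtain ⟨C, hC⟩ := (isCompact_Icc.prod isCompact_Icc).exists_bound_of_continuousOn hcont
  refine ⟨c * Real.exp (η * ‖ρ‖) + |C|, by positivity, fun t ht φ hφ => ?_⟩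
  have ht0 : 0 < t := lt_of_lt_of_le hκ ht
  have hexp : 1 ≤ Real.exp (η * t) := Real.one_le_exp (by positivity)
  rcases le_or_gt t (2 * ‖ρ‖ + 1) with hle | hgt
  · have h1 := (hC (t, φ) ⟨⟨ht, hle⟩, hφ⟩).trans (le_abs_self C)
    have h2 : 0 ≤ c * Real.exp (η * ‖ρ‖) := by positivity
    have h3 := abs_nonneg C
    nlinarith
  · have hn : ‖Complex.exp (Real.log t + φ * Complex.I)‖ = t := by
      rw [Complex.norm_exp, log_add_mul_I_re, Real.exp_log ht0]
    have h1 : ‖ρ‖ + 1 ≤ ‖ρ + Complex.exp (Real.log t + φ * Complex.I)‖ := by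
      have := norm_sub_le_norm_add (Complex.exp (Real.log t + φ * Complex.I)) ρ
      rw [hn, add_comm] at this
      linarith
    have h2 : ‖ρ + Complex.exp (Real.log t + φ * Complex.I)‖ ≤ ‖ρ‖ + t :=
      (norm_add_le _ _).trans (by rw [hn])
    refine (hfar _ (mem_bankSectors_of_mem (hpq hφ)) h1).trans ?_
    calc _ ≤ c * Real.exp (η * (‖ρ‖ + t)) := by gcongr
      _ = c * Real.exp (η * ‖ρ‖) * Real.exp (η * t) := by rw [mul_add, Real.exp_add]; ring
      _ ≤ _ := by
        have := abs_nonneg C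
        gcongr
        linarith

/-- Choice of the rays of a Hankel contour, with a margin `c`. -/
theorem exists_args {θ δ ε c y : ℝ} (hδ : 0 ≤ δ) (hδε : δ ≤ ε) (hc : 2 * c ≤ ε)
    (hcpi : c ≤ Real.pi / 2) (h : |y - θ| ≤ Real.pi / 2 + δ - 2 * c) :
    ∃ φ₁ φ₂ : ℝ, φ₁ ∈ Set.Icc (-θ - Real.pi - δ + c) (-θ - Real.pi + ε - c) ∧
      |y + φ₁ + Real.pi| ≤ Real.pi / 2 - c ∧
      φ₂ ∈ Set.Icc (-θ + Real.pi - ε + c) (-θ + Real.pi + δ - c) ∧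
      |y + φ₂ - Real.pi| ≤ Real.pi / 2 - c := by
  rw [abs_le] at h
  have hclamp : ∀ l m : ℝ, l ≤ m → y - m ≤ Real.pi / 2 - c → l - y ≤ Real.pi / 2 - c →
      ∃ s ∈ Set.Icc l m, |y - s| ≤ Real.pi / 2 - c := by
    intro l m hlm h1 h2
    refine ⟨max l (min y m), ⟨le_max_left _ _, max_le hlm (min_le_right _ _)⟩, ?_⟩
    rw [abs_le]
    rcases le_total y m with hy | hy
    · rw [min_eq_left hy]
      rcases le_total l y with hl | hl
      · rw [max_eq_right hl]; constructor <;> linarith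
      · rw [max_eq_left hl]; constructor <;> linarith
    · rw [min_eq_right hy, max_eq_right hlm]; constructor <;> linarith
  obtain ⟨s₁, h₁, d₁⟩ := hclamp (θ - ε + c) (θ + δ - c) (by linarith) (by linarith) (by linarith)
  obtain ⟨s₂, h₂, d₂⟩ := hclamp (θ - δ + c) (θ + ε - c) (by linarith) (by linarith) (by linarith)
  refine ⟨-s₁ - Real.pi, -s₂ + Real.pi, ⟨by linarith [h₁.2], by linarith [h₁.1]⟩, ?_,
    ⟨by linarith [h₂.2], by linarith [h₂.1]⟩, ?_⟩
  · convert d₁ using 2; ring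
  · convert d₂ using 2; ring

theorem exists_admissibleArgs {θ δ ε : ℝ} (hδ : 0 ≤ δ) (hδε : δ ≤ ε) (hε : 0 < ε) {u : ℂ}
    (h : |u.im - θ| < Real.pi / 2 + δ) : ∃ φ₁ φ₂ : ℝ, AdmissibleArgs θ δ ε u φ₁ φ₂ := by
  have hpi := Real.pi_pos
  obtain ⟨c, hc0, hc⟩ : ∃ c > 0, c ≤ min (min (ε / 2) (Real.pi / 2))
      ((Real.pi / 2 + δ - |u.im - θ|) / 2) :=
    ⟨_, lt_min (lt_min (by linarith) (by linarith)) (by linarith), le_rfl⟩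
  rw [le_min_iff, le_min_iff] at hc
  obtain ⟨φ₁, φ₂, h₁, d₁, h₂, d₂⟩ := exists_args (θ := θ) (c := c) (y := u.im) hδ hδε
    (by linarith [hc.1.1]) hc.1.2 (by linarith [hc.2])
  exact ⟨φ₁, φ₂, by linarith [h₁.1], by linarith [h₁.2], by linarith, by linarith [h₂.1],
    by linarith [h₂.2], by linarith⟩

namespace AdmissibleArgs

variable {θ δ ε : ℝ} {u : ℂ} {φ₁ φ₂ : ℝ}

theorem mem_bank₁ (h : AdmissibleArgs θ δ ε u φ₁ φ₂) : φ₁ ∈ bankArgs θ δ ε :=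
  Or.inl ⟨h.lower₁, h.upper₁⟩

theorem mem_bank₂ (h : AdmissibleArgs θ δ ε u φ₁ φ₂) : φ₂ ∈ bankArgs θ δ ε :=
  Or.inr ⟨h.lower₂, h.upper₂⟩

theorem mem_disc₁ (h : AdmissibleArgs θ δ ε u φ₁ φ₂) (hu : |u.im - θ| < Real.pi / 2 + δ) :
    φ₁ ∈ discArgs θ δ := by
  have h1 := (abs_lt.1 h.decay₁).2
  have h2 := (abs_lt.1 hu).1
  exact ⟨h.lower₁, by linarith [Real.pi_pos]⟩

theorem mem_disc₂ (h : AdmissibleArgs θ δ ε u φ₁ φ₂) (hu : |u.im - θ| < Real.pi / 2 + δ) :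
    φ₂ ∈ discArgs θ δ := by
  have h1 := (abs_lt.1 h.decay₂).1
  have h2 := (abs_lt.1 hu).2
  exact ⟨by linarith [Real.pi_pos], h.upper₂⟩

theorem hankelIntegrable (h : AdmissibleArgs θ δ ε u φ₁ φ₂)
    (hu : |u.im - θ| < Real.pi / 2 + δ) {f : ℂ → ℂ} {r κ : ℝ}
    (hf : HankelDomain f r (bankArgs θ δ ε) (discArgs θ δ)) (ρ : ℂ) (hκ : 0 < κ) (hr : κ < r) :
    HankelIntegrable f ρ u κ φ₁ φ₂ :=
  hf.hankelIntegrable ρ hκ hr (h.mem_disc₁ hu) (h.mem_disc₂ hu) h.mem_bank₁ h.mem_bank₂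
    (cos_neg_of_abs_add_pi_lt h.decay₁) (cos_neg_of_abs_sub_pi_lt h.decay₂)

theorem hankelIntegral_eq (h : AdmissibleArgs θ δ ε u φ₁ φ₂) {φ₁' φ₂' : ℝ}
    (h' : AdmissibleArgs θ δ ε u φ₁' φ₂') (hu : |u.im - θ| < Real.pi / 2 + δ) {f : ℂ → ℂ}
    {r κ κ' : ℝ} (hf : HankelDomain f r (bankArgs θ δ ε) (discArgs θ δ)) (ρ : ℂ)
    (hκ : 0 < κ) (hr : κ < r) (hκ' : 0 < κ') (hr' : κ' < r) :
    hankelIntegral f ρ u κ φ₁ φ₂ = hankelIntegral f ρ u κ' φ₁' φ₂' := by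
  refine hf.hankelIntegral_eq ρ hκ hr hκ' hr' (h.mem_disc₁ hu) (h'.mem_disc₁ hu) (h.mem_disc₂ hu)
    (h'.mem_disc₂ hu) ?_ ?_ (fun φ hφ => cos_neg_of_abs_add_pi_lt ?_)
    fun φ hφ => cos_neg_of_abs_sub_pi_lt ?_
  · exact (Set.ordConnected_Ioo.uIcc_subset ⟨h.lower₁, h.upper₁⟩ ⟨h'.lower₁, h'.upper₁⟩).trans
      Set.subset_union_left
  · exact (Set.ordConnected_Ioo.uIcc_subset ⟨h.lower₂, h.upper₂⟩ ⟨h'.lower₂, h'.upper₂⟩).trans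
      Set.subset_union_right
  · have h1 := abs_lt.1 h.decay₁
    have h2 := abs_lt.1 h'.decay₁
    rw [abs_lt]
    rcases Set.mem_uIcc.1 hφ with h | h <;> constructor <;> linarith [h.1, h.2]
  · have h1 := abs_lt.1 h.decay₂
    have h2 := abs_lt.1 h'.decay₂
    rw [abs_lt]
    rcases Set.mem_uIcc.1 hφ with h | h <;> constructor <;> linarith [h.1, h.2]

theorem eventually (h : AdmissibleArgs θ δ ε u φ₁ φ₂) :
    ∀ᶠ v in 𝓝 u, AdmissibleArgs θ δ ε v φ₁ φ₂ := by
  have h1 : ∀ᶠ v : ℂ in 𝓝 u, |v.im + φ₁ + Real.pi| < Real.pi / 2 :=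
    (isOpen_lt (by fun_prop) continuous_const).mem_nhds h.decay₁
  have h2 : ∀ᶠ v : ℂ in 𝓝 u, |v.im + φ₂ - Real.pi| < Real.pi / 2 :=
    (isOpen_lt (by fun_prop) continuous_const).mem_nhds h.decay₂
  filter_upwards [h1, h2] with v d₁ d₂
  exact ⟨h.lower₁, h.upper₁, d₁, h.lower₂, h.upper₂, d₂⟩

end AdmissibleArgs

/-! ### Holomorphy of the Hankel integral -/

namespace HankelDomain

variable {f : ℂ → ℂ} {r : ℝ} {P Q : Set ℝ}

theorem differentiableAt_rayIntegral (hf : HankelDomain f r P Q) (ρ : ℂ) {u₀ : ℂ} {κ φ : ℝ}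
    (hκ : 0 < κ) (hφ : φ ∈ P) (hcos : Real.cos (u₀.im + φ) < 0) :
    DifferentiableAt ℂ (fun u => ∫ t in Set.Ioi κ, rayIntegrand f ρ u φ t) u₀ := by
  set b := Real.exp u₀.re * (-Real.cos (u₀.im + φ)) with hb
  have hb0 : 0 < b := mul_pos (Real.exp_pos _) (by linarith)
  set E := ‖Complex.exp (Complex.exp u₀ * ρ)‖ + 1 with hE
  have hev : ∀ᶠ u in 𝓝 u₀, Real.exp u.re * Real.cos (u.im + φ) < -(b / 2) ∧
      ‖Complex.exp (Complex.exp u * ρ)‖ < E := by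
    refine Filter.Eventually.and ?_ ?_
    · refine (isOpen_lt (f := fun u : ℂ => Real.exp u.re * Real.cos (u.im + φ)) (by fun_prop)
        continuous_const).mem_nhds ?_
      show Real.exp u₀.re * Real.cos (u₀.im + φ) < -(b / 2)
      linarith
    · refine (isOpen_lt (f := fun u : ℂ => ‖Complex.exp (Complex.exp u * ρ)‖) (by fun_prop)
        continuous_const).mem_nhds ?_
      show ‖Complex.exp (Complex.exp u₀ * ρ)‖ < E
      linarith
  obtain ⟨s, hs, hball⟩ := Metric.eventually_nhds_iff_ball.1 hev
  obtain ⟨c, hc, hbound⟩ := hf.growth φ φ κ (b / 4) (by simpa using hφ) hκ (by positivity)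
  refine (hasDerivAt_integral_of_holomorphic hs (bound := fun t => c * E * Real.exp (-(b / 4) * t))
    (fun u _ => ((hf.continuousOn_ray ρ u hκ hφ).mono
      Set.Ioi_subset_Ici_self).aestronglyMeasurable measurableSet_Ioi)
    (Eventually.of_forall fun t => ?_)
    ((MeasureTheory.ae_restrict_mem measurableSet_Ioi).mono fun t ht u hu => ?_)
    (integrableOn_exp_neg_mul κ (by positivity) _)).differentiableAt
  · refine Differentiable.differentiableOn ?_
    unfold rayIntegrand
    fun_prop
  · have ht' : κ < t := ht
    have ht0 : 0 ≤ t := (hκ.trans ht').le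
    obtain ⟨h1, h2⟩ := hball u hu
    rw [norm_rayIntegrand]
    calc _ ≤ c * Real.exp (b / 4 * t) * (E * Real.exp (-(b / 2) * t)) := by
          gcongr
          exact hbound t ht'.le φ (by simp)
      _ = c * E * (Real.exp (b / 4 * t) * Real.exp (-(b / 2) * t)) := by ring
      _ = _ := by rw [← Real.exp_add]; congr 2; ring

theorem differentiableAt_hankelIntegral (hf : HankelDomain f r P Q) (ρ : ℂ) {u₀ : ℂ}
    {κ φ₁ φ₂ : ℝ} (hκ : 0 < κ) (hr : κ < r) (hQ₁ : φ₁ ∈ Q) (hQ₂ : φ₂ ∈ Q) (hP₁ : φ₁ ∈ P)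
    (hP₂ : φ₂ ∈ P) (hcos₁ : Real.cos (u₀.im + φ₁) < 0) (hcos₂ : Real.cos (u₀.im + φ₂) < 0) :
    DifferentiableAt ℂ (fun u => hankelIntegral f ρ u κ φ₁ φ₂) u₀ := by
  have harc : DifferentiableAt ℂ (fun u => arcIntegral f ρ u κ φ₁ φ₂) u₀ := by
    refine (hasDerivAt_intervalIntegral_of_holomorphic (G := fun u => arcIntegrand f ρ u κ)
      ?_ (fun t _ => ?_) u₀).differentiableAt
    · have hc : ContinuousOn (fun τ : ℝ => f (Real.log κ + τ * Complex.I)) (Set.uIcc φ₁ φ₂) :=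
        continuousOn_comp_arc fun τ hτ =>
          hf.diff_disc κ hκ hr τ (hf.ordConnected.uIcc_subset hQ₁ hQ₂ hτ)
      have hc' : ContinuousOn (fun z : ℂ × ℝ => f (Real.log κ + z.2 * Complex.I))
          (Set.univ ×ˢ Set.uIcc φ₁ φ₂) :=
        hc.comp continuousOn_snd fun z hz => hz.2
      simp only [Function.uncurry_def, arcIntegrand]
      exact (hc'.mul (by fun_prop)).mul (by fun_prop)
    · unfold arcIntegrand
      fun_prop
  exact (((hf.differentiableAt_rayIntegral ρ hκ hP₁ hcos₁).neg.add harc).add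
    (hf.differentiableAt_rayIntegral ρ hκ hP₂ hcos₂)).const_mul _

end HankelDomain

/-! ### Remainders of the expansion at a finite point -/

/-- The first `N` terms of each progression of exponents. -/
noncomputable def truncation (a : ℂ → Polynomial ℂ) (S : Finset ℂ) (N : ℕ) (w : ℂ) : ℂ :=
  ∑ α ∈ S, ∑ n ∈ Finset.range N, finTerm a w (α + n)

theorem norm_sub_truncation_le {a : ℂ → Polynomial ℂ} {S : Finset ℂ}
    (hS : ∀ α ∈ S, ∀ α' ∈ S, α ≠ α' → ∀ m : ℤ, α - α' ≠ m)
    (hsupp : ∀ β, a β ≠ 0 → ∃ α ∈ S, ∃ n : ℕ, β = α + n) {w x : ℂ}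
    (hx : HasSum (finTerm a w) x) {L y : ℝ} (hL : 0 ≤ L) (hy : 0 ≤ y) (hy' : 2 * y ≤ 1)
    (hb : ∀ α ∈ S, ∀ n : ℕ, ‖finTerm a w (α + n)‖ ≤ L * y ^ n) (N : ℕ) :
    ‖x - truncation a S N w‖ ≤ (∑' p : S × ℕ, (1 / 2 : ℝ) ^ p.2) * L * (2 * y) ^ N := by
  classical
  have hq : Summable fun p : S × ℕ => (1 / 2 : ℝ) ^ p.2 := by
    simpa using summable_geometric_prod S 1
  set g : S × ℕ → ℂ := fun p => finTerm a w (p.1 + p.2) with hg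
  have h1 : HasSum g x := (hasSum_exponent_iff hS fun β hβ => hsupp β fun h0 =>
    hβ (finTerm_eq_zero h0 w)).2 hx
  have h2 : HasSum (fun p : S × ℕ => if p.2 < N then g p else 0) (truncation a S N w) := by
    have h : HasSum (fun p : S × ℕ => if p.2 < N then g p else 0)
        (∑ p ∈ S.attach ×ˢ Finset.range N, if p.2 < N then g p else 0) :=
      hasSum_sum_of_ne_finset_zero fun p hp => if_neg (by simpa using hp)
    have hs : ∑ p ∈ S.attach ×ˢ Finset.range N, (if p.2 < N then g p else 0) =
        truncation a S N w := by
      rw [Finset.sum_product, truncation, ← Finset.sum_attach S]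
      refine Finset.sum_congr rfl fun α _ => Finset.sum_congr rfl fun n hn => ?_
      rw [if_pos (Finset.mem_range.1 hn)]
    rwa [hs] at h
  have h3 := h1.sub h2
  rw [← h3.tsum_eq]
  refine tsum_of_norm_bounded ((hq.hasSum.mul_right L).mul_right ((2 * y) ^ N)) fun p => ?_
  split_ifs with hp
  · rw [sub_self, norm_zero]
    positivity
  · rw [sub_zero]
    push Not at hp
    refine (hb p.1 p.1.2 p.2).trans ?_
    have h4 : y ^ p.2 = (1 / 2) ^ p.2 * (2 * y) ^ p.2 := by
      rw [← mul_pow]; congr 1; ring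
    have h5 : (2 * y) ^ p.2 ≤ (2 * y) ^ N := pow_le_pow_of_le_one (by positivity) hy' hp
    rw [h4]
    calc _ ≤ L * ((1 / 2) ^ p.2 * (2 * y) ^ N) := by gcongr
      _ = _ := by ring

theorem norm_truncation_le {a : ℂ → Polynomial ℂ} {S : Finset ℂ} {w : ℂ} {L y z : ℝ}
    (hL : 0 ≤ L) (hy : 0 ≤ y) (hyz : y ≤ z) (hz : 1 ≤ z)
    (hb : ∀ α ∈ S, ∀ n : ℕ, ‖finTerm a w (α + n)‖ ≤ L * y ^ n) (N : ℕ) :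
    ‖truncation a S N w‖ ≤ S.card * L * (2 * z) ^ N := by
  have h : ∀ α ∈ S, ‖∑ n ∈ Finset.range N, finTerm a w (α + n)‖ ≤ L * (2 * z) ^ N := by
    intro α hα
    have h1 : ∀ n ∈ Finset.range N, ‖finTerm a w (α + n)‖ ≤ L * z ^ N := fun n hn => by
      refine (hb α hα n).trans ?_
      have h2 : y ^ n ≤ z ^ n := pow_le_pow_left₀ hy hyz n
      have h3 : z ^ n ≤ z ^ N := pow_le_pow_right₀ hz (Finset.mem_range.1 hn).le
      have := h2.trans h3
      gcongr
    refine (norm_sum_le_of_le _ h1).trans ?_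
    rw [Finset.sum_const, Finset.card_range, nsmul_eq_mul, mul_pow]
    have h4 : (N : ℝ) ≤ 2 ^ N := by exact_mod_cast N.lt_two_pow_self.le
    calc (N : ℝ) * (L * z ^ N) ≤ 2 ^ N * (L * z ^ N) := by gcongr
      _ = _ := by ring
  refine (norm_sum_le_of_le _ h).trans ?_
  rw [Finset.sum_const, nsmul_eq_mul]
  exact le_of_eq (by ring)

/-- A bound for the remainders which is uniform on Hankel contours: near the origin it comes from
the convergent expansion, and far from the origin from the growth of `f` and of each term. -/
theorem exists_remainder_bound {a : ℂ → Polynomial ℂ} (ha : IsNilsson a) {S : Finset ℂ} {J : ℕ}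
    (hS : ∀ α ∈ S, ∀ α' ∈ S, α ≠ α' → ∀ m : ℤ, α - α' ≠ m)
    (hsupp : ∀ β, a β ≠ 0 → ∃ α ∈ S, ∃ n : ℕ, β = α + n) (hJ : ∀ β, (a β).natDegree < J)
    {θ δ ε r : ℝ} (hr : 0 < r) {f : ℂ → ℂ}
    (hsum : ∀ w ∈ punctDisc θ δ r, HasSum (finTerm a w) (f w))
    (hf : HankelDomain f r (bankArgs θ δ ε) (discArgs θ δ)) {p₁ q₁ p₂ q₂ : ℝ}
    (h₁ : Set.Icc p₁ q₁ ⊆ bankArgs θ δ ε) (h₂ : Set.Icc p₂ q₂ ⊆ bankArgs θ δ ε) :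
    ∃ K > (0 : ℝ), ∃ D > (0 : ℝ), ∃ B : ℕ, ∃ t₀ > (0 : ℝ), t₀ < r ∧ ∀ (N : ℕ) (t φ : ℝ), 0 < t →
      φ ∈ discArgs θ δ → (t ≤ t₀ ∨ φ ∈ Set.Icc p₁ q₁ ∪ Set.Icc p₂ q₂) →
      ‖f (Real.log t + φ * Complex.I) - truncation a S N (Real.log t + φ * Complex.I)‖ ≤
        K * (D * t) ^ N * (t ^ B)⁻¹ * Real.exp (2 * t) := by
  obtain ⟨A, B, hA, hb⟩ := ha.exists_term_bound S hJ
  obtain ⟨M, hM, hb⟩ := hb (|θ| + Real.pi + δ)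
  set t₀ := min (min (r / 2) 1) (1 / (2 * A)) with ht₀
  have ht₀0 : 0 < t₀ := by positivity
  have ht₀r : t₀ < r := (min_le_left _ _).trans_lt ((min_le_left _ _).trans_lt (by linarith))
  have ht₀1 : t₀ ≤ 1 := (min_le_left _ _).trans (min_le_right _ _)
  have ht₀A : 2 * (A * t₀) ≤ 1 := by
    have := min_le_right (min (r / 2) 1) (1 / (2 * A))
    rw [← ht₀, le_div_iff₀ (by positivity)] at this
    linarith
  obtain ⟨c₁, hc₁, g₁⟩ := hf.growth p₁ q₁ t₀ 1 h₁ ht₀0 one_pos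
  obtain ⟨c₂, hc₂, g₂⟩ := hf.growth p₂ q₂ t₀ 1 h₂ ht₀0 one_pos
  obtain ⟨c₃, hc₃, g₃⟩ := exists_exp_abs_log_le (B := B) (Nat.cast_nonneg B) ht₀0 one_pos
  set A' := max A (1 / t₀) with hA'
  have hA'0 : 0 < A' := hA.trans_le (le_max_left _ _)
  set s := ∑' p : S × ℕ, (1 / 2 : ℝ) ^ p.2 with hs
  have hs0 : 0 ≤ s := tsum_nonneg fun p => by positivity
  refine ⟨s * M + (c₁ + c₂) * c₃ + S.card * M * c₃ * c₃, by positivity, 2 * A', by positivity, B,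
    t₀, ht₀0, ht₀r, fun N t φ ht hφ hor => ?_⟩
  set w : ℂ := Real.log t + φ * Complex.I with hw
  have hterm : ∀ α ∈ S, ∀ n : ℕ, ‖finTerm a w (α + n)‖ ≤
      (M * Real.exp (B * |Real.log t|)) * (A * t) ^ n := fun α hα n => by
    have him : |w.im| ≤ |θ| + Real.pi + δ := by
      have h1 := neg_abs_le θ
      have h2 := le_abs_self θ
      rw [hw, log_add_mul_I_im, abs_le]
      constructor <;> linarith [hφ.1, hφ.2]
    refine (hb α hα w him n).1.trans (le_of_eq ?_)
    rw [hw, log_add_mul_I_re, mul_comm (n : ℝ), Real.exp_mul, Real.exp_log ht, Real.rpow_natCast,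
      mul_pow]
    ring
  have hAt : 0 ≤ A * t := by positivity
  have htB : 0 < t ^ B := by positivity
  have hexp2 : 1 ≤ Real.exp (2 * t) := Real.one_le_exp (by positivity)
  have hAA' : A * t ≤ A' * t := by gcongr; exact le_max_left _ _
  have k₁ : 0 ≤ s * M := by positivity
  have k₂ : 0 ≤ (c₁ + c₂) * c₃ := by positivity
  have k₃ : 0 ≤ S.card * M * c₃ * c₃ := by positivity
  rcases le_or_gt t t₀ with hle | hgt
  · have hy : 2 * (A * t) ≤ 1 := by nlinarith
    have h := norm_sub_truncation_le hS hsupp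
      (hsum w (mem_punctDisc_of_mem ht (hle.trans_lt ht₀r) hφ)) (by positivity) hAt hy hterm N
    have hlog : Real.exp (B * |Real.log t|) = (t ^ B)⁻¹ := by
      rw [abs_of_nonpos (Real.log_nonpos ht.le (hle.trans ht₀1)), mul_neg, Real.exp_neg,
        Real.exp_nat_mul, Real.exp_log ht]
    rw [hlog] at h
    calc _ ≤ s * (M * (t ^ B)⁻¹) * (2 * (A * t)) ^ N := h
      _ ≤ s * (M * (t ^ B)⁻¹) * (2 * (A' * t)) ^ N := by gcongr
      _ = s * M * (2 * A' * t) ^ N * (t ^ B)⁻¹ * 1 := by rw [← mul_assoc 2]; ring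
      _ ≤ _ := by gcongr; linarith
  · have hz : 1 ≤ A' * t := by
      have h1 : 1 / t₀ * t ≤ A' * t := by gcongr; exact le_max_right _ _
      have h2 : 1 ≤ 1 / t₀ * t := by
        rw [div_mul_eq_mul_div, one_mul, one_le_div ht₀0]; exact hgt.le
      linarith
    have hD : 1 ≤ (2 * A' * t) ^ N := one_le_pow₀ (by nlinarith)
    have hfw : ‖f w‖ ≤ (c₁ + c₂) * Real.exp t := by
      rcases hor with h | h | h
      · exact absurd h (not_le.2 hgt)
      · have := g₁ t hgt.le φ h
        rw [one_mul] at this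
        nlinarith [Real.exp_pos t]
      · have := g₂ t hgt.le φ h
        rw [one_mul] at this
        nlinarith [Real.exp_pos t]
    have hg₃ := g₃ t hgt.le
    rw [one_mul] at hg₃
    -- `t ^ B ≤ e^{B |log t|}` trades the exponential growth against the factor `t ^ (-B)`
    have hone : 1 ≤ c₃ * Real.exp t * (t ^ B)⁻¹ := by
      rw [← div_eq_mul_inv, one_le_div htB]
      refine le_trans ?_ hg₃
      conv_lhs => rw [← Real.exp_log ht, ← Real.exp_nat_mul]
      rw [Real.exp_le_exp]
      gcongr
      exact le_abs_self _
    have htr := norm_truncation_le (by positivity) hAt hAA' hz hterm N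
    have hexp : Real.exp t * Real.exp t = Real.exp (2 * t) := by rw [← Real.exp_add]; ring_nf
    have hf1 : ‖f w‖ ≤ (c₁ + c₂) * c₃ * (2 * A' * t) ^ N * (t ^ B)⁻¹ * Real.exp (2 * t) := by
      calc ‖f w‖ ≤ (c₁ + c₂) * Real.exp t * 1 * 1 := by simpa using hfw
        _ ≤ (c₁ + c₂) * Real.exp t * (2 * A' * t) ^ N * (c₃ * Real.exp t * (t ^ B)⁻¹) := by gcongr
        _ = _ := by rw [← hexp]; ring
    have hf2 : ‖truncation a S N w‖ ≤
        S.card * M * c₃ * c₃ * (2 * A' * t) ^ N * (t ^ B)⁻¹ * Real.exp (2 * t) := by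
      calc _ ≤ S.card * (M * Real.exp (B * |Real.log t|)) * (2 * (A' * t)) ^ N * 1 := by
            simpa using htr
        _ ≤ S.card * (M * (c₃ * Real.exp t)) * (2 * (A' * t)) ^ N *
            (c₃ * Real.exp t * (t ^ B)⁻¹) := by gcongr
        _ = _ := by rw [← hexp, ← mul_assoc 2]; ring
    have hpos : 0 ≤ (2 * A' * t) ^ N * (t ^ B)⁻¹ * Real.exp (2 * t) := by positivity
    refine (norm_sub_le _ _).trans ((add_le_add hf1 hf2).trans ?_)
    nlinarith [mul_nonneg k₁ hpos]

/-! ### Estimates of Hankel integrals -/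

theorem integral_pow_mul_exp_neg (N : ℕ) {b : ℝ} (hb : 0 < b) :
    MeasureTheory.IntegrableOn (fun t : ℝ => t ^ N * Real.exp (-b * t)) (Set.Ioi 0) ∧
      ∫ t in Set.Ioi 0, t ^ N * Real.exp (-b * t) = N.factorial / b ^ (N + 1) := by
  have h := Real.integral_rpow_mul_exp_neg_mul_Ioi (a := N + 1) (by positivity) hb
  rw [Real.Gamma_nat_eq_factorial] at h
  have hval : ∫ t in Set.Ioi 0, t ^ N * Real.exp (-b * t) = N.factorial / b ^ (N + 1) := by
    rw [show (N.factorial : ℝ) / b ^ (N + 1) = (1 / b) ^ ((N : ℝ) + 1) * N.factorial by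
      rw [← Nat.cast_add_one, Real.rpow_natCast, one_div, inv_pow]; ring, ← h]
    refine MeasureTheory.setIntegral_congr_fun measurableSet_Ioi fun t _ => ?_
    simp
  refine ⟨MeasureTheory.Integrable.of_integral_ne_zero ?_, hval⟩
  rw [hval]
  positivity

/-- Estimate of a Hankel integral over the contour whose circle has radius `1 / |x|`, for a function
of size `t ^ N` up to powers of `t` and an exponential. -/
theorem norm_hankelIntegral_le {g : ℂ → ℂ} (ρ : ℂ) {u : ℂ} {m K D W X φ₁ φ₂ : ℝ} {B N : ℕ}
    (hX : X = Real.exp u.re) (hm : 0 < m) (hK : 0 ≤ K) (hD : 0 < D) (hX1 : 1 ≤ X)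
    (hX4 : 4 ≤ m * X) (hcos₁ : Real.cos (u.im + φ₁) ≤ -m) (hcos₂ : Real.cos (u.im + φ₂) ≤ -m)
    (hray : ∀ t ≥ X⁻¹, ∀ φ, φ = φ₁ ∨ φ = φ₂ → ‖g (Real.log t + φ * Complex.I)‖ ≤
      K * (D * t) ^ N * (t ^ B)⁻¹ * Real.exp (2 * t))
    (harc : ∀ φ ∈ Set.uIcc φ₁ φ₂, ‖g (Real.log X⁻¹ + φ * Complex.I)‖ ≤
      K * (D * X⁻¹) ^ N * (X⁻¹ ^ B)⁻¹ * Real.exp (2 * X⁻¹))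
    (hW : |φ₂ - φ₁| ≤ W) :
    ‖hankelIntegral g ρ u X⁻¹ φ₁ φ₂‖ ≤ ‖Complex.exp (Complex.exp u * ρ)‖ *
      (K * (4 / m + Real.exp 3 * W) * (D * (1 + 2 / m)) ^ N * N.factorial * (X ^ B / X ^ N)) := by
  set E := ‖Complex.exp (Complex.exp u * ρ)‖ with hE
  have hX0 : 0 < X := by linarith
  have hE0 : 0 ≤ E := norm_nonneg _
  have hW0 : 0 ≤ W := (abs_nonneg _).trans hW
  have hb0 : 0 < m * X / 2 := by positivity
  obtain ⟨hint, hval⟩ := integral_pow_mul_exp_neg N hb0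
  have hone : 1 ≤ (1 + 2 / m) ^ N := one_le_pow₀ (by have : 0 < 2 / m := by positivity
                                                     linarith)
  have hfac : (1 : ℝ) ≤ N.factorial := by exact_mod_cast N.factorial_pos
  have hrays : ∀ φ, φ = φ₁ ∨ φ = φ₂ → Real.cos (u.im + φ) ≤ -m →
      ‖∫ t in Set.Ioi X⁻¹, rayIntegrand g ρ u φ t‖ ≤
        E * (K * (2 / m) * (D * (1 + 2 / m)) ^ N * N.factorial * (X ^ B / X ^ N)) := by
    intro φ hφ hcos
    have hpt : ∀ t ∈ Set.Ioi X⁻¹, ‖rayIntegrand g ρ u φ t‖ ≤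
        K * D ^ N * X ^ B * E * (t ^ N * Real.exp (-(m * X / 2) * t)) := by
      intro t ht
      have ht' : X⁻¹ < t := ht
      have ht0 : 0 < t := (by positivity : 0 < X⁻¹).trans ht'
      have h1 := hray t ht'.le φ hφ
      rw [norm_rayIntegrand, ← hE, ← hX]
      have h2 : (t ^ B)⁻¹ ≤ X ^ B := by
        rw [← inv_pow]
        exact pow_le_pow_left₀ (by positivity) (inv_le_of_inv_le₀ hX0 ht'.le) B
      have h3 : Real.exp (2 * t) * Real.exp (X * Real.cos (u.im + φ) * t) ≤
          Real.exp (-(m * X / 2) * t) := by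
        rw [← Real.exp_add, Real.exp_le_exp]
        have h4 : X * Real.cos (u.im + φ) ≤ X * -m := by gcongr
        nlinarith
      calc _ ≤ K * (D * t) ^ N * (t ^ B)⁻¹ * Real.exp (2 * t) *
            (E * Real.exp (X * Real.cos (u.im + φ) * t)) := by gcongr
        _ = K * (D * t) ^ N * (t ^ B)⁻¹ * E *
            (Real.exp (2 * t) * Real.exp (X * Real.cos (u.im + φ) * t)) := by ring
        _ ≤ K * (D * t) ^ N * X ^ B * E * Real.exp (-(m * X / 2) * t) := by gcongr
        _ = _ := by rw [mul_pow]; ring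
    have hsub : Set.Ioi X⁻¹ ⊆ Set.Ioi 0 := Set.Ioi_subset_Ioi (by positivity)
    refine (MeasureTheory.norm_integral_le_of_norm_le ((hint.mono_set hsub).const_mul _)
      ((MeasureTheory.ae_restrict_mem measurableSet_Ioi).mono hpt)).trans ?_
    rw [MeasureTheory.integral_const_mul]
    have h5 : ∫ t in Set.Ioi X⁻¹, t ^ N * Real.exp (-(m * X / 2) * t) ≤
        N.factorial / (m * X / 2) ^ (N + 1) := by
      rw [← hval]
      refine MeasureTheory.setIntegral_mono_set hint ?_ hsub.eventuallyLE
      refine (MeasureTheory.ae_restrict_mem measurableSet_Ioi).mono fun t ht => ?_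
      have ht0 : 0 < t := ht
      show 0 ≤ t ^ N * Real.exp (-(m * X / 2) * t)
      positivity
    have h6 : (N.factorial : ℝ) / (m * X / 2) ^ (N + 1) ≤
        2 / m * (1 + 2 / m) ^ N * N.factorial / X ^ N := by
      have h7 : (2 / m) ^ N ≤ (1 + 2 / m) ^ N :=
        pow_le_pow_left₀ (by positivity) (by linarith) N
      have h8 : X⁻¹ ≤ 1 := inv_le_one_of_one_le₀ hX1
      calc (N.factorial : ℝ) / (m * X / 2) ^ (N + 1) =
            2 / m * (2 / m) ^ N * N.factorial / X ^ N * X⁻¹ := by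
            rw [pow_succ, div_pow, div_pow, mul_pow]; field_simp
        _ ≤ 2 / m * (1 + 2 / m) ^ N * N.factorial / X ^ N * 1 := by gcongr
        _ = _ := mul_one _
    calc _ ≤ K * D ^ N * X ^ B * E * (2 / m * (1 + 2 / m) ^ N * N.factorial / X ^ N) := by
          gcongr
          exact h5.trans h6
      _ = _ := by rw [mul_pow]; ring
  have harc' : ‖arcIntegral g ρ u X⁻¹ φ₁ φ₂‖ ≤
      E * (K * (Real.exp 3 * W) * (D * (1 + 2 / m)) ^ N * N.factorial * (X ^ B / X ^ N)) := by
    have hXi : X⁻¹ ≤ 1 := inv_le_one_of_one_le₀ hX1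
    have hpt : ∀ τ ∈ Set.uIoc φ₁ φ₂, ‖arcIntegrand g ρ u X⁻¹ τ‖ ≤
        K * D ^ N * (X ^ B / X ^ N) * E * Real.exp 3 := by
      intro τ hτ
      have h1 := harc τ (Set.uIoc_subset_uIcc hτ)
      rw [norm_arcIntegrand _ _ _ (by positivity), ← hE, ← hX]
      have h2 : X * Real.cos (u.im + τ) * X⁻¹ ≤ 1 := by
        rw [mul_right_comm, mul_inv_cancel₀ hX0.ne', one_mul]
        exact Real.cos_le_one _
      have h3 : Real.exp (2 * X⁻¹) * Real.exp (X * Real.cos (u.im + τ) * X⁻¹) ≤ Real.exp 3 := by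
        rw [← Real.exp_add, Real.exp_le_exp]
        linarith
      calc _ ≤ K * (D * X⁻¹) ^ N * (X⁻¹ ^ B)⁻¹ * Real.exp (2 * X⁻¹) *
            (E * Real.exp (X * Real.cos (u.im + τ) * X⁻¹)) * 1 := by gcongr
        _ = K * (D * X⁻¹) ^ N * (X⁻¹ ^ B)⁻¹ * E *
            (Real.exp (2 * X⁻¹) * Real.exp (X * Real.cos (u.im + τ) * X⁻¹)) := by ring
        _ ≤ K * (D * X⁻¹) ^ N * (X⁻¹ ^ B)⁻¹ * E * Real.exp 3 := by gcongr
        _ = _ := by rw [inv_pow, inv_inv, mul_pow, inv_pow]; ring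
    rw [arcIntegral_eq]
    refine (intervalIntegral.norm_integral_le_of_norm_le_const hpt).trans ?_
    calc _ ≤ K * D ^ N * (X ^ B / X ^ N) * E * Real.exp 3 * W * 1 * 1 := by
          rw [mul_one, mul_one]; gcongr
      _ ≤ K * D ^ N * (X ^ B / X ^ N) * E * Real.exp 3 * W * (1 + 2 / m) ^ N * N.factorial := by
          gcongr
      _ = _ := by rw [mul_pow]; ring
  have hpi : ‖(2 * Complex.I * Real.pi : ℂ)⁻¹‖ ≤ 1 := by
    rw [norm_inv, norm_mul, norm_mul, Complex.norm_I, Complex.norm_real, Real.norm_eq_abs,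
      abs_of_pos Real.pi_pos]
    refine inv_le_one_of_one_le₀ ?_
    have := Real.pi_gt_three
    norm_num
    linarith
  rw [hankelIntegral, norm_mul]
  refine (mul_le_of_le_one_left (norm_nonneg _) hpi).trans ?_
  refine (norm_add_le _ _).trans ((add_le_add_left (norm_add_le _ _) _).trans ?_)
  rw [norm_neg]
  refine (add_le_add (add_le_add (hrays φ₁ (Or.inl rfl) hcos₁) harc')
    (hrays φ₂ (Or.inr rfl) hcos₂)).trans (le_of_eq ?_)
  ring

/-! ### The asymptotic expansion -/

theorem hankelIntegrable_finTerm (a : ℂ → Polynomial ℂ) (β ρ : ℂ) {u : ℂ} {κ φ₁ φ₂ : ℝ}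
    (hκ : 0 < κ) (h₁ : |u.im + φ₁ + Real.pi| < Real.pi / 2)
    (h₂ : |u.im + φ₂ - Real.pi| < Real.pi / 2) :
    HankelIntegrable (fun w => finTerm a w β) ρ u κ φ₁ φ₂ :=
  hankelIntegrable_exp_mul_eval β (a β) ρ hκ h₁ h₂

/-- Each term of the formal function contributes the corresponding term of its image. -/
theorem hankelIntegral_finTerm (a : ℂ → Polynomial ℂ) (β ρ : ℂ) {u : ℂ} {κ φ₁ φ₂ : ℝ}
    (hκ : 0 < κ) (h₁ : |u.im + φ₁ + Real.pi| < Real.pi / 2)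
    (h₂ : |u.im + φ₂ - Real.pi| < Real.pi / 2) :
    hankelIntegral (fun w => finTerm a w β) ρ u κ φ₁ φ₂ =
      Complex.exp (Complex.exp u * ρ) * infTerm (gammaOpInf (laplaceFin a)) u β := by
  rw [infTerm, gammaOpInf_laplaceFin]
  exact hankelIntegral_exp_mul_eval β (a β) ρ hκ h₁ h₂

theorem truncation_eq_sum (a : ℂ → Polynomial ℂ) (S : Finset ℂ) (N : ℕ) :
    truncation a S N = fun w => ∑ p ∈ S ×ˢ Finset.range N, 1 * finTerm a w (p.1 + p.2) := by
  funext w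
  simp only [one_mul]
  rw [Finset.sum_product, truncation]

theorem hankelIntegrable_truncation (a : ℂ → Polynomial ℂ) (S : Finset ℂ) (N : ℕ) (ρ : ℂ) {u : ℂ}
    {κ φ₁ φ₂ : ℝ} (hκ : 0 < κ) (h₁ : |u.im + φ₁ + Real.pi| < Real.pi / 2)
    (h₂ : |u.im + φ₂ - Real.pi| < Real.pi / 2) :
    HankelIntegrable (truncation a S N) ρ u κ φ₁ φ₂ := by
  rw [truncation_eq_sum]
  exact HankelIntegrable.sum _ fun p _ => hankelIntegrable_finTerm a _ ρ hκ h₁ h₂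

theorem hankelIntegral_truncation (a : ℂ → Polynomial ℂ) (S : Finset ℂ) (N : ℕ) (ρ : ℂ) {u : ℂ}
    {κ φ₁ φ₂ : ℝ} (hκ : 0 < κ) (h₁ : |u.im + φ₁ + Real.pi| < Real.pi / 2)
    (h₂ : |u.im + φ₂ - Real.pi| < Real.pi / 2) :
    hankelIntegral (truncation a S N) ρ u κ φ₁ φ₂ = Complex.exp (Complex.exp u * ρ) *
      ∑ α ∈ S, ∑ n ∈ Finset.range N, infTerm (gammaOpInf (laplaceFin a)) u (α + n) := by
  rw [truncation_eq_sum, hankelIntegral_sum _ fun p _ => hankelIntegrable_finTerm a _ ρ hκ h₁ h₂,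
    Finset.sum_product, Finset.mul_sum]
  refine Finset.sum_congr rfl fun α _ => ?_
  rw [Finset.mul_sum]
  refine Finset.sum_congr rfl fun n _ => ?_
  rw [one_mul, hankelIntegral_finTerm a _ ρ hκ h₁ h₂]

theorem cos_le_neg_sin_of_abs_le {y c : ℝ} (hc : 0 ≤ c) (h : |y| ≤ Real.pi / 2 - c) :
    Real.sin c ≤ Real.cos y := by
  rw [← Real.cos_abs, ← Real.cos_pi_div_two_sub]
  exact Real.cos_le_cos_of_nonneg_of_le_pi (abs_nonneg y) (by linarith [Real.pi_pos]) h

/-- The error after `N` terms, uniformly in a closed subsector. -/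
theorem exists_asymp_bound {a : ℂ → Polynomial ℂ} (ha : IsNilsson a) {S : Finset ℂ} {J : ℕ}
    (hS : ∀ α ∈ S, ∀ α' ∈ S, α ≠ α' → ∀ m : ℤ, α - α' ≠ m)
    (hsupp : ∀ β, a β ≠ 0 → ∃ α ∈ S, ∃ n : ℕ, β = α + n) (hJ : ∀ β, (a β).natDegree < J)
    (ρ : ℂ) {θ δ ε r ψ : ℝ} (hr : 0 < r) (hδ : 0 ≤ δ) (hδε : δ ≤ ε) (hε : 0 < ε) {f F : ℂ → ℂ}
    (hsum : ∀ w ∈ punctDisc θ δ r, HasSum (finTerm a w) (f w))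
    (hf : HankelDomain f r (bankArgs θ δ ε) (discArgs θ δ))
    (hF : ∀ u : ℂ, |u.im - θ| < Real.pi / 2 + δ → ∀ κ φ₁ φ₂ : ℝ, 0 < κ → κ < r →
      AdmissibleArgs θ δ ε u φ₁ φ₂ → hankelIntegral f ρ u κ φ₁ φ₂ = F u)
    (hψ : ψ < Real.pi / 2 + δ) :
    ∃ R > (0 : ℝ), ∃ B > (0 : ℝ), ∃ C > (0 : ℝ),
      ∀ u : ℂ, R ≤ Real.exp u.re → |u.im - θ| ≤ ψ → ∀ N : ℕ, 1 ≤ N →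
        ‖Complex.exp (-(ρ * Complex.exp u)) * F u -
            ∑ α ∈ S, ∑ n ∈ Finset.range N, infTerm (gammaOpInf (laplaceFin a)) u (α + n)‖ ≤
          C ^ N * (N.factorial : ℝ) * Real.exp u.re ^ (B - N) := by
  have hpi := Real.pi_pos
  -- the margin by which the rays stay inside the banks and inside the half-plane of decay
  obtain ⟨c, hc0, hc⟩ : ∃ c > 0, c ≤ min (min (ε / 2) (Real.pi / 2))
      ((Real.pi / 2 + δ - ψ) / 2) :=
    ⟨_, lt_min (lt_min (by linarith) (by linarith)) (by linarith), le_rfl⟩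
  rw [le_min_iff, le_min_iff] at hc
  obtain ⟨⟨hcε, hcpi⟩, hcψ⟩ := hc
  set m := Real.sin c with hm
  have hm0 : 0 < m := Real.sin_pos_of_pos_of_lt_pi hc0 (by linarith)
  have hI₁ : Set.Icc (-θ - Real.pi - δ + c) (-θ - Real.pi + ε - c) ⊆ bankArgs θ δ ε :=
    fun φ hφ => Or.inl ⟨by linarith [hφ.1], by linarith [hφ.2]⟩
  have hI₂ : Set.Icc (-θ + Real.pi - ε + c) (-θ + Real.pi + δ - c) ⊆ bankArgs θ δ ε :=
    fun φ hφ => Or.inr ⟨by linarith [hφ.1], by linarith [hφ.2]⟩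
  obtain ⟨K, hK, D, hD, B, t₀, ht₀, ht₀r, hrem⟩ :=
    exists_remainder_bound ha hS hsupp hJ hr hsum hf hI₁ hI₂
  set W := 2 * Real.pi + 2 * δ with hW
  set K' := K * (4 / m + Real.exp 3 * W) with hK'
  have hK'0 : 0 < K' := by positivity
  set D' := D * (1 + 2 / m) with hD'
  have hD'0 : 0 < D' := by positivity
  refine ⟨max 1 (max (4 / m) (1 / t₀)), by positivity, B + 1, by positivity, (K' + 1) * D',
    by positivity, fun u hu huψ N hN => ?_⟩
  set X := Real.exp u.re with hX
  have hX1 : 1 ≤ X := (le_max_left _ _).trans hu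
  have hX0 : 0 < X := by linarith
  have hX4 : 4 ≤ m * X := by
    have := ((le_max_left _ _).trans (le_max_right _ _)).trans hu
    rw [div_le_iff₀ hm0] at this
    linarith
  have hXt : X⁻¹ ≤ t₀ := by
    have := ((le_max_right _ _).trans (le_max_right _ _)).trans hu
    rw [one_div] at this
    exact inv_le_of_inv_le₀ ht₀ this
  have hXi : 0 < X⁻¹ := by positivity
  have hu' : |u.im - θ| < Real.pi / 2 + δ := huψ.trans_lt hψ
  obtain ⟨φ₁, φ₂, h₁, d₁, h₂, d₂⟩ := exists_args (θ := θ) (c := c) (y := u.im) hδ hδε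
    (by linarith) hcpi (by linarith)
  have hadm : AdmissibleArgs θ δ ε u φ₁ φ₂ :=
    ⟨by linarith [h₁.1], by linarith [h₁.2], by linarith, by linarith [h₂.1],
      by linarith [h₂.2], by linarith⟩
  have hQ₁ := hadm.mem_disc₁ hu'
  have hQ₂ := hadm.mem_disc₂ hu'
  have hcos₁ : Real.cos (u.im + φ₁) ≤ -m := by
    have := cos_le_neg_sin_of_abs_le hc0.le d₁
    rw [Real.cos_add_pi] at this
    linarith
  have hcos₂ : Real.cos (u.im + φ₂) ≤ -m := by
    have := cos_le_neg_sin_of_abs_le hc0.le d₂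
    rw [Real.cos_sub_pi] at this
    linarith
  have hdiff : Complex.exp (-(ρ * Complex.exp u)) * F u -
      ∑ α ∈ S, ∑ n ∈ Finset.range N, infTerm (gammaOpInf (laplaceFin a)) u (α + n) =
      Complex.exp (-(ρ * Complex.exp u)) *
        hankelIntegral (fun w => f w - truncation a S N w) ρ u X⁻¹ φ₁ φ₂ := by
    rw [hankelIntegral_sub (hadm.hankelIntegrable hu' hf ρ hXi (hXt.trans_lt ht₀r))
      (hankelIntegrable_truncation a S N ρ hXi hadm.decay₁ hadm.decay₂),
      hF u hu' _ _ _ hXi (hXt.trans_lt ht₀r) hadm,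
      hankelIntegral_truncation a S N ρ hXi hadm.decay₁ hadm.decay₂, mul_sub, ← mul_assoc,
      ← Complex.exp_add, mul_comm ρ, neg_add_cancel, Complex.exp_zero, one_mul]
  have hbound := norm_hankelIntegral_le (g := fun w => f w - truncation a S N w) ρ (B := B)
    (N := N) (W := W) hX hm0 hK.le hD hX1 hX4 hcos₁ hcos₂ (fun t ht φ hφ => by
      rcases hφ with rfl | rfl
      · exact hrem N t _ (hXi.trans_le ht) hQ₁ (Or.inr (Or.inl h₁))
      · exact hrem N t _ (hXi.trans_le ht) hQ₂ (Or.inr (Or.inr h₂)))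
    (fun φ hφ => hrem N _ _ hXi (Set.ordConnected_Ioo.uIcc_subset hQ₁ hQ₂ hφ) (Or.inl hXt))
    (by
      rw [hW, abs_le]
      constructor <;> linarith [hQ₁.1, hQ₁.2, hQ₂.1, hQ₂.2])
  rw [hdiff, norm_mul]
  have hE : ‖Complex.exp (-(ρ * Complex.exp u))‖ * ‖Complex.exp (Complex.exp u * ρ)‖ = 1 := by
    rw [← norm_mul, ← Complex.exp_add, mul_comm ρ, neg_add_cancel, Complex.exp_zero, norm_one]
  refine (mul_le_mul_of_nonneg_left hbound (norm_nonneg _)).trans ?_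
  rw [← mul_assoc, hE, one_mul, ← hK', ← hD']
  have hpow : X ^ ((B : ℝ) + 1 - N) = X ^ (B + 1) / X ^ N := by
    rw [Real.rpow_sub hX0, Real.rpow_natCast, ← Nat.cast_add_one, Real.rpow_natCast]
  rw [hpow]
  have hK'N : K' ≤ (K' + 1) ^ N :=
    (by linarith : K' ≤ K' + 1).trans (le_self_pow₀ (by linarith) (by omega))
  have hXB : X ^ B ≤ X ^ (B + 1) := pow_le_pow_right₀ hX1 (Nat.le_succ B)
  rw [mul_pow (K' + 1)]
  gcongr

/-- The function defined by the Hankel integrals around a finite point. -/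
theorem exists_hankel_function {θ δ ε r : ℝ} (hr : 0 < r) (hδ : 0 ≤ δ) (hδε : δ ≤ ε)
    (hε : 0 < ε) (ρ : ℂ) {f : ℂ → ℂ} (hf : HankelDomain f r (bankArgs θ δ ε) (discArgs θ δ)) :
    ∃ F : ℂ → ℂ, (∀ u : ℂ, |u.im - θ| < Real.pi / 2 + δ → ∀ κ φ₁ φ₂ : ℝ, 0 < κ → κ < r →
      AdmissibleArgs θ δ ε u φ₁ φ₂ → hankelIntegral f ρ u κ φ₁ φ₂ = F u) ∧
      ∀ u : ℂ, |u.im - θ| < Real.pi / 2 + δ → DifferentiableAt ℂ F u := by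
  have hex : ∀ u : ℂ, ∃ p : ℝ × ℝ, |u.im - θ| < Real.pi / 2 + δ →
      AdmissibleArgs θ δ ε u p.1 p.2 := fun u => by
    by_cases h : |u.im - θ| < Real.pi / 2 + δ
    · obtain ⟨φ₁, φ₂, hφ⟩ := exists_admissibleArgs hδ hδε hε h
      exact ⟨(φ₁, φ₂), fun _ => hφ⟩
    · exact ⟨0, fun h' => absurd h' h⟩
  choose p hp using hex
  have hr2 : 0 < r / 2 := by linarith
  have hF : ∀ u : ℂ, |u.im - θ| < Real.pi / 2 + δ → ∀ κ φ₁ φ₂ : ℝ, 0 < κ → κ < r →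
      AdmissibleArgs θ δ ε u φ₁ φ₂ →
      hankelIntegral f ρ u κ φ₁ φ₂ = hankelIntegral f ρ u (r / 2) (p u).1 (p u).2 :=
    fun u hu κ φ₁ φ₂ hκ hκr hφ =>
      hφ.hankelIntegral_eq (hp u hu) hu hf ρ hκ hκr hr2 (by linarith)
  refine ⟨fun u => hankelIntegral f ρ u (r / 2) (p u).1 (p u).2, hF, fun u hu => ?_⟩
  have hφ := hp u hu
  have hd : DifferentiableAt ℂ (fun v => hankelIntegral f ρ v (r / 2) (p u).1 (p u).2) u :=
    hf.differentiableAt_hankelIntegral ρ hr2 (by linarith) (hφ.mem_disc₁ hu) (hφ.mem_disc₂ hu)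
      hφ.mem_bank₁ hφ.mem_bank₂ (cos_neg_of_abs_add_pi_lt hφ.decay₁)
      (cos_neg_of_abs_sub_pi_lt hφ.decay₂)
  refine hd.congr_of_eventuallyEq ?_
  have hopen : ∀ᶠ v : ℂ in 𝓝 u, |v.im - θ| < Real.pi / 2 + δ :=
    (isOpen_lt (by fun_prop) continuous_const).mem_nhds hu
  filter_upwards [hopen, hφ.eventually] with v hv hadm
  exact (hF v hv (r / 2) _ _ hr2 (by linarith) hadm).symm

theorem mainTheorem11 :
    -- Hankel integral at a finite point
    (∀ (ρ : ℂ) (θ : ℝ) (a : ℂ → Polynomial ℂ) (f : ℂ → ℂ) (r δ ε : ℝ),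
      IsNilsson a → 0 < r → 0 ≤ δ → δ ≤ ε → 0 < ε →
      (∀ w ∈ punctDisc θ δ r, HasSum (finTerm a w) (f w)) →
      DifferentiableOn ℂ f (punctDisc θ δ r ∪ bankSectors θ δ ε) →
      (∀ η > (0 : ℝ), ∃ c > (0 : ℝ), ∀ w ∈ bankSectors θ δ ε,
        ‖ρ‖ + 1 ≤ ‖ρ + Complex.exp w‖ → ‖f w‖ ≤ c * Real.exp (η * ‖ρ + Complex.exp w‖)) →
      ∃ F : ℂ → ℂ,
        (∀ u : ℂ, |u.im - θ| < Real.pi / 2 + δ → ∀ κ φ₁ φ₂ : ℝ, 0 < κ → κ < r →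
          -θ - Real.pi - δ < φ₁ → φ₁ < -θ - Real.pi + ε → |u.im + φ₁ + Real.pi| < Real.pi / 2 →
          -θ + Real.pi - ε < φ₂ → φ₂ < -θ + Real.pi + δ → |u.im + φ₂ - Real.pi| < Real.pi / 2 →
            MeasureTheory.IntegrableOn (rayIntegrand f ρ u φ₁) (Set.Ioi κ) ∧
            MeasureTheory.IntegrableOn (rayIntegrand f ρ u φ₂) (Set.Ioi κ) ∧
            hankelIntegral f ρ u κ φ₁ φ₂ = F u) ∧
        ∀ ψ < Real.pi / 2 + δ, HasAsympExpansion F ρ (gammaOpInf (laplaceFin a)) θ ψ) ∧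
    -- circle integral at infinity
    (∀ (θ : ℝ) (a : ℂ → Polynomial ℂ), IsNilsson a →
      IsLogSeries (gammaOpZero (laplaceInf a)) ∧
      (∀ (α : ℂ) (j : ℕ), IsEntireSeries fun n => (gammaOpZero (laplaceInf a) (α + n)).coeff j) ∧
      (∃ R₀ > (0 : ℝ), ∀ w : ℂ, R₀ < Real.exp w.re → Summable (infTerm a w)) ∧
      ∀ u : ℂ, |u.im - θ| < Real.pi / 2 →
        Summable (finTerm (gammaOpZero (laplaceInf a)) u) ∧
        Tendsto
          (fun R : ℝ => (2 * Complex.I * Real.pi)⁻¹ *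
            arcIntegral (fun w => ∑' β, infTerm a w β) 0 u R (-θ - Real.pi) (-θ + Real.pi))
          atTop (𝓝 (∑' β, finTerm (gammaOpZero (laplaceInf a)) u β))) := by
  refine ⟨fun ρ θ a f r δ ε ha hr hδ hδε hε hsum hdiff hgrow => ?_, fun θ a ha =>
    ⟨isLogSeries_gammaOpZero_laplaceInf ha.1, isEntireSeries_gammaOpZero_laplaceInf ha,
      ha.exists_summable_infTerm, fun u hu => ha.tendsto_arcIntegral hu⟩⟩
  have hf : HankelDomain f r (bankArgs θ δ ε) (discArgs θ δ) := hankelDomain_of_growth hdiff hgrow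
  obtain ⟨F, hF, hFd⟩ := exists_hankel_function hr hδ hδε hε ρ hf
  refine ⟨F, fun u hu κ φ₁ φ₂ hκ hκr l₁ u₁ d₁ l₂ u₂ d₂ => ?_, fun ψ hψ => ?_⟩
  · have hadm : AdmissibleArgs θ δ ε u φ₁ φ₂ := ⟨l₁, u₁, d₁, l₂, u₂, d₂⟩
    have hint := hadm.hankelIntegrable hu hf ρ hκ hκr
    exact ⟨hint.ray₁, hint.ray₂, hF u hu κ φ₁ φ₂ hκ hκr hadm⟩
  · obtain ⟨S, J, hS, hsupp, hJ⟩ := ha.1.exists_normalized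
    obtain ⟨R, hR, B, hB, C, hC, hbound⟩ :=
      exists_asymp_bound ha hS hsupp hJ ρ hr hδ hδε hε hsum hf hF hψ
    refine ⟨S, hS, fun β hβ => hsupp β fun h0 => hβ ?_, R, hR, B, hB, C, hC, fun u hu => ?_, hbound⟩
    · rw [gammaOpInf_laplaceFin, h0, map_zero]
    · exact (hFd u (hu.2.trans_lt hψ)).differentiableWithinAt
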